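/- **Setting.** Let $F\subset \mathrm{Sym}(\mathbb R^n)$ be a closed convex set of symmetric $n\times n$ matrices such that $F+\mathcal P\subset F$, where $\mathcal P=\{A\ge 0\}$; $tF\subset F$ for all $t\ge 0$; and $F$ is invariant under $A\mapsto gAg^{t}$ for all $g$ in some subgroup $G\subset \mathrm O(n)$ acting transitively on $S^{n-1}$. Assume that $F$ has finite Riesz characteristic $$p=\sup\{q\in\mathbb R:\ P_{e^\perp}-(q-1)P_e\in F\}<\infty ,$$ where $P_e$ and $P_{e^\perp}=I-P_e$ are the orthogonal projections onto the line spanned by a unit vector $e$ and onto its orthogonal complement (by invariance the choice of $e$ does not matter). Let $X\subset\mathbb R^n$ be a connected open neighbourhood of $x_0$ and let $u:X\to[-\infty,\infty)$, $u\not\equiv-\infty$, be $F$-subharmonic: $u$ is upper semicontinuous, and $D^2_x\varphi\in F$ whenever $x\in X$, $\varphi$ is $C^2$ near $x$, $u\le\varphi$ near $x$ and $u(x)=\varphi(x)$. For small $r>0$ put $$M(r)=\sup_{|x|\le 1}u(x_0+rx),\qquad S(r)=\frac1{|S^{n-1}|}\int_{S^{n-1}}u(x_0+r\sigma)\,d\sigma,\qquad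 V(r)=\frac1{|B|}\int_{B}u(x_0+rx)\,dx ,$$ where $B$ is the closed unit ball. Let $K(t)=t^{2-p}$ if $p<2$, $K(t)=\log t$ if $p=2$, and $K(t)=-1/t^{p-2}$ if $p>2$. For $\Psi=M,S,V$ let $$\Theta^\Psi=\lim_{\substack{r,s\to0\\ 0<s<r}}\frac{\Psi(r)-\Psi(s)}{K(r)-K(s)} .$$ For a Borel measure $\mu\ge0$ on $X$, finite on compact subsets of $X$, let $$\Theta^{k}(\mu)=\lim_{r\downarrow0}\frac{\mu(\{|x-x_0|\le r\})}{\alpha(k)\,r^{k}},\qquad \alpha(k)=\frac{\pi^{k/2}}{\Gamma(k/2+1)} .$$ **Statement.** The averages $M(r),S(r),V(r)$ are finite for all small $r>0$; $u\in L^1_{\rm loc}(X)$; and the distributional Laplacian $\mu=\Delta u$ is a non-negative measure on $X$, finite on compact subsets of $X$. The four densities $\Theta^M,\Theta^S,\Theta^V,\Theta^{n-p}(\mu)$ exist as real numbers, and the following hold. 1. (Proposition 7.1) If $p\ne2$, then $$\Theta^S=\frac{n-p+2}{n}\,\Theta^V=\frac{\alpha(n-p)}{n\,|p-2|\,\alpha(n)}\,\Theta^{n-p}(\mu);$$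 if $p=2$, then $$\Theta^S=\Theta^V=\frac{\alpha(n-2)}{n\,\alpha(n)}\,\Theta^{n-2}(\mu).$$ 2. (Proposition 7.2) There is a constant $C=C(p,n)>1$, depending only on $p$ and $n$, such that $$\Theta^M\le\Theta^S\le C\,\Theta^M\quad\text{if }p>2,\qquad \Theta^S\le\Theta^M\le C\,\Theta^S\quad\text{if }1<p<2,\qquad \Theta^M=\Theta^S\quad\text{if }p=2.$$ -/

import Mathlib

open Set Filter Topology MeasureTheory
open scoped ContDiff Matrix

noncomputable section

namespace RieszDensity

/-! ### Subequations and the Riesz characteristic -/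

/-- A (pure second order, constant coefficient) subequation: a closed set of symmetric matrices
which is stable under the addition of positive semidefinite matrices. -/
structure IsSubequation {n : ℕ} (F : Set (Matrix (Fin n) (Fin n) ℝ)) : Prop where
  symm : ∀ A ∈ F, A.IsSymm
  closed : IsClosed F
  positivity : ∀ A ∈ F, ∀ P : Matrix (Fin n) (Fin n) ℝ, P.PosSemidef → A + P ∈ F

/-- The cone property: `t F ⊆ F` for all `t ≥ 0`. -/
def IsConeSet {n : ℕ} (F : Set (Matrix (Fin n) (Fin n) ℝ)) : Prop :=
  ∀ t : ℝ, 0 ≤ t → ∀ A ∈ F, t • A ∈ F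

/-- Spherical transitivity: `F` is invariant under (the action `A ↦ g A gᵀ` of) some subgroup of
`O(n)` which acts transitively on the unit sphere. -/
def IsSTInvariant {n : ℕ} (F : Set (Matrix (Fin n) (Fin n) ℝ)) : Prop :=
  ∃ G : Subgroup (Matrix.orthogonalGroup (Fin n) ℝ),
    (∀ v w : EuclideanSpace ℝ (Fin n), ‖v‖ = 1 → ‖w‖ = 1 →
      ∃ g ∈ G, (g : Matrix (Fin n) (Fin n) ℝ) *ᵥ v.ofLp = w.ofLp) ∧
    ∀ g ∈ G, ∀ A ∈ F,
      (g : Matrix (Fin n) (Fin n) ℝ) * A * (g : Matrix (Fin n) (Fin n) ℝ)ᵀ ∈ F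

/-- The matrix of the orthogonal projection onto the line spanned by a unit vector `e`. -/
def lineProj {n : ℕ} (e : EuclideanSpace ℝ (Fin n)) : Matrix (Fin n) (Fin n) ℝ :=
  Matrix.vecMulVec e.ofLp e.ofLp

/-- `F` has the finite (increasing) Riesz characteristic `p`: the real number `p` is the supremum
of the `q` with `P_{e^⊥} - (q - 1) P_e ∈ F`, for unit vectors `e`. (For an ST-invariant `F` this
membership does not depend on `e`. There is no such real `p` if the supremum is `+∞`.) -/
def IsRieszCharacteristic {n : ℕ} (F : Set (Matrix (Fin n) (Fin n) ℝ)) (p : ℝ) : Prop :=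
  IsLUB {q : ℝ | ∀ e : EuclideanSpace ℝ (Fin n), ‖e‖ = 1 →
    (1 - lineProj e) - (q - 1) • lineProj e ∈ F} p

/-! ### Viscosity subsolutions -/

/-- The Hessian matrix of `φ` at `x`. -/
def hessian {n : ℕ} (φ : EuclideanSpace ℝ (Fin n) → ℝ) (x : EuclideanSpace ℝ (Fin n)) :
    Matrix (Fin n) (Fin n) ℝ :=
  Matrix.of fun i j =>
    iteratedFDeriv ℝ 2 φ x ![EuclideanSpace.single i 1, EuclideanSpace.single j 1]

/-- `u : X → [-∞, ∞)` is `F`-subharmonic on the open set `X`: it is upper semicontinuous, and each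
function `φ` which is `C²` near a point `x` of `X` and touches `u` from above at `x` has its
Hessian at `x` in `F`. -/
structure IsSubharmonicOn {n : ℕ} (F : Set (Matrix (Fin n) (Fin n) ℝ))
    (u : EuclideanSpace ℝ (Fin n) → EReal) (X : Set (EuclideanSpace ℝ (Fin n))) : Prop where
  ne_top : ∀ x ∈ X, u x ≠ ⊤
  usc : UpperSemicontinuousOn u X
  viscosity : ∀ x ∈ X, ∀ φ : EuclideanSpace ℝ (Fin n) → ℝ, ContDiffAt ℝ 2 φ x →
    (∀ᶠ y in 𝓝 x, u y ≤ (φ y : EReal)) → u x = (φ x : EReal) → hessian φ x ∈ F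

/-! ### Averages -/

/-- The maximum `M(u, x₀; r)` of `u` over the ball `|x - x₀| ≤ r`, as an extended real. -/
def ballSup {n : ℕ} (u : EuclideanSpace ℝ (Fin n) → EReal) (x₀ : EuclideanSpace ℝ (Fin n))
    (r : ℝ) : EReal :=
  ⨆ x ∈ Metric.closedBall (0 : EuclideanSpace ℝ (Fin n)) 1, u (x₀ + r • x)

/-- The surface measure on the unit sphere. -/
def sphereMeasure (n : ℕ) : Measure (Metric.sphere (0 : EuclideanSpace ℝ (Fin n)) 1) :=
  (volume : Measure (EuclideanSpace ℝ (Fin n))).toSphere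

/-- The maximum `M(u, x₀; r)` as a real number. -/
def maxMean {n : ℕ} (u : EuclideanSpace ℝ (Fin n) → EReal) (x₀ : EuclideanSpace ℝ (Fin n))
    (r : ℝ) : ℝ :=
  (ballSup u x₀ r).toReal

/-- The spherical average `S(u, x₀; r)`. -/
def sphereMean {n : ℕ} (u : EuclideanSpace ℝ (Fin n) → EReal) (x₀ : EuclideanSpace ℝ (Fin n))
    (r : ℝ) : ℝ :=
  ⨍ σ : Metric.sphere (0 : EuclideanSpace ℝ (Fin n)) 1,
    (u (x₀ + r • (σ : EuclideanSpace ℝ (Fin n)))).toReal ∂(sphereMeasure n)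

/-- The volume average `V(u, x₀; r)`. -/
def volumeMean {n : ℕ} (u : EuclideanSpace ℝ (Fin n) → EReal) (x₀ : EuclideanSpace ℝ (Fin n))
    (r : ℝ) : ℝ :=
  ⨍ x in Metric.closedBall (0 : EuclideanSpace ℝ (Fin n)) 1, (u (x₀ + r • x)).toReal

/-- The three averages at radius `r` are finite: the supremum is a real number, and `u` is
almost everywhere finite and integrable on the sphere and on the ball of radius `r` about `x₀`.
Then none of `maxMean`, `sphereMean`, `volumeMean` involves a default value. -/
structure MeansFinite {n : ℕ} (u : EuclideanSpace ℝ (Fin n) → EReal)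
    (x₀ : EuclideanSpace ℝ (Fin n)) (r : ℝ) : Prop where
  sup_ne_bot : ballSup u x₀ r ≠ ⊥
  sup_ne_top : ballSup u x₀ r ≠ ⊤
  sphere_ne_bot : ∀ᵐ σ : Metric.sphere (0 : EuclideanSpace ℝ (Fin n)) 1 ∂(sphereMeasure n),
    u (x₀ + r • (σ : EuclideanSpace ℝ (Fin n))) ≠ ⊥
  sphere_integrable : Integrable
    (fun σ : Metric.sphere (0 : EuclideanSpace ℝ (Fin n)) 1 =>
      (u (x₀ + r • (σ : EuclideanSpace ℝ (Fin n)))).toReal) (sphereMeasure n)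
  ball_ne_bot : ∀ᵐ x ∂(volume.restrict (Metric.closedBall (0 : EuclideanSpace ℝ (Fin n)) 1)),
    u (x₀ + r • x) ≠ ⊥
  ball_integrable : IntegrableOn (fun x => (u (x₀ + r • x)).toReal)
    (Metric.closedBall (0 : EuclideanSpace ℝ (Fin n)) 1) volume

/-! ### Densities -/

/-- The Riesz kernel `K_p(t)`, `t > 0`: it is `t^(2-p)` for `p < 2`, `log t` for `p = 2`, and
`-1 / t^(p-2)` for `p > 2`. -/
def rieszKernel (p t : ℝ) : ℝ :=
  if p < 2 then t ^ (2 - p) else if p = 2 then Real.log t else -(1 / t ^ (p - 2))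

/-- `Θ` is the limit of `(ψ(r) - ψ(s)) / (K_p(r) - K_p(s))` as `r, s → 0` with `0 < s < r`. -/
def HasRieszDensity (p : ℝ) (ψ : ℝ → ℝ) (Θ : ℝ) : Prop :=
  Tendsto (fun q : ℝ × ℝ => (ψ q.2 - ψ q.1) / (rieszKernel p q.2 - rieszKernel p q.1))
    (𝓝[{q : ℝ × ℝ | 0 < q.1 ∧ q.1 < q.2}] (0, 0)) (𝓝 Θ)

/-- The constant `α(k) = π^(k/2) / Γ(k/2 + 1)`, which for an integer `k` is the volume of the unit
ball of `ℝ^k`. -/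
def alpha (k : ℝ) : ℝ :=
  Real.pi ^ (k / 2) / Real.Gamma (k / 2 + 1)

/-- `Θ` is the `k`-dimensional mass density of `μ` at `x₀`, the limit of
`μ(B_r(x₀)) / (α(k) r^k)` as `r` decreases to `0`. -/
def HasMassDensity {n : ℕ} (k : ℝ) (μ : Measure (EuclideanSpace ℝ (Fin n)))
    (x₀ : EuclideanSpace ℝ (Fin n)) (Θ : ℝ) : Prop :=
  Tendsto (fun r : ℝ => (μ (Metric.closedBall x₀ r)).toReal / (alpha k * r ^ k))
    (𝓝[>] 0) (𝓝 Θ)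

/-- `u` is a locally integrable function on the open set `X`, finite almost everywhere. -/
def IsLocallyIntegrableOn {n : ℕ} (u : EuclideanSpace ℝ (Fin n) → EReal)
    (X : Set (EuclideanSpace ℝ (Fin n))) : Prop :=
  (∀ᵐ x ∂(volume.restrict X), u x ≠ ⊥ ∧ u x ≠ ⊤) ∧
    LocallyIntegrableOn (fun x => (u x).toReal) X volume

/-- `Δu = μ` on `X` in the sense of distributions, where `μ ≥ 0` is a Borel measure which is finite
on the compact subsets of `X`. (Only the restriction of `μ` to `X` matters.) -/
structure IsLaplacianOn {n : ℕ} (u : EuclideanSpace ℝ (Fin n) → EReal)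
    (X : Set (EuclideanSpace ℝ (Fin n))) (μ : Measure (EuclideanSpace ℝ (Fin n))) : Prop where
  finite_on_compacts : ∀ K : Set (EuclideanSpace ℝ (Fin n)), IsCompact K → K ⊆ X → μ K < ⊤
  integral_eq : ∀ φ : EuclideanSpace ℝ (Fin n) → ℝ, ContDiff ℝ ∞ φ → HasCompactSupport φ →
    tsupport φ ⊆ X →
    ∫ x, (u x).toReal * Laplacian.laplacian φ x = ∫ x, φ x ∂μ

end RieszDensity

end

noncomputable section

namespace RieszDensity

variable {n : ℕ}

/-! ### Calculus of Hessians -/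

/-! The kernel is made so that the Hessian of `K_p(|x|)` is a positive multiple of `P_{e^⊥} - (p-1)
P_e`, `e = x/|x|`, a boundary matrix of `F`. Subtracting `ε|x|²` turns it into a strict
supersolution, and comparison on annuli shows that `M` is an increasing convex function of `K_p`
(`FSub.kernelConvex_radialMax`).

The same argument serves for `S`. Let a compact group of rotations preserving `F` and transitive on
the sphere act on a subsolution `v`, and average over its Haar measure. The average is radial and
equals the spherical mean of `v`; because `F` is convex it is again a subsolution
(`FSub.of_rotationMean`), so its maximum over a ball is `S` (`FSub.kernelConvex_sphereAverage`).
Convexity of `F` enters through separation: a symmetric matrix outside `F` is detected by some `M ↦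
tr(Cᵗ M C)` with `C` invertible which is nonnegative on `F`. For such a constant coefficient
operator the viscosity condition implies a mean value inequality over small ellipsoids, and mean
value inequalities, being linear in `v`, survive averaging.

Averaging over the group also shows that matrices in `F` have nonnegative trace
(`Admissible.trace_nonneg`). Hence subsolutions are subharmonic in the viscosity sense. The maximum
principle, harmonic polynomials and polynomial approximation on the sphere give the sub-mean value
inequality, and from it follow local integrability and, with the Riesz extension and representation
theorems, the measure `Δu ≥ 0`. All inequalities are first proved for the bounded truncations
`max(u, -N)` and passed to the limit.

Convexity makes the slopes of `M` and `S` with respect to `K_p` decrease to limits at `0`. The other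
densities are multiples of `Θ^S`. For `V` one integrates `S` in polar coordinates and uses that
`K_p(tr) - K_p(ts)` scales by `t^(2-p)`. For the mass one tests `Δu` against radial cut-offs and
integrates by parts in the radius, which compares `μ(B_r)` with `r^(n-p)`.

For the comparison of `Θ^M` with `Θ^S`, one inequality comes from `S ≤ M`. The other comes from a
Harnack inequality bounding `M(lr) - M(r)` by a multiple of `V((1-2l)r) - M(r)`: normalise by
`K_p(r)`, let `r → 0`, and choose `l`. For `p = 2` all powers `l^(2-p)` are `1` and equality
results; for `1 < p < 2` the choice of `l` is delicate (`exists_radius_ratio`). -/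

/-- Euclidean space. -/
abbrev Eu (n : ℕ) := EuclideanSpace ℝ (Fin n)

/-- The second derivative as a bilinear form. -/
abbrev d2 {n : ℕ} (φ : Eu n → ℝ) (x : Eu n) : Eu n →L[ℝ] Eu n →L[ℝ] ℝ :=
  fderiv ℝ (fderiv ℝ φ) x

/-- The bilinear pairing `∑ Bᵢⱼ Aᵢⱼ` of matrices. -/
def pair {n : ℕ} (B A : Matrix (Fin n) (Fin n) ℝ) : ℝ := ∑ i, ∑ j, B i j * A i j

theorem hessian_apply (φ : Eu n → ℝ) (x : Eu n) (i j : Fin n) :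
    hessian φ x i j = d2 φ x (EuclideanSpace.single i 1) (EuclideanSpace.single j 1) := by
  simp [hessian, iteratedFDeriv_two_apply]

theorem sum_coord_single (v : Eu n) : v = ∑ i, v i • EuclideanSpace.single i (1 : ℝ) := by
  ext j
  simp [Pi.single_apply]

theorem d2_apply (φ : Eu n → ℝ) (x v w : Eu n) :
    d2 φ x v w = ∑ i, ∑ j, v i * w j * hessian φ x i j := by
  conv_lhs => rw [sum_coord_single v, sum_coord_single w]
  simp only [map_sum, map_smul, _root_.sum_apply, _root_.smul_apply,
    smul_eq_mul, hessian_apply, Finset.mul_sum]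
  rw [Finset.sum_comm]
  refine Finset.sum_congr rfl fun i _ => Finset.sum_congr rfl fun j _ => by ring

theorem laplacian_eq_trace_hessian (φ : Eu n → ℝ) (x : Eu n) :
    Laplacian.laplacian φ x = (hessian φ x).trace := by
  rw [InnerProductSpace.laplacian_eq_iteratedFDeriv_orthonormalBasis φ
    (EuclideanSpace.basisFun (Fin n) ℝ)]
  simp [Matrix.trace, hessian]

theorem hessian_isSymm {φ : Eu n → ℝ} {x : Eu n} (h : ContDiffAt ℝ 2 φ x) :
    (hessian φ x).IsSymm := by
  ext i j
  rw [Matrix.transpose_apply, hessian_apply, hessian_apply]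
  exact (h.isSymmSndFDerivAt (by simp)) _ _

theorem differentiableAt_fderiv_two {φ : Eu n → ℝ} {x : Eu n} (h : ContDiffAt ℝ 2 φ x) :
    DifferentiableAt ℝ (fderiv ℝ φ) x :=
  (h.fderiv_right (m := 1) (by norm_num)).differentiableAt (by norm_num)

theorem eventually_differentiableAt_of_contDiffAt {φ : Eu n → ℝ} {x : Eu n}
    (h : ContDiffAt ℝ 2 φ x) : ∀ᶠ y in 𝓝 x, DifferentiableAt ℝ φ y := by
  filter_upwards [h.eventually (by simp)] with y hy
  exact hy.differentiableAt (by norm_num)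

/-- The Hessian is determined by a first and a second derivative given as such. -/
theorem hessian_eq_of_hasFDerivAt {φ : Eu n → ℝ} {φ' : Eu n → Eu n →L[ℝ] ℝ} {x : Eu n}
    {φ'' : Eu n →L[ℝ] Eu n →L[ℝ] ℝ} (h : ∀ᶠ y in 𝓝 x, HasFDerivAt φ (φ' y) y)
    (h' : HasFDerivAt φ' φ'' x) (i j : Fin n) :
    hessian φ x i j = φ'' (EuclideanSpace.single i 1) (EuclideanSpace.single j 1) := by
  rw [hessian_apply, d2]
  have : fderiv ℝ φ =ᶠ[𝓝 x] φ' := h.mono fun y hy => hy.fderiv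
  rw [this.fderiv_eq, h'.fderiv]

theorem hessian_add {φ ψ : Eu n → ℝ} {x : Eu n} (h : ContDiffAt ℝ 2 φ x)
    (h' : ContDiffAt ℝ 2 ψ x) :
    hessian (fun y => φ y + ψ y) x = hessian φ x + hessian ψ x := by
  ext i j
  have : (fun y => φ y + ψ y) = φ + ψ := rfl
  simp only [hessian, Matrix.of_apply, Matrix.add_apply, this]
  rw [iteratedFDeriv_add_apply h h']; rfl

theorem hessian_const (c : ℝ) (x : Eu n) : hessian (fun _ => c) x = 0 := by
  ext i j
  simp [hessian, iteratedFDeriv_const_of_ne]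

theorem hessian_neg (φ : Eu n → ℝ) (x : Eu n) :
    hessian (fun y => - φ y) x = - hessian φ x := by
  ext i j
  have : (fun y => - φ y) = - φ := rfl
  simp [hessian, this, iteratedFDeriv_neg_apply]

/-- Behaviour of Hessians under an affine change of variables. -/
theorem hessian_comp_affine {φ : Eu n → ℝ} (L : Eu n →L[ℝ] Eu n) (a y : Eu n)
    (h : ContDiffAt ℝ 2 φ (a + L y)) :
    hessian (fun z => φ (a + L z)) y =
      (Matrix.of fun i j => (L (EuclideanSpace.single j 1)) i)ᵀ * hessian φ (a + L y) *
        (Matrix.of fun i j => (L (EuclideanSpace.single j 1)) i) := by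
  have hA : ∀ z, HasFDerivAt (fun z => a + L z) L z := fun z => L.hasFDerivAt.const_add a
  have hc : Tendsto (fun z => a + L z) (𝓝 y) (𝓝 (a + L y)) := (hA y).continuousAt
  have h1 : ∀ᶠ z in 𝓝 y, HasFDerivAt (fun z => φ (a + L z)) ((fderiv ℝ φ (a + L z)).comp L) z := by
    filter_upwards [hc.eventually (eventually_differentiableAt_of_contDiffAt h)] with z hz
    exact hz.hasFDerivAt.comp z (hA z)
  have h2 : HasFDerivAt (fun z => (fderiv ℝ φ (a + L z)).comp L)
      (((ContinuousLinearMap.compL ℝ (Eu n) (Eu n) ℝ).flip L).comp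
        ((d2 φ (a + L y)).comp L)) y :=
    ((ContinuousLinearMap.compL ℝ (Eu n) (Eu n) ℝ).flip L).hasFDerivAt.comp y
      ((differentiableAt_fderiv_two h).hasFDerivAt.comp y (hA y))
  ext i j
  rw [hessian_eq_of_hasFDerivAt h1 h2]
  simp only [ContinuousLinearMap.comp_apply, ContinuousLinearMap.flip_apply,
    ContinuousLinearMap.compL_apply, d2_apply, Matrix.mul_apply, Matrix.transpose_apply,
    Matrix.of_apply, Finset.sum_mul]
  rw [Finset.sum_comm]
  refine Finset.sum_congr rfl fun i _ => Finset.sum_congr rfl fun j _ => by ring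

/-- Radial functions are written in the variable `|x|²`, which is smooth at the origin too. This
computes both the barriers built from the Riesz kernel and the Laplacians of radial cut-offs. -/
theorem hessian_comp_normSq {f f' : ℝ → ℝ} {f'' : ℝ} {x : Eu n}
    (h : ∀ᶠ t in 𝓝 (‖x‖ ^ 2), HasDerivAt f (f' t) t) (h' : HasDerivAt f' f'' (‖x‖ ^ 2)) :
    hessian (fun y => f (‖y‖ ^ 2)) x =
      (2 * f' (‖x‖ ^ 2)) • (1 : Matrix (Fin n) (Fin n) ℝ) + (4 * f'') • Matrix.vecMulVec x.ofLp x.ofLp := by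
  let ip : Eu n →L[ℝ] Eu n →L[ℝ] ℝ := (2 : ℝ) • innerSL ℝ
  have hip : ∀ v w, ip v w = 2 * inner ℝ v w := fun v w => rfl
  have hN : ∀ z : Eu n, HasFDerivAt (fun z : Eu n => ‖z‖ ^ 2) (ip z) z := fun z =>
    (hasStrictFDerivAt_norm_sq z).hasFDerivAt.congr_fderiv (by
      ext w; rw [hip, two_smul, two_mul]; rfl)
  have hc : Tendsto (fun z : Eu n => ‖z‖ ^ 2) (𝓝 x) (𝓝 (‖x‖ ^ 2)) := (hN x).continuousAt
  have h1 : ∀ᶠ z in 𝓝 x, HasFDerivAt (fun y : Eu n => f (‖y‖ ^ 2))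
      (f' (‖z‖ ^ 2) • ip z) z := by
    filter_upwards [hc.eventually h] with z hz
    exact hz.comp_hasFDerivAt z (hN z)
  have h2 := (h'.comp_hasFDerivAt x (hN x)).smul (ip.hasFDerivAt (x := x))
  ext i j
  rw [hessian_eq_of_hasFDerivAt (φ' := fun z => f' (‖z‖ ^ 2) • ip z) h1 h2]
  simp [Matrix.vecMulVec_apply, hip, EuclideanSpace.inner_single_right, Matrix.one_apply,
    eq_comm]
  split_ifs with h1 <;> ring

/-- Second order Taylor expansion. -/
theorem taylor_two {φ : Eu n → ℝ} {x : Eu n} (h : ContDiffAt ℝ 2 φ x) {ε : ℝ} (hε : 0 < ε) :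
    ∃ δ > 0, ∀ w : Eu n, ‖w‖ < δ →
      |φ (x + w) - φ x - fderiv ℝ φ x w - d2 φ x w w / 2| ≤ ε * ‖w‖ ^ 2 := by
  have h2 := (differentiableAt_fderiv_two h).hasFDerivAt.isLittleO
  have h1 := (eventually_differentiableAt_of_contDiffAt h)
  have hsymm : ∀ v w, d2 φ x v w = d2 φ x w v := h.isSymmSndFDerivAt (by simp)
  obtain ⟨δ, hδ, hb⟩ := Metric.eventually_nhds_iff_ball.1 (h1.and (h2.bound hε))
  refine ⟨δ, hδ, fun w hw => ?_⟩
  -- The mean value inequality is applied to the Taylor remainder: its derivative at `v` is the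
  -- first order remainder of `fderiv ℝ φ`, hence at most `ε‖w‖` for `‖v‖ ≤ ‖w‖`.
  let ψ : Eu n → ℝ := fun w => φ (x + w) - φ x - fderiv ℝ φ x w - d2 φ x w w / 2
  have hψ : ∀ v ∈ Metric.closedBall (0 : Eu n) ‖w‖, HasFDerivWithinAt ψ
      (fderiv ℝ φ (x + v) - fderiv ℝ φ x - d2 φ x v) (Metric.closedBall (0 : Eu n) ‖w‖) v := by
    intro v hv
    have hv' : x + v ∈ Metric.ball x δ := by
      simp at hv ⊢; linarith
    have e1 : HasFDerivAt (fun v => φ (x + v)) (fderiv ℝ φ (x + v)) v := by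
      have := (hb _ hv').1.hasFDerivAt
      exact this.comp v ((hasFDerivAt_id v).const_add x)
    have e2 : HasFDerivAt (fun v => d2 φ x v v) ((2 : ℝ) • d2 φ x v) v := by
      have := ((d2 φ x).hasFDerivAt (x := v)).clm_apply (hasFDerivAt_id v)
      refine this.congr_fderiv ?_
      ext u
      simp [hsymm u v]; ring
    refine (((e1.sub_const (φ x)).sub (fderiv ℝ φ x).hasFDerivAt).sub
      (e2.mul_const (2 : ℝ)⁻¹)).hasFDerivWithinAt.congr_fderiv ?_ |>.congr_of_eventuallyEq ?_ ?_
    · ext u; simp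
    · exact Eventually.of_forall fun v => by simp [ψ, div_eq_mul_inv]
    · simp [ψ, div_eq_mul_inv]
  have hbd : ∀ v ∈ Metric.closedBall (0 : Eu n) ‖w‖,
      ‖fderiv ℝ φ (x + v) - fderiv ℝ φ x - d2 φ x v‖ ≤ ε * ‖w‖ := by
    intro v hv
    have hv' : x + v ∈ Metric.ball x δ := by
      simp at hv ⊢; linarith
    have := (hb _ hv').2
    simp only [add_sub_cancel_left] at this
    refine this.trans ?_
    gcongr
    simpa using hv
  have := (convex_closedBall (0 : Eu n) ‖w‖).norm_image_sub_le_of_norm_hasFDerivWithin_le hψ hbd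
    (x := 0) (y := w) (by simp) (by simp)
  simp only [ψ, sub_zero, map_zero, add_zero, sub_self, zero_div, Real.norm_eq_abs] at this
  rw [sq, ← mul_assoc]; exact this

/-- A uniform bound on second differences. -/
theorem second_difference_le {φ : Eu n → ℝ} (h : ContDiff ℝ 2 φ) (hc : HasCompactSupport φ) :
    ∃ C : ℝ, ∀ x w : Eu n, |φ (x + w) + φ (x - w) - 2 * φ x| ≤ C * ‖w‖ ^ 2 := by
  have h1 : ContDiff ℝ 1 (fderiv ℝ φ) := h.fderiv_right (by norm_num)
  obtain ⟨K, hK⟩ := h1.lipschitzWith_of_hasCompactSupport (hc.fderiv ℝ) (by norm_num)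
  refine ⟨2 * K, fun x w => ?_⟩
  let ψ : Eu n → ℝ := fun w => φ (x + w) + φ (x - w) - 2 * φ x
  have hd : ∀ y, HasFDerivAt φ (fderiv ℝ φ y) y := fun y =>
    (h.differentiable (by norm_num) y).hasFDerivAt
  have hψ : ∀ v ∈ Metric.closedBall (0 : Eu n) ‖w‖, HasFDerivWithinAt ψ
      (fderiv ℝ φ (x + v) - fderiv ℝ φ (x - v)) (Metric.closedBall (0 : Eu n) ‖w‖) v := by
    intro v _
    have e1 := (hd (x + v)).comp v ((hasFDerivAt_id v).const_add x)
    have e2 := (hd (x - v)).comp v ((hasFDerivAt_id v).const_sub x)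
    refine ((e1.add e2).sub_const (2 * φ x)).hasFDerivWithinAt.congr_fderiv ?_
    ext u; simp [sub_eq_add_neg]
  have hbd : ∀ v ∈ Metric.closedBall (0 : Eu n) ‖w‖,
      ‖fderiv ℝ φ (x + v) - fderiv ℝ φ (x - v)‖ ≤ 2 * K * ‖w‖ := by
    intro v hv
    refine (hK.norm_sub_le _ _).trans ?_
    have : x + v - (x - v) = (2 : ℝ) • v := by rw [two_smul]; abel
    rw [this, norm_smul]
    have hv' : ‖v‖ ≤ ‖w‖ := by simpa using hv
    have := K.2
    simp only [Real.norm_ofNat]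
    nlinarith [mul_le_mul_of_nonneg_left hv' this, show (K : ℝ) = K.1 from rfl]
  have := (convex_closedBall (0 : Eu n) ‖w‖).norm_image_sub_le_of_norm_hasFDerivWithin_le hψ hbd
    (x := 0) (y := w) (by simp) (by simp)
  simp only [ψ, sub_zero, add_zero, Real.norm_eq_abs] at this
  have e : φ x + φ x - 2 * φ x = 0 := by ring
  rw [e, sub_zero] at this
  rw [sq, ← mul_assoc]; exact this

/-! ### Averages over a compact group of rotations -/

/-- The linear map of a square matrix. -/
abbrev mlin (A : Matrix (Fin n) (Fin n) ℝ) : Eu n →L[ℝ] Eu n := Matrix.toEuclideanCLM (𝕜 := ℝ) A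

/-- A probability measure on a compact space of orthogonal matrices preserving `F`, such that
averages of functions over it are radial. -/
structure RotationFamily (F : Set (Matrix (Fin n) (Fin n) ℝ)) where
  Ω : Type
  top : TopologicalSpace Ω
  compact : CompactSpace Ω
  meas : MeasurableSpace Ω
  borel : BorelSpace Ω
  ν : Measure Ω
  prob : IsProbabilityMeasure ν
  mat : Ω → Matrix (Fin n) (Fin n) ℝ
  continuous_mat : Continuous mat
  orth : ∀ k, mat k ∈ Matrix.orthogonalGroup (Fin n) ℝ
  inv : ∀ k, ∀ A ∈ F, (mat k)ᵀ * A * mat k ∈ F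
  radial : ∀ (f : Eu n → ℝ) (x y : Eu n), ‖x‖ = ‖y‖ →
    ∫ k, f (mlin (mat k) x) ∂ν = ∫ k, f (mlin (mat k) y) ∂ν

attribute [instance] RotationFamily.top RotationFamily.compact RotationFamily.meas
  RotationFamily.borel RotationFamily.prob

instance compactSpace_orthogonalGroup : CompactSpace (Matrix.orthogonalGroup (Fin n) ℝ) := by
  have hK : IsCompact (Set.pi univ fun _ : Fin n => Set.pi univ fun _ : Fin n => Icc (-1 : ℝ) 1) :=
    isCompact_univ_pi fun _ => isCompact_univ_pi fun _ => isCompact_Icc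
  refine isCompact_iff_compactSpace.1 (hK.of_isClosed_subset (isClosed_unitary (R := Matrix (Fin n) (Fin n) ℝ)) ?_)
  intro U hU i _ j _
  have := entry_norm_bound_of_unitary (𝕜 := ℝ) hU i j
  rw [Real.norm_eq_abs, abs_le] at this
  exact this

theorem norm_mlin_of_orthogonal {A : Matrix (Fin n) (Fin n) ℝ}
    (hA : A ∈ Matrix.orthogonalGroup (Fin n) ℝ) (x : Eu n) : ‖mlin A x‖ = ‖x‖ := by
  rw [EuclideanSpace.norm_eq, EuclideanSpace.norm_eq]
  congr 1
  have h1 : Aᵀ * A = 1 := (Matrix.mem_orthogonalGroup_iff' _ _).1 hA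
  have : ∀ y : Eu n, ∑ i, ‖y i‖ ^ 2 = y.ofLp ⬝ᵥ y.ofLp := fun y => by
    simp [dotProduct, sq]
  rw [this, this, Matrix.ofLp_toEuclideanCLM, Matrix.dotProduct_mulVec, Matrix.vecMul_mulVec, h1,
    Matrix.vecMul_one]

theorem mlin_mul (A B : Matrix (Fin n) (Fin n) ℝ) (x : Eu n) :
    mlin (A * B) x = mlin A (mlin B x) := by
  simp [mlin]

/-- The space is the closure of the given group, which is compact and so has a Haar probability
measure; since `F` is closed, the closure still preserves it. -/
theorem exists_rotationFamily {F : Set (Matrix (Fin n) (Fin n) ℝ)} (hF : IsClosed F)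
    (hST : IsSTInvariant F) : Nonempty (RotationFamily F) := by
  obtain ⟨G, hG, hGF⟩ := hST
  let H := G.topologicalClosure
  have hHc : IsClosed (H : Set (Matrix.orthogonalGroup (Fin n) ℝ)) := G.isClosed_topologicalClosure
  have : CompactSpace H := isCompact_iff_compactSpace.1 hHc.isCompact
  let : MeasurableSpace H := borel H
  have : BorelSpace H := ⟨rfl⟩
  let ν : Measure H := Measure.haarMeasure ⊤
  have : IsProbabilityMeasure ν := ⟨by
    have := Measure.haarMeasure_self (K₀ := (⊤ : TopologicalSpace.PositiveCompacts H))
    simpa using this⟩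
  have hinv : ∀ g ∈ H, ∀ A ∈ F, (g : Matrix (Fin n) (Fin n) ℝ) * A *
      (g : Matrix (Fin n) (Fin n) ℝ)ᵀ ∈ F := by
    intro g hg A hA
    have hcl : IsClosed {g : Matrix.orthogonalGroup (Fin n) ℝ | (g : Matrix (Fin n) (Fin n) ℝ) * A *
      (g : Matrix (Fin n) (Fin n) ℝ)ᵀ ∈ F} := hF.preimage (by fun_prop)
    exact hcl.closure_subset_iff.2 (fun g hg => hGF g hg A hA) hg
  have hcoe : ∀ k : H, ((k⁻¹ : H) : Matrix.orthogonalGroup (Fin n) ℝ).1 =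
      (k : Matrix.orthogonalGroup (Fin n) ℝ).1ᵀ := fun k => rfl
  -- The matrix attached to `k` is that of `k⁻¹`: replacing `x` by `g x` then replaces `k` by `g⁻¹
  -- k`, so that left invariance of the Haar measure gives radiality, for every function `f`.
  refine ⟨⟨H, inferInstance, inferInstance, inferInstance, inferInstance, ν, inferInstance,
    fun k => ((k⁻¹ : H) : Matrix.orthogonalGroup (Fin n) ℝ).1, by fun_prop, fun k => Subtype.prop _,
    fun k A hA => ?_, fun f x y hxy => ?_⟩⟩
  · simp only [hcoe, Matrix.transpose_transpose]
    exact hinv k k.2 A hA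
  · obtain ⟨g, hg, hgxy⟩ : ∃ g ∈ G, mlin (g : Matrix (Fin n) (Fin n) ℝ) x = y := by
      by_cases hx : ‖x‖ = 0
      · have hy : ‖y‖ = 0 := hxy ▸ hx
        refine ⟨1, G.one_mem, ?_⟩
        rw [norm_eq_zero.1 hx, norm_eq_zero.1 hy, map_zero]
      · obtain ⟨g, hg, h⟩ := hG (‖x‖⁻¹ • x) (‖y‖⁻¹ • y) (by simp [norm_smul, hx])
          (by simp [norm_smul, hxy ▸ hx])
        refine ⟨g, hg, ?_⟩
        have h' : mlin (g : Matrix (Fin n) (Fin n) ℝ) (‖x‖⁻¹ • x) = ‖y‖⁻¹ • y := by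
          ext i
          rw [Matrix.ofLp_toEuclideanCLM, h]
        rw [map_smul, ← hxy] at h'
        exact smul_right_injective _ (inv_ne_zero hx) h'
    have hgH : g ∈ H := G.le_topologicalClosure hg
    have := integral_mul_left_eq_self (μ := ν)
      (fun k : H => f (mlin ((k⁻¹ : H) : Matrix.orthogonalGroup (Fin n) ℝ).1 x)) (⟨g, hgH⟩⁻¹ : H)
    rw [← this]
    congr 1
    ext k
    congr 1
    rw [← hgxy, ← mlin_mul, mul_inv_rev, inv_inv]
    rfl

/-- The linear isometry given by an orthogonal matrix. -/
def orthEquiv {A : Matrix (Fin n) (Fin n) ℝ} (hA : A ∈ Matrix.orthogonalGroup (Fin n) ℝ) :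
    Eu n ≃ₗᵢ[ℝ] Eu n :=
  LinearIsometry.toLinearIsometryEquiv
    ⟨(mlin A).toLinearMap, norm_mlin_of_orthogonal hA⟩ rfl

theorem orthEquiv_apply {A : Matrix (Fin n) (Fin n) ℝ}
    (hA : A ∈ Matrix.orthogonalGroup (Fin n) ℝ) (x : Eu n) : orthEquiv hA x = mlin A x := rfl

instance : IsFiniteMeasure (sphereMeasure n) := by unfold sphereMeasure; infer_instance

-- `toSphere` measures a set through the volume of the cone over it, and a linear isometry maps
-- cones to cones and preserves volume.
open scoped Pointwise in
theorem integral_sphere_comp (e : Eu n ≃ₗᵢ[ℝ] Eu n) (f : Eu n → ℝ) :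
    ∫ σ : Metric.sphere (0 : Eu n) 1, f (e σ) ∂(sphereMeasure n) =
      ∫ σ : Metric.sphere (0 : Eu n) 1, f σ ∂(sphereMeasure n) := by
  let T : Metric.sphere (0 : Eu n) 1 ≃ₜ Metric.sphere (0 : Eu n) 1 :=
    { toFun := fun σ => ⟨e σ, by simp⟩
      invFun := fun σ => ⟨e.symm σ, by simp⟩
      left_inv := fun σ => by simp
      right_inv := fun σ => by simp
      continuous_toFun := by fun_prop
      continuous_invFun := by fun_prop }
  have hT : MeasurePreserving T (sphereMeasure n) (sphereMeasure n) := by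
    refine ⟨T.continuous.measurable, ?_⟩
    ext s hs
    rw [Measure.map_apply T.continuous.measurable hs, sphereMeasure,
      Measure.toSphere_apply' _ (T.continuous.measurable hs), Measure.toSphere_apply' _ hs]
    congr 1
    have h0 : ∀ s, volume (e ⁻¹' s) = volume s := fun s =>
      MeasurePreserving.measure_preimage_equiv (f := e.toHomeomorph.toMeasurableEquiv)
        e.measurePreserving s
    rw [← h0 (Ioo (0 : ℝ) 1 • (Subtype.val '' s))]
    congr 1
    ext x
    simp only [Set.mem_smul, mem_preimage, mem_image]
    constructor
    · rintro ⟨t, ht, _, ⟨σ, hσ, rfl⟩, rfl⟩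
      exact ⟨t, ht, _, ⟨T σ, hσ, rfl⟩, by simp [T]⟩
    · rintro ⟨t, ht, _, ⟨σ, hσ, rfl⟩, h⟩
      refine ⟨t, ht, _, ⟨T.symm σ, by simpa using hσ, rfl⟩, e.injective ?_⟩
      rw [map_smul, ← h]
      simp [T]
  exact hT.integral_comp' (f := T.toMeasurableEquiv) (fun σ => f σ)

theorem continuous_rotation {F : Set (Matrix (Fin n) (Fin n) ℝ)} (R : RotationFamily F)
    {Z : Type*} [TopologicalSpace Z] {a : Z → R.Ω} {g : Z → Eu n} (ha : Continuous a)
    (hg : Continuous g) : Continuous (fun z => mlin (R.mat (a z)) (g z)) := by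
  have hm : Continuous fun z => R.mat (a z) := R.continuous_mat.comp ha
  have h1 : ∀ z, mlin (R.mat (a z)) (g z) =
      WithLp.toLp 2 (R.mat (a z) *ᵥ (g z).ofLp) := fun z => rfl
  simp only [h1]
  have h2 : Continuous fun z => (g z).ofLp := (PiLp.continuous_ofLp 2 _).comp hg
  exact (PiLp.continuous_toLp 2 _).comp (hm.matrix_mulVec h2)

theorem measurable_rotation {F : Set (Matrix (Fin n) (Fin n) ℝ)} (R : RotationFamily F)
    {S : Type*} [TopologicalSpace S] [SecondCountableTopology S] [MeasurableSpace S]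
    [BorelSpace S] {g : S → Eu n} (hg : Continuous g) :
    Measurable (fun z : S × R.Ω => mlin (R.mat z.2) (g z.1)) :=
  (continuous_rotation R (a := fun z : S × R.Ω => z.2) (g := fun z => g z.1) continuous_snd
    (hg.comp' continuous_fst)).measurable

/-- The average of `f` over the rotations of `x` is its average over the sphere through `x`. -/
theorem integral_rotation_eq [NeZero n] {F : Set (Matrix (Fin n) (Fin n) ℝ)}
    (R : RotationFamily F) {f : Eu n → ℝ} (hf : Measurable f) (x : Eu n) {C : ℝ}
    (hC : ∀ y, ‖y‖ = ‖x‖ → |f y| ≤ C) :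
    ∫ k, f (mlin (R.mat k) x) ∂(R.ν) =
      ⨍ σ : Metric.sphere (0 : Eu n) 1, f (‖x‖ • (σ : Eu n)) ∂(sphereMeasure n) := by
  have : Nontrivial (Eu n) := Module.nontrivial_of_finrank_pos (R := ℝ) (by simp [NeZero.pos])
  have hne : NeZero (sphereMeasure n) := ⟨by unfold sphereMeasure; exact Measure.toSphere_ne_zero _⟩
  -- The rotation average is constant on spheres, so averaging it over the sphere changes nothing.
  -- After exchanging the integrals, each rotation disappears because it preserves the surface
  -- measure.
  have key : ∀ σ : Metric.sphere (0 : Eu n) 1, ∫ k, f (mlin (R.mat k) (‖x‖ • (σ : Eu n))) ∂(R.ν) =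
      ∫ k, f (mlin (R.mat k) x) ∂(R.ν) := fun σ => R.radial f _ _ (by simp [norm_smul])
  have hint : Integrable (fun z : Metric.sphere (0 : Eu n) 1 × R.Ω =>
      f (mlin (R.mat z.2) (‖x‖ • (z.1 : Eu n)))) ((sphereMeasure n).prod R.ν) := by
    have hm := measurable_rotation R (S := Metric.sphere (0 : Eu n) 1)
      (g := fun σ => ‖x‖ • (σ : Eu n)) (by fun_prop)
    exact Integrable.of_bound (C := C) (hf.comp hm).aestronglyMeasurable
      (Eventually.of_forall fun z => hC _ (by
        rw [norm_mlin_of_orthogonal (R.orth _)]; simp [norm_smul]))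
  have sw : ∫ σ : Metric.sphere (0 : Eu n) 1, (∫ k, f (mlin (R.mat k) (‖x‖ • (σ : Eu n))) ∂(R.ν))
      ∂(sphereMeasure n) = ∫ k, (∫ σ : Metric.sphere (0 : Eu n) 1,
        f (mlin (R.mat k) (‖x‖ • (σ : Eu n))) ∂(sphereMeasure n)) ∂(R.ν) :=
    integral_integral_swap hint
  calc ∫ k, f (mlin (R.mat k) x) ∂(R.ν)
      = ⨍ σ : Metric.sphere (0 : Eu n) 1, (∫ k, f (mlin (R.mat k) (‖x‖ • (σ : Eu n))) ∂(R.ν))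
          ∂(sphereMeasure n) := by simp only [key, average_const]
    _ = ∫ k, (⨍ σ : Metric.sphere (0 : Eu n) 1, f (mlin (R.mat k) (‖x‖ • (σ : Eu n)))
          ∂(sphereMeasure n)) ∂(R.ν) := by
        simp only [average_eq]
        rw [integral_smul, sw]
    _ = ∫ k, (⨍ σ : Metric.sphere (0 : Eu n) 1, f (‖x‖ • (σ : Eu n))
          ∂(sphereMeasure n)) ∂(R.ν) := by
        congr 1; ext k
        simp only [average_eq]
        congr 1
        have := integral_sphere_comp (orthEquiv (R.orth k)) (fun y => f (‖x‖ • y))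
        simp only [orthEquiv_apply] at this
        simpa only [map_smul] using this
    _ = _ := by simp

section

/-! ### The pairing of matrices and the geometry of `F` -/

theorem pair_eq_trace (B A : Matrix (Fin n) (Fin n) ℝ) : pair B A = (B * Aᵀ).trace := by
  simp [pair, Matrix.trace, Matrix.mul_apply]

theorem pair_add_left (B B' A : Matrix (Fin n) (Fin n) ℝ) :
    pair (B + B') A = pair B A + pair B' A := by
  simp [pair_eq_trace, add_mul]

theorem pair_smul_left (t : ℝ) (B A : Matrix (Fin n) (Fin n) ℝ) :
    pair (t • B) A = t * pair B A := by
  simp [pair_eq_trace]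

theorem pair_transpose (B A : Matrix (Fin n) (Fin n) ℝ) : pair Bᵀ A = pair B Aᵀ := by
  simp only [pair, Matrix.transpose_apply]
  exact Finset.sum_comm

theorem pair_one (A : Matrix (Fin n) (Fin n) ℝ) : pair 1 A = A.trace := by
  simp [pair_eq_trace]

theorem pair_vecMulVec (B : Matrix (Fin n) (Fin n) ℝ) (x : Fin n → ℝ) :
    pair B (Matrix.vecMulVec x x) = x ⬝ᵥ (B *ᵥ x) := by
  simp only [pair, Matrix.vecMulVec_apply, dotProduct, Matrix.mulVec, Finset.mul_sum]
  exact Finset.sum_congr rfl fun i _ => Finset.sum_congr rfl fun j _ => by ring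

theorem pair_mul_transpose (C A : Matrix (Fin n) (Fin n) ℝ) (hA : A.IsSymm) :
    pair (C * Cᵀ) A = (Cᵀ * A * C).trace := by
  rw [pair_eq_trace, hA.eq, Matrix.trace_mul_comm, ← Matrix.mul_assoc, Matrix.trace_mul_comm,
    ← Matrix.mul_assoc]

theorem posSemidef_vecMulVec (x : Fin n → ℝ) : (Matrix.vecMulVec x x).PosSemidef := by
  simpa using Matrix.posSemidef_vecMulVec_self_star x

variable {F : Set (Matrix (Fin n) (Fin n) ℝ)}

/-- Hahn–Banach separation, with matrices regarded as functions of two indices. A linear functional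
bounded below on a cone is nonnegative on it. -/
theorem exists_pair_lt (hcl : IsClosed F) (hconv : Convex ℝ F) (hcone : IsConeSet F)
    (h0 : (0 : Matrix (Fin n) (Fin n) ℝ) ∈ F) {A : Matrix (Fin n) (Fin n) ℝ} (hA : A ∉ F) :
    ∃ B : Matrix (Fin n) (Fin n) ℝ, (∀ M ∈ F, 0 ≤ pair B M) ∧ pair B A < 0 := by
  let F' : Set (Fin n → Fin n → ℝ) := F
  have hcl' : IsClosed F' := hcl
  have hconv' : Convex ℝ F' := hconv
  let A' : Fin n → Fin n → ℝ := A
  have hA' : A' ∉ F' := hA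
  obtain ⟨f, u, hfA, hf⟩ := geometric_hahn_banach_point_closed hconv' hcl' hA'
  have hu : u < 0 := by simpa using hf 0 h0
  let B : Matrix (Fin n) (Fin n) ℝ := Matrix.of fun i j => f (Pi.single i (Pi.single j 1))
  have hB : ∀ M : Fin n → Fin n → ℝ, f M = pair B M := by
    intro M
    have : M = ∑ i, ∑ j, M i j • (Pi.single i (Pi.single j 1) : Fin n → Fin n → ℝ) := by
      ext a b
      simp [Finset.sum_apply, Pi.single_apply, ite_apply, Finset.sum_ite_eq]
    conv_lhs => rw [this]
    simp only [map_sum, map_smul, smul_eq_mul, pair, B, Matrix.of_apply]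
    exact Finset.sum_congr rfl fun i _ => Finset.sum_congr rfl fun j _ => by ring
  refine ⟨B, fun M hM => ?_, ?_⟩
  · by_contra! hneg
    let M' : Fin n → Fin n → ℝ := M
    have hM' : f M' = pair B M := hB M'
    rw [← hM'] at hneg
    -- The functional takes exactly the value `u` at this positive multiple of `M`, although it
    -- exceeds `u` on all of `F`.
    have h1 : u < f ((u / f M') • M') :=
      hf _ (hcone (u / f M') (by rw [div_nonneg_iff]; right; exact ⟨hu.le, hneg.le⟩) M hM)
    rw [map_smul, smul_eq_mul, div_mul_cancel₀ _ hneg.ne] at h1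
    exact lt_irrefl _ h1
  · have e : f A' = pair B A := hB A'
    rw [← e]; exact hfA.trans hu

/-! ### Position of `F` between the positive semidefinite matrices and the matrices of nonnegative
trace -/

/-- The standing assumptions on `F`, together with its Riesz characteristic. -/
structure Admissible (F : Set (Matrix (Fin n) (Fin n) ℝ)) (p : ℝ) : Prop where
  sub : IsSubequation F
  cone : IsConeSet F
  st : IsSTInvariant F
  conv : Convex ℝ F
  riesz : IsRieszCharacteristic F p

variable {p : ℝ}

theorem lineProj_posSemidef (e : Eu n) : (lineProj e).PosSemidef := posSemidef_vecMulVec _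

theorem trace_lineProj {e : Eu n} (he : ‖e‖ = 1) : (lineProj e).trace = 1 := by
  rw [lineProj, Matrix.trace_vecMulVec]
  have : e.ofLp ⬝ᵥ e.ofLp = ‖e‖ ^ 2 := by
    rw [EuclideanSpace.norm_sq_eq]; simp [dotProduct, sq]
  rw [this, he, one_pow]

theorem one_sub_lineProj_posSemidef {e : Eu n} (he : ‖e‖ = 1) :
    (1 - lineProj e).PosSemidef := by
  refine Matrix.PosSemidef.of_dotProduct_mulVec_nonneg ?_ fun x => ?_
  · exact Matrix.isHermitian_one.sub (lineProj_posSemidef e).1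
  · have h1 : star x ⬝ᵥ ((1 - lineProj e) *ᵥ x) = ‖WithLp.toLp 2 x‖ ^ 2 -
        (inner ℝ e (WithLp.toLp 2 x)) ^ 2 := by
      rw [Matrix.sub_mulVec, Matrix.one_mulVec, dotProduct_sub, EuclideanSpace.norm_sq_eq,
        lineProj, Matrix.vecMulVec_mulVec]
      simp [dotProduct, sq, PiLp.inner_apply, Finset.sum_mul, mul_comm]
      exact Finset.sum_congr rfl fun i _ => by ring
    rw [h1]
    have := abs_real_inner_le_norm e (WithLp.toLp 2 x)
    rw [he, one_mul] at this
    have := sq_le_sq' (by linarith [abs_le.1 this]) (abs_le.1 this).2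
    linarith

namespace Admissible

/-- If `F` were empty, the set of admissible `q` would be empty or, in the absence of unit vectors,
all of `ℝ`; neither has a real least upper bound. -/
theorem zero_mem (h : Admissible F p) : (0 : Matrix (Fin n) (Fin n) ℝ) ∈ F := by
  have hne : F.Nonempty := by
    by_contra hF
    rw [Set.not_nonempty_iff_eq_empty] at hF
    by_cases hn : ∃ e : Eu n, ‖e‖ = 1
    · obtain ⟨e, he⟩ := hn
      have : p ≤ p - 1 := h.riesz.2 fun q hq => by
        have := hq e he
        simp [hF] at this
      linarith
    · have : p + 1 ≤ p := h.riesz.1 fun e he => (hn ⟨e, he⟩).elim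
      linarith
  obtain ⟨A, hA⟩ := hne
  simpa using h.cone 0 le_rfl A hA

theorem posSemidef_mem (h : Admissible F p) {A : Matrix (Fin n) (Fin n) ℝ} (hA : A.PosSemidef) :
    A ∈ F := by
  simpa using h.sub.positivity 0 h.zero_mem A hA

/-- In dimension `0` there are no unit vectors, every `q` is admissible vacuously, and the supremum
would not be finite. -/
theorem ne_zero (h : Admissible F p) : NeZero n := by
  refine ⟨?_⟩
  rintro rfl
  have : p + 1 ≤ p := h.riesz.1 fun e he => by
    rw [Subsingleton.elim e 0, norm_zero] at he
    norm_num at he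
  linarith

theorem one_le (h : Admissible F p) : 1 ≤ p :=
  h.riesz.1 fun e he => by
    simpa using h.posSemidef_mem (one_sub_lineProj_posSemidef he)

/-- Transitivity carries membership from one unit vector to all of them, so `q` would be admissible.
-/
theorem not_mem_of_gt (h : Admissible F p) {q : ℝ} (hq : p < q) {e : Eu n} (he : ‖e‖ = 1) :
    (1 - lineProj e) - (q - 1) • lineProj e ∉ F := by
  intro hmem
  have : q ≤ p := h.riesz.1 fun e' he' => by
    obtain ⟨G, hG, hGF⟩ := h.st
    obtain ⟨g, hg, hge⟩ := hG e e' he he'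
    have h1 := hGF g hg _ hmem
    have h2 : (g : Matrix (Fin n) (Fin n) ℝ) * (g : Matrix (Fin n) (Fin n) ℝ)ᵀ = 1 :=
      (Matrix.mem_orthogonalGroup_iff _ _).1 g.2
    have h3 : (g : Matrix (Fin n) (Fin n) ℝ) * lineProj e * (g : Matrix (Fin n) (Fin n) ℝ)ᵀ =
        lineProj e' := by
      rw [lineProj, lineProj, Matrix.mul_vecMulVec, Matrix.vecMulVec_mul, hge,
        Matrix.vecMul_transpose, hge]
    simpa [mul_sub, sub_mul, h2, h3] using h1
  linarith

/-- Adding `(p+1) P_{e^⊥}` to `-p I` gives `P_{e^⊥} - p P_e`, which would make `q = p + 1`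
admissible. -/
theorem neg_one_not_mem (h : Admissible F p) : (-1 : Matrix (Fin n) (Fin n) ℝ) ∉ F := by
  intro hmem
  have := h.ne_zero
  have : p + 1 ≤ p := h.riesz.1 fun e he => by
    have h1 := h.sub.positivity _ (h.cone p (by linarith [h.one_le]) _ hmem) _
      ((one_sub_lineProj_posSemidef he).smul (a := p + 1) (by linarith [h.one_le]))
    convert h1 using 1
    module
  linarith

/-- The group average `Z` of `A` has a quadratic form that is constant on spheres, so `Z = c I` with
`tr Z = tr A`. Separating `-I` from `F` yields `B` with `tr B > 0` that is nonnegative on `F`. Then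
`c tr B = pair B Z ≥ 0`, as `pair B Z` averages pairings with elements of `F`. -/
theorem trace_nonneg (h : Admissible F p) {A : Matrix (Fin n) (Fin n) ℝ} (hA : A ∈ F) :
    0 ≤ A.trace := by
  obtain ⟨B, hB, hB1⟩ := exists_pair_lt h.sub.closed h.conv h.cone h.zero_mem h.neg_one_not_mem
  have hBtr : 0 < B.trace := by
    have : pair B (-1) = - B.trace := by simp [pair_eq_trace]
    linarith
  obtain ⟨R⟩ := exists_rotationFamily h.sub.closed h.st
  have hcont : ∀ i j, Continuous fun k => ((R.mat k)ᵀ * A * R.mat k) i j := fun i j => by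
    have := R.continuous_mat
    exact Continuous.matrix_elem (by fun_prop) i j
  have hint : ∀ i j, Integrable (fun k => ((R.mat k)ᵀ * A * R.mat k) i j) R.ν := fun i j =>
    (hcont i j).integrable_of_hasCompactSupport (HasCompactSupport.of_compactSpace _)
  let Z : Matrix (Fin n) (Fin n) ℝ := Matrix.of fun i j => ∫ k, ((R.mat k)ᵀ * A * R.mat k) i j ∂(R.ν)
  have hpair : ∀ B, pair B Z = ∫ k, pair B ((R.mat k)ᵀ * A * R.mat k) ∂(R.ν) := by
    intro B
    simp only [pair, Z, Matrix.of_apply]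
    rw [integral_finsetSum (f := fun i k => ∑ j, B i j * ((R.mat k)ᵀ * A * R.mat k) i j) _
      fun i _ => integrable_finsetSum _ fun j _ => (hint i j).const_mul _]
    refine Finset.sum_congr rfl fun i _ => ?_
    rw [integral_finsetSum _ fun j _ => (hint i j).const_mul _]
    simp only [integral_const_mul]
  have hZB : 0 ≤ pair B Z := by
    rw [hpair]
    exact integral_nonneg fun k => hB _ (R.inv k A hA)
  have hZtr : Z.trace = A.trace := by
    rw [← pair_one, hpair]
    have : ∀ k, pair 1 ((R.mat k)ᵀ * A * R.mat k) = A.trace := fun k => by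
      rw [pair_one, Matrix.mul_assoc, Matrix.trace_mul_comm, Matrix.mul_assoc,
        (Matrix.mem_orthogonalGroup_iff _ _).1 (R.orth k), Matrix.mul_one]
    simp [this]
  have hZsymm : ∀ i j, Z i j = Z j i := by
    intro i j
    simp only [Z, Matrix.of_apply]
    congr 1; ext k
    have : ((R.mat k)ᵀ * A * R.mat k)ᵀ = (R.mat k)ᵀ * A * R.mat k := by
      simp [Matrix.mul_assoc, (h.sub.symm A hA).eq]
    conv_lhs => rw [← this]
    rfl
  have hq : ∀ x : Eu n, x.ofLp ⬝ᵥ (Z *ᵥ x.ofLp) =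
      ∫ k, (mlin (R.mat k) x).ofLp ⬝ᵥ (A *ᵥ (mlin (R.mat k) x).ofLp) ∂(R.ν) := by
    intro x
    rw [← pair_vecMulVec]
    have h1 : pair Z (Matrix.vecMulVec x.ofLp x.ofLp) = pair (Matrix.vecMulVec x.ofLp x.ofLp) Z := by
      simp [pair, mul_comm]
    rw [h1, hpair]
    congr 1; ext k
    have h2 : ∀ M, pair (Matrix.vecMulVec x.ofLp x.ofLp) M =
      pair M (Matrix.vecMulVec x.ofLp x.ofLp) := fun M => by simp [pair, mul_comm]
    rw [h2, pair_vecMulVec, Matrix.ofLp_toEuclideanCLM, ← Matrix.mulVec_mulVec,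
      ← Matrix.mulVec_mulVec, Matrix.dotProduct_mulVec, Matrix.vecMul_transpose]
  have hrad : ∀ x y : Eu n, ‖x‖ = ‖y‖ → x.ofLp ⬝ᵥ (Z *ᵥ x.ofLp) = y.ofLp ⬝ᵥ (Z *ᵥ y.ofLp) := by
    intro x y hxy
    rw [hq, hq]
    exact R.radial (fun y => y.ofLp ⬝ᵥ (A *ᵥ y.ofLp)) x y hxy
  have := h.ne_zero
  let c := Z 0 0
  have hdiag : ∀ i, Z i i = c := by
    intro i
    simpa using hrad (EuclideanSpace.single i 1) (EuclideanSpace.single 0 1) (by simp)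
  -- The quadratic form agrees at `e_i + e_j` and `e_i - e_j`, which have the same norm.
  have hoff : ∀ i j, i ≠ j → Z i j = 0 := by
    intro i j hij
    have h1 := hrad (EuclideanSpace.single i 1 + EuclideanSpace.single j 1)
      (EuclideanSpace.single i 1 - EuclideanSpace.single j 1) (by
        have hin : inner ℝ (EuclideanSpace.single i (1 : ℝ)) (EuclideanSpace.single j (1 : ℝ)) = 0 := by
          simp [EuclideanSpace.inner_single_left, hij]
        rw [← sq_eq_sq₀ (norm_nonneg _) (norm_nonneg _), norm_add_sq_real, norm_sub_sq_real, hin]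
        ring)
    simp [Matrix.mulVec_add, Matrix.mulVec_sub] at h1
    have := hZsymm i j
    linarith
  have hZ : Z = c • (1 : Matrix (Fin n) (Fin n) ℝ) := by
    ext i j
    by_cases hij : i = j
    · subst hij; simp [hdiag]
    · simp [hoff i j hij, hij]
  have hc : 0 ≤ c := by
    rw [hZ, pair_eq_trace] at hZB
    simp at hZB
    exact nonneg_of_mul_nonneg_left hZB hBtr
  rw [← hZtr, hZ]
  simp
  positivity

/-- The trace of `P_{e^⊥} - (q-1) P_e` is `n - q`. -/
theorem le_dim (h : Admissible F p) : p ≤ n := by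
  refine h.riesz.2 fun q hq => ?_
  have := h.ne_zero
  have h1 := h.trace_nonneg (hq (EuclideanSpace.single 0 1) (by simp))
  rw [Matrix.trace_sub, Matrix.trace_sub, Matrix.trace_smul, trace_lineProj (by simp)] at h1
  simp at h1
  linarith

open scoped MatrixOrder in
/-- A symmetric matrix outside `F` is detected by a positive definite linear operator. -/
theorem exists_factor (h : Admissible F p) {A : Matrix (Fin n) (Fin n) ℝ} (hAs : A.IsSymm)
    (hA : A ∉ F) :
    ∃ C D : Matrix (Fin n) (Fin n) ℝ, C * D = 1 ∧ D * C = 1 ∧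
      (∀ M ∈ F, 0 ≤ (Cᵀ * M * C).trace) ∧ (Cᵀ * A * C).trace < 0 := by
  obtain ⟨B, hB, hBA⟩ := exists_pair_lt h.sub.closed h.conv h.cone h.zero_mem hA
  -- The separating form is only nonnegative on rank one projections. Adding `δ` times the trace,
  -- which is nonnegative on `F`, makes it positive definite, and a small `δ` keeps it negative at
  -- `A`. The factor `C` is then the square root of the symmetrized form.
  obtain ⟨δ, hδ, hδA⟩ : ∃ δ > 0, pair B A + δ * A.trace < 0 := by
    refine ⟨-pair B A / (2 * (|A.trace| + 1)), by apply div_pos <;> [linarith; positivity], ?_⟩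
    have h1 : -pair B A / (2 * (|A.trace| + 1)) * A.trace ≤ -pair B A / 2 := by
      rw [div_mul_eq_mul_div, div_le_div_iff₀ (by positivity) two_pos]
      have := le_abs_self A.trace
      nlinarith
    linarith
  let B' : Matrix (Fin n) (Fin n) ℝ := (1 / 2 : ℝ) • (B + Bᵀ) + δ • 1
  have hB' : ∀ M : Matrix (Fin n) (Fin n) ℝ, M.IsSymm → pair B' M = pair B M + δ * M.trace := by
    intro M hM
    simp only [B', pair_add_left, pair_smul_left, pair_transpose, hM.eq, pair_one]
    ring
  have hpos : B'.PosDef := by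
    refine Matrix.PosDef.of_dotProduct_mulVec_pos ?_ fun x hx => ?_
    · ext i j
      simp [B', Matrix.add_apply, Matrix.one_apply, add_comm, eq_comm]
    · have h1 : star x ⬝ᵥ (B' *ᵥ x) = pair B' (Matrix.vecMulVec x x) := by
        rw [pair_vecMulVec]; simp
      have hmem := h.posSemidef_mem (posSemidef_vecMulVec x)
      rw [h1, hB' _ (h.sub.symm _ hmem), Matrix.trace_vecMulVec]
      have h2 : 0 < x ⬝ᵥ x := by
        have := (Matrix.dotProduct_star_self_pos_iff (v := x)).2 hx
        simpa using this
      have := hB _ hmem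
      positivity
  have hsq : CFC.sqrt B' * CFC.sqrt B' = B' :=
    CFC.sqrt_mul_sqrt_self B' (Matrix.nonneg_iff_posSemidef.2 hpos.posSemidef)
  have hsymm : (CFC.sqrt B')ᵀ = CFC.sqrt B' := by
    have := (Matrix.nonneg_iff_posSemidef.1 (CFC.sqrt_nonneg B')).1
    simpa [Matrix.IsHermitian] using this
  have hunit : IsUnit (CFC.sqrt B').det := by
    have := (Matrix.isUnit_iff_isUnit_det _).1 hpos.isUnit
    rw [← hsq, Matrix.det_mul] at this
    exact isUnit_of_mul_isUnit_left this
  have key : ∀ M : Matrix (Fin n) (Fin n) ℝ, M.IsSymm →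
      ((CFC.sqrt B')ᵀ * M * CFC.sqrt B').trace = pair B M + δ * M.trace := by
    intro M hM
    rw [← pair_mul_transpose _ _ hM, hsymm, hsq, hB' M hM]
  refine ⟨CFC.sqrt B', (CFC.sqrt B')⁻¹, Matrix.mul_nonsing_inv _ hunit,
    Matrix.nonsing_inv_mul _ hunit, fun M hM => ?_, ?_⟩
  · rw [key M (h.sub.symm M hM)]
    have := hB M hM
    have := h.trace_nonneg hM
    positivity
  · rw [key A hAs]; exact hδA

end Admissible

end

/-! ### Harmonic polynomials -/

/-- The function on Euclidean space given by a polynomial. -/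
def pev (P : MvPolynomial (Fin n) ℝ) (x : Eu n) : ℝ := MvPolynomial.eval x.ofLp P

/-- The Laplacian of a polynomial. -/
def lapP : MvPolynomial (Fin n) ℝ →ₗ[ℝ] MvPolynomial (Fin n) ℝ :=
  ∑ i, (MvPolynomial.pderiv i).toLinearMap ∘ₗ (MvPolynomial.pderiv i).toLinearMap

theorem lapP_apply (P : MvPolynomial (Fin n) ℝ) :
    lapP P = ∑ i, MvPolynomial.pderiv i (MvPolynomial.pderiv i P) := by
  simp [lapP]

theorem contDiff_pev (P : MvPolynomial (Fin n) ℝ) : ContDiff ℝ ∞ (pev P) := by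
  induction P using MvPolynomial.induction_on with
  | C a =>
    have : pev (MvPolynomial.C a : MvPolynomial (Fin n) ℝ) = fun _ => a := by ext; simp [pev]
    rw [this]; exact contDiff_const
  | add p q hp hq =>
    have : pev (p + q) = fun y => pev p y + pev q y := by ext; simp [pev]
    rw [this]; exact hp.add hq
  | mul_X p i hp =>
    have h1 : pev (p * MvPolynomial.X i) = fun y => pev p y * y i := by ext; simp [pev]
    have h2 : ContDiff ℝ ∞ fun x : Eu n => x i := by fun_prop
    rw [h1]; exact hp.mul h2

theorem two_le_infty : (2 : ℕ∞ω) ≤ ∞ := by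
  exact WithTop.coe_le_coe.2 (by simp : (2 : ℕ∞) ≤ ⊤)

theorem continuous_pev (P : MvPolynomial (Fin n) ℝ) : Continuous (pev P) := (contDiff_pev P).continuous

theorem hasFDerivAt_pev (P : MvPolynomial (Fin n) ℝ) (x : Eu n) :
    HasFDerivAt (pev P)
      (∑ i, pev (MvPolynomial.pderiv i P) x • (EuclideanSpace.proj i : Eu n →L[ℝ] ℝ)) x := by
  induction P using MvPolynomial.induction_on with
  | C a =>
    have : pev (MvPolynomial.C a : MvPolynomial (Fin n) ℝ) = fun _ => a := by ext; simp [pev]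
    rw [this]
    refine (hasFDerivAt_const a x).congr_fderiv ?_
    simp [pev]
  | add p q hp hq =>
    have : pev (p + q) = fun y => pev p y + pev q y := by ext; simp [pev]
    rw [this]
    refine (hp.add hq).congr_fderiv ?_
    simp [pev, add_smul, Finset.sum_add_distrib]
  | mul_X p i hp =>
    have : pev (p * MvPolynomial.X i) = fun y => pev p y * y i := by ext; simp [pev]
    rw [this]
    have h2 : HasFDerivAt (fun y : Eu n => y i) (EuclideanSpace.proj i : Eu n →L[ℝ] ℝ) x :=
      (EuclideanSpace.proj i : Eu n →L[ℝ] ℝ).hasFDerivAt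
    refine (hp.mul h2).congr_fderiv ?_
    ext v
    simp only [pev, MvPolynomial.pderiv_mul, MvPolynomial.pderiv_X, map_add, map_mul,
      MvPolynomial.eval_X, _root_.add_apply, _root_.smul_apply, _root_.sum_apply, smul_eq_mul,
      add_mul, Finset.sum_add_distrib, Finset.mul_sum]
    rw [add_comm]
    congr 1
    · exact Finset.sum_congr rfl fun j _ => by ring
    · rw [Finset.sum_eq_single i]
      · simp
      · intro j _ hj; simp [hj.symm]
      · simp

theorem hessian_pev (P : MvPolynomial (Fin n) ℝ) (x : Eu n) (i j : Fin n) :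
    hessian (pev P) x i j = pev (MvPolynomial.pderiv i (MvPolynomial.pderiv j P)) x := by
  have h2 : HasFDerivAt (fun y => ∑ k, pev (MvPolynomial.pderiv k P) y •
      (EuclideanSpace.proj k : Eu n →L[ℝ] ℝ)) (∑ k, (∑ l, pev (MvPolynomial.pderiv l
        (MvPolynomial.pderiv k P)) x • (EuclideanSpace.proj l : Eu n →L[ℝ] ℝ)).smulRight
          (EuclideanSpace.proj k : Eu n →L[ℝ] ℝ)) x :=
    HasFDerivAt.fun_sum fun k _ => (hasFDerivAt_pev (MvPolynomial.pderiv k P) x).smul_const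
      (EuclideanSpace.proj k : Eu n →L[ℝ] ℝ)
  rw [hessian_eq_of_hasFDerivAt (Eventually.of_forall (hasFDerivAt_pev P)) h2]
  simp

theorem trace_hessian_pev (P : MvPolynomial (Fin n) ℝ) (x : Eu n) :
    (hessian (pev P) x).trace = pev (lapP P) x := by
  simp [Matrix.trace, hessian_pev, lapP_apply, pev]

theorem totalDegree_pderiv_le {P : MvPolynomial (Fin n) ℝ} {d : ℕ} (hP : P.totalDegree ≤ d + 1)
    (i : Fin n) : (MvPolynomial.pderiv i P).totalDegree ≤ d := by
  refine Finset.sup_le fun m hm => ?_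
  rw [MvPolynomial.mem_support_iff, MvPolynomial.coeff_pderiv] at hm
  have h1 : m + Finsupp.single i 1 ∈ P.support := by
    rw [MvPolynomial.mem_support_iff]
    exact left_ne_zero_of_mul hm
  have h2 := MvPolynomial.le_totalDegree h1
  rw [Finsupp.sum_add_index' (by simp) (by simp)] at h2
  simp at h2
  omega

/-- The polynomial `1 - |x|²`. -/
def oneSubNormSq : MvPolynomial (Fin n) ℝ := 1 - ∑ i, MvPolynomial.X i ^ 2

theorem pev_oneSubNormSq (x : Eu n) : pev oneSubNormSq x = 1 - ‖x‖ ^ 2 := by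
  simp [pev, oneSubNormSq, EuclideanSpace.norm_sq_eq]

/-- Multiplication by `1 - |x|²` raises the degree by two and the Laplacian lowers it by two. Thus
`Q ↦ Δ((1 - |x|²) Q)` acts on a finite-dimensional space, where injectivity implies surjectivity. -/
theorem totalDegree_lapP_mul_le {P : MvPolynomial (Fin n) ℝ} {d : ℕ} (hP : P.totalDegree ≤ d) :
    (lapP (oneSubNormSq * P)).totalDegree ≤ d := by
  have h1 : (oneSubNormSq : MvPolynomial (Fin n) ℝ).totalDegree ≤ 2 := by
    refine (MvPolynomial.totalDegree_sub _ _).trans (max_le (by simp) ?_)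
    refine MvPolynomial.totalDegree_finsetSum_le fun i _ => ?_
    simp
  have h2 : (oneSubNormSq * P).totalDegree ≤ d + 1 + 1 :=
    (MvPolynomial.totalDegree_mul _ _).trans (by omega)
  rw [lapP_apply]
  exact MvPolynomial.totalDegree_finsetSum_le fun i _ =>
    totalDegree_pderiv_le (totalDegree_pderiv_le h2 i) i

/-! ### The maximum principle -/

/-- `v` is a viscosity subsolution of the Laplace equation. -/
def TraceSub (v : Eu n → ℝ) (X : Set (Eu n)) : Prop :=
  ∀ x ∈ X, ∀ φ : Eu n → ℝ, ContDiffAt ℝ 2 φ x → (∀ᶠ y in 𝓝 x, v y ≤ φ y) → v x = φ x →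
    0 ≤ (hessian φ x).trace

theorem hessian_posSemidef_of_isLocalMin {φ : Eu n → ℝ} {x : Eu n} (h : ContDiffAt ℝ 2 φ x)
    (hm : IsLocalMin φ x) : (hessian φ x).PosSemidef := by
  have hd : ∀ w, 0 ≤ d2 φ x w w := by
    intro w
    by_contra! hneg
    have hw : w ≠ 0 := by rintro rfl; simp at hneg
    have hw' : 0 < ‖w‖ ^ 2 := by positivity
    obtain ⟨δ, hδ, hT⟩ := taylor_two h (ε := -d2 φ x w w / (4 * ‖w‖ ^ 2))
      (div_pos (by linarith) (by positivity))
    have hlim : Tendsto (fun t : ℝ => x + t • w) (𝓝[>] 0) (𝓝 x) := by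
      have : Tendsto (fun t : ℝ => x + t • w) (𝓝 0) (𝓝 (x + (0 : ℝ) • w)) :=
        Continuous.tendsto (by fun_prop) 0
      rw [zero_smul, add_zero] at this
      exact this.mono_left nhdsWithin_le_nhds
    have hlim2 : Tendsto (fun t : ℝ => ‖t • w‖) (𝓝[>] 0) (𝓝 0) := by
      have : Tendsto (fun t : ℝ => ‖t • w‖) (𝓝 0) (𝓝 (‖(0 : ℝ) • w‖)) :=
        Continuous.tendsto (by fun_prop) 0
      rw [zero_smul, norm_zero] at this
      exact this.mono_left nhdsWithin_le_nhds
    obtain ⟨t, ht1, ht2, ht3⟩ := ((hlim.eventually hm).and ((hlim2.eventually_lt_const hδ).and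
      self_mem_nhdsWithin)).exists
    have ht3' : (0 : ℝ) < t := ht3
    have h1 := hT _ ht2
    rw [hm.fderiv_eq_zero] at h1
    simp only [map_smul, _root_.smul_apply, smul_eq_mul, _root_.zero_apply] at h1
    rw [norm_smul, mul_pow, Real.norm_eq_abs, sq_abs] at h1
    have h2 := (abs_le.1 h1).2
    have h3 : -d2 φ x w w / (4 * ‖w‖ ^ 2) * (t ^ 2 * ‖w‖ ^ 2) = t ^ 2 * (-d2 φ x w w / 4) := by
      field_simp
    rw [h3] at h2
    have h4 : 0 < t ^ 2 * -d2 φ x w w := by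
      apply mul_pos (by positivity); linarith
    nlinarith
  refine Matrix.PosSemidef.of_dotProduct_mulVec_nonneg ?_ fun w => ?_
  · have := hessian_isSymm h
    rw [Matrix.IsHermitian, Matrix.conjTranspose_eq_transpose_of_trivial]
    exact this
  · have h1 := hd (WithLp.toLp 2 w)
    rw [d2_apply] at h1
    refine h1.trans_eq ?_
    simp only [dotProduct, Matrix.mulVec, Finset.mul_sum, star_trivial]
    exact Finset.sum_congr rfl fun i _ => Finset.sum_congr rfl fun j _ => by ring

theorem traceSub_of_contDiff {h : Eu n → ℝ} (hh : ContDiff ℝ 2 h)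
    (hΔ : ∀ x, (hessian h x).trace = 0) (X : Set (Eu n)) : TraceSub h X := by
  intro x _ φ hφ hle heq
  have h1 : ContDiffAt ℝ 2 (fun y => φ y + -h y) x := hφ.add hh.contDiffAt.neg
  have h2 : IsLocalMin (fun y => φ y + -h y) x := by
    filter_upwards [hle] with y hy
    linarith
  have h3 := (hessian_posSemidef_of_isLocalMin h1 h2).trace_nonneg
  rw [hessian_add hφ hh.contDiffAt.neg, hessian_neg, Matrix.trace_add, Matrix.trace_neg, hΔ] at h3
  simpa using h3

theorem hessian_mul_normSq (c : ℝ) (x : Eu n) :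
    hessian (fun y : Eu n => c * ‖y‖ ^ 2) x = (2 * c) • (1 : Matrix (Fin n) (Fin n) ℝ) := by
  have := hessian_comp_normSq (n := n) (f := fun t => c * t) (f' := fun _ => c) (f'' := 0) (x := x)
    (Eventually.of_forall fun t => by simpa using (hasDerivAt_id t).const_mul c)
    (hasDerivAt_const _ _)
  rw [this]; simp

/-- The maximum principle on balls. -/
theorem le_of_le_on_sphere [NeZero n] {v h : Eu n → ℝ} {r : ℝ}
    (hv : UpperSemicontinuousOn v (Metric.closedBall 0 r)) (hsub : TraceSub v (Metric.ball 0 r))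
    (hh : ContDiff ℝ 2 h) (hΔ : ∀ x, (hessian h x).trace = 0)
    (hle : ∀ x ∈ Metric.sphere (0 : Eu n) r, v x ≤ h x) :
    ∀ x ∈ Metric.closedBall (0 : Eu n) r, v x ≤ h x := by
  intro x₁ hx₁
  by_contra! hlt
  obtain ⟨ε, hε, hεlt⟩ : ∃ ε > 0, ε * r ^ 2 < v x₁ - h x₁ := by
    refine ⟨(v x₁ - h x₁) / (r ^ 2 + 1), div_pos (by linarith) (by positivity), ?_⟩
    rw [div_mul_eq_mul_div, div_lt_iff₀ (by positivity)]
    nlinarith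
  -- With the penalty `ε|y|²`, the maximum of `w` exceeds `ε r²` and so is attained inside the ball.
  -- There `h - ε|y|²` plus a constant touches `v` from above, although its Laplacian is `-2nε < 0`.
  let w : Eu n → ℝ := fun y => v y + (-h y + ε * ‖y‖ ^ 2)
  have hg : ContDiff ℝ 2 fun y : Eu n => -h y + ε * ‖y‖ ^ 2 :=
    hh.neg.add (contDiff_const.mul (contDiff_norm_sq ℝ))
  have hw : UpperSemicontinuousOn w (Metric.closedBall 0 r) :=
    hv.add (hg.continuous.upperSemicontinuous.upperSemicontinuousOn _)
  obtain ⟨a, ha, hmax⟩ := hw.exists_isMaxOn ⟨x₁, hx₁⟩ (isCompact_closedBall _ _)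
  have h1 : w x₁ ≤ w a := hmax hx₁
  have h2 : ε * r ^ 2 < w a := by
    have : 0 ≤ ε * ‖x₁‖ ^ 2 := by positivity
    simp only [w] at h1 ⊢
    linarith
  have ha' : a ∈ Metric.ball (0 : Eu n) r := by
    rw [← Metric.closedBall_sdiff_sphere]
    refine ⟨ha, fun has => ?_⟩
    have h3 := hle a has
    have h4 : ‖a‖ = r := by simpa using has
    simp only [w, h4] at h2
    linarith
  let φ : Eu n → ℝ := fun y => h y + (-ε * ‖y‖ ^ 2 + w a)
  have hq : ContDiff ℝ 2 fun y : Eu n => -ε * ‖y‖ ^ 2 := contDiff_const.mul (contDiff_norm_sq ℝ)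
  have h5 := hsub a ha' φ (hh.add (hq.add contDiff_const)).contDiffAt (by
    filter_upwards [Metric.isOpen_ball.mem_nhds ha'] with y hy
    have := hmax (Metric.ball_subset_closedBall hy)
    simp only [w, φ, mem_ofPred_eq] at this ⊢
    linarith) (by simp only [φ, w]; ring)
  have h6 : hessian φ a = hessian h a + ((2 * -ε) • (1 : Matrix (Fin n) (Fin n) ℝ) + 0) := by
    rw [hessian_add hh.contDiffAt (hq.add contDiff_const).contDiffAt,
      hessian_add hq.contDiffAt contDiffAt_const, hessian_const, hessian_mul_normSq]
  rw [h6, Matrix.trace_add, hΔ] at h5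
  simp at h5
  have : (0 : ℝ) < n := by exact_mod_cast NeZero.pos n
  nlinarith

/-- The Dirichlet problem on the unit ball with polynomial data. -/
theorem exists_harmonic_poly [NeZero n] (P : MvPolynomial (Fin n) ℝ) :
    ∃ H : MvPolynomial (Fin n) ℝ, lapP H = 0 ∧ ∀ x : Eu n, ‖x‖ = 1 → pev H x = pev P x := by
  let d := P.totalDegree
  let W := MvPolynomial.restrictTotalDegree (Fin n) ℝ d
  -- The solution is sought as `P - (1 - |x|²) Q`; harmonicity means `T Q = ΔP`. The maximum
  -- principle makes `T` injective, since `(1 - |x|²) Q` vanishes on the sphere.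
  let T : W →ₗ[ℝ] W := LinearMap.restrict (lapP ∘ₗ LinearMap.mulLeft ℝ oneSubNormSq)
    (p := W) (q := W) fun Q hQ => by
      rw [MvPolynomial.mem_restrictTotalDegree] at hQ ⊢
      exact totalDegree_lapP_mul_le hQ
  have hinj : Function.Injective T := by
    rw [← LinearMap.ker_eq_bot, LinearMap.ker_eq_bot']
    intro Q hQ
    have hQ' : lapP (oneSubNormSq * Q.1) = 0 := congrArg Subtype.val hQ
    let g := pev (oneSubNormSq * Q.1)
    have hg : ContDiff ℝ 2 g := (contDiff_pev _).of_le two_le_infty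
    have hgΔ : ∀ x, (hessian g x).trace = 0 := fun x => by
      rw [trace_hessian_pev, hQ']; simp [pev]
    have hgval : ∀ x, g x = (1 - ‖x‖ ^ 2) * pev Q.1 x := fun x => by
      rw [← pev_oneSubNormSq]; simp [g, pev]
    have hgs : ∀ x ∈ Metric.sphere (0 : Eu n) 1, g x = 0 := fun x hx => by
      have : ‖x‖ = 1 := by simpa using hx
      rw [hgval, this]; simp
    have hg0 : ∀ x ∈ Metric.closedBall (0 : Eu n) 1, g x = 0 := by
      intro x hx
      refine le_antisymm ?_ ?_
      · exact le_of_le_on_sphere (h := fun _ => 0)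
          (hg.continuous.upperSemicontinuous.upperSemicontinuousOn _)
          (traceSub_of_contDiff hg hgΔ _) contDiff_const (by simp [hessian_const])
          (fun x hx => (hgs x hx).le) x hx
      · exact le_of_le_on_sphere (v := fun _ => 0)
          (continuous_const.upperSemicontinuous.upperSemicontinuousOn _)
          (traceSub_of_contDiff contDiff_const (by simp [hessian_const]) _) hg hgΔ
          (fun x hx => (hgs x hx).ge) x hx
    have : Q.1 = 0 := by
      -- The cube of side `1/n` at the origin lies in the open unit ball, where `1 - |x|² ≠ 0`;
      -- vanishing on a product of infinite sets suffices for a polynomial to be zero.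
      refine MvPolynomial.funext_set (fun _ => Ioo 0 (1 / (n : ℝ))) (fun i => Ioo_infinite (by
        have : (0 : ℝ) < n := by exact_mod_cast NeZero.pos n
        positivity)) fun x hx => ?_
      have hn : (0 : ℝ) < n := by exact_mod_cast NeZero.pos n
      have hn1 : (1 : ℝ) ≤ n := by exact_mod_cast NeZero.pos n
      have hx2 : ‖WithLp.toLp 2 x‖ ^ 2 < 1 := by
        rw [EuclideanSpace.norm_sq_eq]
        calc ∑ i, ‖x i‖ ^ 2 < ∑ _i : Fin n, (1 / (n : ℝ)) := by
              refine Finset.sum_lt_sum_of_nonempty ⟨0, Finset.mem_univ _⟩ fun i _ => ?_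
              have h1 := (hx i (mem_univ _)).1
              have h2 := (hx i (mem_univ _)).2
              have h3 : 1 / (n : ℝ) ≤ 1 := by rw [div_le_one hn]; exact hn1
              rw [Real.norm_eq_abs, sq_abs]
              nlinarith
          _ = 1 := by simp
      have := hg0 (WithLp.toLp 2 x) (by
        rw [mem_closedBall_zero_iff]
        nlinarith [norm_nonneg (WithLp.toLp 2 x)])
      rw [hgval] at this
      rcases mul_eq_zero.1 this with h | h
      · linarith
      · simpa [pev] using h
    exact Subtype.ext this
  have hsurj : Function.Surjective T := LinearMap.injective_iff_surjective.1 hinj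
  have hmem : lapP P ∈ W := by
    rw [MvPolynomial.mem_restrictTotalDegree, lapP_apply]
    exact MvPolynomial.totalDegree_finsetSum_le fun i _ =>
      totalDegree_pderiv_le ((totalDegree_pderiv_le (d := d + 1) (by omega) i)) i
  obtain ⟨Q, hQ⟩ := hsurj ⟨lapP P, hmem⟩
  have hQ' : lapP (oneSubNormSq * Q.1) = lapP P := congrArg Subtype.val hQ
  refine ⟨P - oneSubNormSq * Q.1, by rw [map_sub, hQ', sub_self], fun x hx => ?_⟩
  have h1 : pev oneSubNormSq x = 0 := by rw [pev_oneSubNormSq, hx]; simp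
  have h2 : pev (P - oneSubNormSq * Q.1) x = pev P x - pev oneSubNormSq x * pev Q.1 x := by
    simp [pev]
  rw [h2, h1, zero_mul, sub_zero]

/-! ### Mean values over spheres -/

/-- The unit sphere. -/
abbrev USphere (n : ℕ) := Metric.sphere (0 : Eu n) 1

theorem nontrivial_eu [NeZero n] : Nontrivial (Eu n) :=
  Module.nontrivial_of_finrank_pos (R := ℝ) (by simp [NeZero.pos])

instance [NeZero n] : NeZero (sphereMeasure n) :=
  have := nontrivial_eu (n := n)
  ⟨by unfold sphereMeasure; exact Measure.toSphere_ne_zero _⟩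

instance [NeZero n] : Nonempty (USphere n) := ⟨⟨EuclideanSpace.single 0 1, by simp⟩⟩

theorem trace_hessian_rotation {h : Eu n → ℝ} (hh : ContDiff ℝ 2 h)
    {A : Matrix (Fin n) (Fin n) ℝ} (hA : A ∈ Matrix.orthogonalGroup (Fin n) ℝ) (x : Eu n) :
    (hessian (fun y => h (mlin A y)) x).trace = (hessian h (mlin A x)).trace := by
  have h1 := hessian_comp_affine (φ := h) (mlin A) 0 x hh.contDiffAt
  have h2 : (Matrix.of fun i j => (mlin A (EuclideanSpace.single j 1)) i) = A := by
    ext i j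
    simp [Matrix.ofLp_toEuclideanCLM]
  simp only [zero_add, h2] at h1
  rw [h1, Matrix.mul_assoc, Matrix.trace_mul_comm, Matrix.mul_assoc,
    (Matrix.mem_orthogonalGroup_iff _ _).1 hA, Matrix.mul_one]

theorem harmonic_le_of_le_on_sphere [NeZero n] {h : Eu n → ℝ} (hh : ContDiff ℝ 2 h)
    (hΔ : ∀ x, (hessian h x).trace = 0) {c : ℝ} (hc : ∀ σ : USphere n, h σ ≤ c) : h 0 ≤ c :=
  le_of_le_on_sphere (r := 1) (h := fun _ => c)
    (hh.continuous.upperSemicontinuous.upperSemicontinuousOn _)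
    (traceSub_of_contDiff hh hΔ _) contDiff_const (by simp [hessian_const])
    (fun x hx => hc ⟨x, hx⟩) 0 (by simp)

/-- The rotation average is realized as a Bochner integral in the space of continuous functions on
the sphere. It therefore lies in any closed convex set containing all the rotated functions, which
pointwise integration would not show. -/
theorem exists_rotation_integral [NeZero n] {F : Set (Matrix (Fin n) (Fin n) ℝ)}
    (R : RotationFamily F) {g : Eu n → ℝ} (hg : Continuous g) :
    ∃ Φ : R.Ω → C(USphere n, ℝ), Integrable Φ R.ν ∧
      (∀ k σ, Φ k σ = g (mlin (R.mat k) (σ : Eu n))) ∧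
      ∀ σ, (∫ k, Φ k ∂(R.ν)) σ = ⨍ σ : USphere n, g σ ∂(sphereMeasure n) := by
  have hrot : Continuous (fun z : R.Ω × USphere n => mlin (R.mat z.1) (z.2 : Eu n)) :=
    continuous_rotation R (a := fun z : R.Ω × USphere n => z.1) (g := fun z => (z.2 : Eu n))
      continuous_fst (by fun_prop)
  have hcont : Continuous (fun z : R.Ω × USphere n => g (mlin (R.mat z.1) (z.2 : Eu n))) :=
    hg.comp' hrot
  let Φ : C(R.Ω, C(USphere n, ℝ)) := ContinuousMap.curry ⟨_, hcont⟩
  have hint : Integrable Φ R.ν :=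
    Φ.continuous.integrable_of_hasCompactSupport (HasCompactSupport.of_compactSpace _)
  have hΦ : ∀ k σ, Φ k σ = g (mlin (R.mat k) (σ : Eu n)) := fun _ _ => rfl
  refine ⟨Φ, hint, hΦ, fun σ => ?_⟩
  rw [ContinuousMap.integral_apply hint]
  simp only [hΦ]
  obtain ⟨C, hC⟩ := (isCompact_sphere (0 : Eu n) 1).exists_bound_of_continuousOn hg.continuousOn
  have hσ : ‖(σ : Eu n)‖ = 1 := by simp
  rw [integral_rotation_eq R hg.measurable (σ : Eu n) (C := C)
    (fun y hy => hC y (by rw [mem_sphere_zero_iff_norm, hy, hσ])), hσ]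
  simp only [one_smul]

/-- The mean value property of harmonic polynomials. -/
theorem harmonic_poly_mean [NeZero n] {F : Set (Matrix (Fin n) (Fin n) ℝ)} (R : RotationFamily F)
    {H : MvPolynomial (Fin n) ℝ} (hH : lapP H = 0) :
    pev H 0 = ⨍ σ : USphere n, pev H σ ∂(sphereMeasure n) := by
  set c := ⨍ σ : USphere n, pev H σ ∂(sphereMeasure n) with hcdef
  -- `S` is the convex set of boundary values of `C²` harmonic functions with the same value at `0`
  -- as `H`. The rotation average of `H` lies in its closure and is the constant `c`; the maximum
  -- principle, applied to nearby elements of `S` from above and below, forces `H(0) = c`.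
  let S : Set C(USphere n, ℝ) := {f | ∃ h : Eu n → ℝ, ContDiff ℝ 2 h ∧
    (∀ x, (hessian h x).trace = 0) ∧ h 0 = pev H 0 ∧ ∀ σ : USphere n, f σ = h σ}
  have hHs : ContDiff ℝ 2 (pev H) := (contDiff_pev H).of_le two_le_infty
  have hHΔ : ∀ x, (hessian (pev H) x).trace = 0 := fun x => by
    rw [trace_hessian_pev, hH]; simp [pev]
  have hS : Convex ℝ S := by
    rintro f ⟨h, h1, h2, h3, h4⟩ f' ⟨h', h1', h2', h3', h4'⟩ a b ha hb hab
    have hmul : ∀ (a : ℝ) (h : Eu n → ℝ) (h1 : ContDiff ℝ 2 h) (h2 : ∀ x, (hessian h x).trace = 0) x,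
        (hessian (fun y => a * h y) x).trace = 0 := fun a h h1 h2 x => by
      rw [← laplacian_eq_trace_hessian]
      have := InnerProductSpace.laplacian_smul a (h1.contDiffAt (x := x))
      rw [laplacian_eq_trace_hessian h, h2, smul_zero] at this
      exact this
    refine ⟨fun x => a * h x + b * h' x, (contDiff_const.mul h1).add (contDiff_const.mul h1'),
      fun x => ?_, ?_, fun σ => by simp [h4, h4']⟩
    · rw [hessian_add (contDiff_const.mul h1).contDiffAt (contDiff_const.mul h1').contDiffAt,
        Matrix.trace_add, hmul a h h1 h2, hmul b h' h1' h2', add_zero]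
    · change a * h 0 + b * h' 0 = _
      rw [h3, h3', ← add_mul, hab, one_mul]
  obtain ⟨Φ, hint, hΦ, hval⟩ := exists_rotation_integral R (continuous_pev H)
  have hmem : ∫ k, Φ k ∂(R.ν) ∈ closure S := by
    refine hS.closure.integral_mem isClosed_closure (Eventually.of_forall fun k => ?_) hint
    refine subset_closure ⟨fun x => pev H (mlin (R.mat k) x),
      hHs.comp (mlin (R.mat k)).contDiff, fun x => ?_, ?_, fun σ => hΦ k σ⟩
    · rw [trace_hessian_rotation hHs (R.orth k), hHΔ]
    · simp
  have hσ : ∀ ε > 0, |pev H 0 - c| ≤ ε := by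
    intro ε hε
    obtain ⟨f, ⟨h, h1, h2, h3, h4⟩, hf⟩ := Metric.mem_closure_iff.1 hmem ε hε
    have hb : ∀ σ : USphere n, |c - h σ| ≤ ε := fun σ => by
      have hv : _ = c := hval σ
      rw [← hv, ← h4 σ, ← Real.dist_eq]
      exact ((ContinuousMap.dist_apply_le_dist σ).trans hf.le)
    have hu := harmonic_le_of_le_on_sphere h1 h2 (c := c + ε) fun σ => by
      linarith [(abs_le.1 (hb σ)).1]
    have hl := harmonic_le_of_le_on_sphere (h := fun x => - h x) (c := ε - c) h1.neg
      (fun x => by rw [hessian_neg, Matrix.trace_neg, h2, neg_zero]) fun σ => by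
      linarith [(abs_le.1 (hb σ)).2]
    rw [h3] at hu hl
    rw [abs_le]; constructor <;> linarith
  have : |pev H 0 - c| ≤ 0 := le_of_forall_pos_le_add fun ε hε => by simpa using hσ ε hε
  exact sub_eq_zero.1 (abs_nonpos_iff.1 this)

/-- Polynomials are dense in the continuous functions on the sphere. -/
theorem exists_poly_near (f : C(USphere n, ℝ)) {ε : ℝ} (hε : 0 < ε) :
    ∃ P : MvPolynomial (Fin n) ℝ, ∀ σ : USphere n, |f σ - pev P σ| < ε := by
  let co : Fin n → C(USphere n, ℝ) := fun i => ⟨fun σ => (σ : Eu n) i, by fun_prop⟩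
  let A : Subalgebra ℝ C(USphere n, ℝ) := (MvPolynomial.aeval (R := ℝ) co).range
  have hsep : A.SeparatesPoints := by
    intro x y hxy
    obtain ⟨i, hi⟩ : ∃ i, (x : Eu n) i ≠ (y : Eu n) i := by
      by_contra! hall
      exact hxy (Subtype.ext (by ext i; exact hall i))
    exact ⟨co i, ⟨co i, ⟨MvPolynomial.X i, by simp⟩, rfl⟩, hi⟩
  have htop := ContinuousMap.subalgebra_topologicalClosure_eq_top_of_separatesPoints A hsep
  have hf : f ∈ A.topologicalClosure := htop ▸ Algebra.mem_top
  obtain ⟨g, ⟨P, rfl⟩, hg⟩ := Metric.mem_closure_iff.1 hf ε hε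
  have hev : ∀ σ : USphere n, (MvPolynomial.aeval co P) σ = pev P σ := by
    intro σ
    have := MvPolynomial.comp_aeval_apply co (ContinuousMap.evalAlgHom ℝ ℝ σ) P
    exact this.trans (by rw [MvPolynomial.aeval_eq_eval]; rfl)
  refine ⟨P, fun σ => ?_⟩
  rw [← hev, ← Real.dist_eq]
  exact (ContinuousMap.dist_apply_le_dist σ).trans_lt hg

/-- Bounded upper semicontinuous functions on the sphere are decreasing limits of continuous
ones; only the convergence is recorded. -/
theorem exists_continuous_approx [NeZero n] {v : USphere n → ℝ} (hv : UpperSemicontinuous v) {C : ℝ}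
    (hC : ∀ σ, |v σ| ≤ C) :
    ∃ f : ℕ → C(USphere n, ℝ), (∀ k σ, v σ ≤ f k σ) ∧ (∀ k σ, |f k σ| ≤ C) ∧
      ∀ σ, Tendsto (fun k => f k σ) atTop (𝓝 (v σ)) := by
  -- The sup-convolution is `k`-Lipschitz and stays between `v` and `C`. Points at distance at least
  -- `δ` from `σ` cannot contribute once `kδ > 2C`, and semicontinuity controls the others.
  let g : ℕ → USphere n → ℝ := fun k σ => ⨆ τ, (v τ - k * dist σ τ)
  have hub : ∀ (k : ℕ) σ τ, v τ - k * dist σ τ ≤ C := fun k σ τ => by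
    have := (abs_le.1 (hC τ)).2
    have : 0 ≤ (k : ℝ) * dist σ τ := by positivity
    linarith
  have hbdd : ∀ (k : ℕ) σ, BddAbove (range fun τ => v τ - k * dist σ τ) := fun k σ =>
    ⟨C, by rintro _ ⟨τ, rfl⟩; exact hub k σ τ⟩
  have hle : ∀ k σ, v σ ≤ g k σ := fun k σ => by
    have := le_ciSup (hbdd k σ) σ
    simpa using this
  have hlip : ∀ k : ℕ, LipschitzWith k (g k) := fun k => by
    refine LipschitzWith.of_le_add_mul _ fun σ σ' => ciSup_le fun τ => ?_
    have h1 := le_ciSup (hbdd k σ') τ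
    have h2 := dist_triangle σ' σ τ
    have h3 : (k : ℝ) * dist σ' τ ≤ k * (dist σ' σ + dist σ τ) := by gcongr
    rw [dist_comm σ' σ] at h3
    simp only [NNReal.coe_natCast]
    change v τ - k * dist σ τ ≤ (⨆ τ, (v τ - k * dist σ' τ)) + k * dist σ σ'
    linarith
  refine ⟨fun k => ⟨g k, (hlip k).continuous⟩, hle, fun k σ => ?_, fun σ => ?_⟩
  · exact abs_le.2 ⟨(abs_le.1 (hC σ)).1.trans (hle k σ), ciSup_le fun τ => hub k σ τ⟩
  · rw [Metric.tendsto_atTop]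
    intro ε hε
    obtain ⟨δ, hδ, hb⟩ := Metric.eventually_nhds_iff_ball.1 (hv σ (v σ + ε / 2) (by linarith))
    obtain ⟨N, hN⟩ := exists_nat_gt (2 * C / δ)
    refine ⟨N, fun k hk => ?_⟩
    have hgk : g k σ ≤ v σ + ε / 2 := by
      refine ciSup_le fun τ => ?_
      by_cases hτ : dist τ σ < δ
      · have h1 := hb τ hτ
        have : 0 ≤ (k : ℝ) * dist σ τ := by positivity
        linarith
      · push Not at hτ
        rw [dist_comm] at hτ
        have h1 : 2 * C < k * δ := by
          rw [div_lt_iff₀ hδ] at hN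
          exact hN.trans_le (by gcongr)
        have h2 : (k : ℝ) * δ ≤ k * dist σ τ := by gcongr
        have h3 := abs_le.1 (hC τ)
        have h4 := abs_le.1 (hC σ)
        linarith
    have := hle k σ
    change dist (g k σ) (v σ) < ε
    rw [Real.dist_eq, abs_of_nonneg (by linarith)]
    linarith

/-- Subsolutions of the Laplace equation lie below their spherical means. -/
theorem le_sphere_average [NeZero n] {F : Set (Matrix (Fin n) (Fin n) ℝ)} (R : RotationFamily F)
    {v : Eu n → ℝ} (hv : UpperSemicontinuous v) {C : ℝ} (hC : ∀ x, |v x| ≤ C)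
    (hsub : TraceSub v (Metric.ball 0 1)) :
    v 0 ≤ ⨍ σ : USphere n, v σ ∂(sphereMeasure n) := by
  have hci : ∀ f : C(USphere n, ℝ), Integrable f (sphereMeasure n) := fun f =>
    f.continuous.integrable_of_hasCompactSupport (HasCompactSupport.of_compactSpace _)
  have hcont : ∀ f : C(USphere n, ℝ), (∀ σ : USphere n, v σ ≤ f σ) →
      v 0 ≤ ⨍ σ, f σ ∂(sphereMeasure n) := by
    intro f hf
    refine le_of_forall_pos_le_add fun ε hε => ?_
    -- Approximating `f + ε/2` to within `ε/2` places the polynomial between `f` and `f + ε` on the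
    -- sphere.
    obtain ⟨P, hP⟩ := exists_poly_near (f + ContinuousMap.const _ (ε / 2)) (half_pos hε)
    obtain ⟨H, hH, hHP⟩ := exists_harmonic_poly P
    have hHs : ContDiff ℝ 2 (pev H) := (contDiff_pev H).of_le two_le_infty
    have hHΔ : ∀ x, (hessian (pev H) x).trace = 0 := fun x => by
      rw [trace_hessian_pev, hH]; simp [pev]
    have hPσ : ∀ σ : USphere n, f σ ≤ pev H σ ∧ pev H σ ≤ f σ + ε := fun σ => by
      rw [hHP σ (by simp)]
      have := abs_lt.1 (hP σ)
      simp at this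
      constructor <;> linarith
    have h1 : v 0 ≤ pev H 0 := le_of_le_on_sphere (r := 1) (hv.upperSemicontinuousOn _) hsub hHs hHΔ
      (fun x hx => (hf ⟨x, hx⟩).trans (hPσ ⟨x, hx⟩).1) 0 (by simp)
    rw [harmonic_poly_mean R hH] at h1
    refine h1.trans ?_
    have h2 : ⨍ σ : USphere n, (f σ + ε) ∂(sphereMeasure n) =
        ⨍ σ, f σ ∂(sphereMeasure n) + ε := by
      rw [average, average, integral_add (hci f).to_average (integrable_const _)]
      simp
    rw [← h2]
    refine integral_mono ?_ ?_ fun σ => (hPσ σ).2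
    · exact (hci ⟨fun σ : USphere n => pev H σ,
        (continuous_pev H).comp continuous_subtype_val⟩).to_average
    · exact ((hci f).add (integrable_const _)).to_average
  obtain ⟨f, hf1, hf2, hf3⟩ := exists_continuous_approx (v := fun σ : USphere n => v σ)
    (hv.comp continuous_subtype_val) (fun σ => hC σ)
  refine ge_of_tendsto' (x := atTop) ?_ fun k => hcont (f k) (hf1 k)
  refine tendsto_integral_of_dominated_convergence (fun _ => C)
    (fun k => (hci (f k)).to_average.aestronglyMeasurable) (integrable_const _) ?_ ?_
  · exact fun k => Eventually.of_forall fun σ => hf2 k σ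
  · exact Eventually.of_forall hf3

/-! ### Polar coordinates and mean values over balls -/

/-- The closed unit ball. -/
abbrev UBall (n : ℕ) : Set (Eu n) := Metric.closedBall (0 : Eu n) 1

/-- The homeomorphism of the punctured space with sphere times half-line transports the volume. The
weight of the radial measure is moved into the integrand, so that Fubini can be used with Lebesgue
measure on the half-line. -/
theorem polar_aux [NeZero n] {f : Eu n → ℝ} (hf : Integrable f) :
    Integrable (fun z : ℝ × USphere n => z.1 ^ (n - 1) * f (z.1 • (z.2 : Eu n)))
      ((volume.restrict (Ioi 0)).prod (sphereMeasure n)) ∧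
    ∫ x, f x = ∫ z : ℝ × USphere n, z.1 ^ (n - 1) * f (z.1 • (z.2 : Eu n))
      ∂((volume.restrict (Ioi 0)).prod (sphereMeasure n)) := by
  have := nontrivial_eu (n := n)
  have hdim : Module.finrank ℝ (Eu n) = n := by simp
  have hs0 : MeasurableSet ({0}ᶜ : Set (Eu n)) := (measurableSet_singleton 0).compl
  have hmp := (volume : Measure (Eu n)).measurePreserving_homeomorphUnitSphereProd
  rw [hdim] at hmp
  have hemb := (homeomorphUnitSphereProd (Eu n)).measurableEmbedding
  let G : USphere n × Ioi (0 : ℝ) → ℝ := fun z => f (z.2.1 • (z.1 : Eu n))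
  have hG : ∀ x, G (homeomorphUnitSphereProd (Eu n) x) = f x := fun x => by
    have hx : (x : Eu n) ≠ 0 := x.2
    simp [G, smul_smul, hx]
  have hres : volume.restrict ({0}ᶜ : Set (Eu n)) = volume := restrict_compl_singleton _
  have h1 : Integrable (fun x : ({0}ᶜ : Set (Eu n)) => f x) (Measure.comap Subtype.val volume) := by
    have : IntegrableOn f ({0}ᶜ : Set (Eu n)) := hf.integrableOn
    exact (integrableOn_iff_comap_subtypeVal hs0).1 this
  have h2 : ∫ x, f x = ∫ x : ({0}ᶜ : Set (Eu n)), f x ∂(Measure.comap Subtype.val volume) := by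
    rw [integral_subtype_comap hs0 f, hres]
  have h3 : Integrable G ((sphereMeasure n).prod (Measure.volumeIoiPow (n - 1))) := by
    refine (hmp.integrable_comp_emb hemb).1 ?_
    simpa only [Function.comp_def, hG] using h1
  have h4 : ∫ x, f x = ∫ z, G z ∂((sphereMeasure n).prod (Measure.volumeIoiPow (n - 1))) := by
    have := hmp.integral_comp hemb G
    simp only [hG] at this
    rw [h2, this]; rfl
  let ν₀ : Measure (Ioi (0 : ℝ)) := Measure.comap Subtype.val volume
  let ρ : Ioi (0 : ℝ) → ENNReal := fun r => .ofReal (r.1 ^ (n - 1))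
  have hρ : Measurable ρ := by fun_prop
  have hσf : SigmaFinite ν₀ := by
    have e1 : MeasurePreserving (Subtype.val : Ioi (0 : ℝ) → ℝ) ν₀ (volume.restrict (Ioi 0)) :=
      measurePreserving_subtype_coe measurableSet_Ioi
    refine SigmaFinite.of_map ν₀ e1.aemeasurable ?_
    rw [e1.map_eq]
    infer_instance
  have hden : (sphereMeasure n).prod (Measure.volumeIoiPow (n - 1)) =
      ((sphereMeasure n).prod ν₀).withDensity (fun z => ρ z.2) := by
    rw [Measure.volumeIoiPow]
    exact prod_withDensity_right hρ
  have hρ2 : Measurable fun z : USphere n × Ioi (0 : ℝ) => ρ z.2 := hρ.comp measurable_snd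
  have hlt : ∀ᵐ z ∂((sphereMeasure n).prod ν₀), ρ z.2 < ⊤ :=
    Eventually.of_forall fun z => ENNReal.ofReal_lt_top
  have hreal : ∀ z : USphere n × Ioi (0 : ℝ), (ρ z.2).toReal • G z =
      z.2.1 ^ (n - 1) * f (z.2.1 • (z.1 : Eu n)) := fun z => by
    rw [smul_eq_mul, ENNReal.toReal_ofReal (pow_nonneg (le_of_lt z.2.2) _)]
  rw [hden, integrable_withDensity_iff_integrable_smul' hρ2 hlt] at h3
  rw [hden, integral_withDensity_eq_integral_toReal_smul hρ2 hlt] at h4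
  simp only [hreal] at h3 h4
  have hmp2 : MeasurePreserving (fun z : USphere n × Ioi (0 : ℝ) => (z.2.1, z.1))
      ((sphereMeasure n).prod ν₀) ((volume.restrict (Ioi 0)).prod (sphereMeasure n)) := by
    have e1 : MeasurePreserving (Subtype.val : Ioi (0 : ℝ) → ℝ) ν₀ (volume.restrict (Ioi 0)) :=
      measurePreserving_subtype_coe measurableSet_Ioi
    exact Measure.measurePreserving_swap.comp ((MeasurePreserving.id (sphereMeasure n)).prod e1)
  have hemb2 : MeasurableEmbedding (fun z : USphere n × Ioi (0 : ℝ) => (z.2.1, z.1)) :=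
    MeasurableEquiv.prodComm.measurableEmbedding.comp
      (MeasurableEmbedding.id.prodMap (MeasurableEmbedding.subtype_coe measurableSet_Ioi))
  constructor
  · exact (hmp2.integrable_comp_emb hemb2).1 h3
  · rw [h4]
    exact hmp2.integral_comp hemb2
      (fun z : ℝ × USphere n => z.1 ^ (n - 1) * f (z.1 • (z.2 : Eu n)))

/-- Integration in polar coordinates. -/
theorem integral_polar [NeZero n] {f : Eu n → ℝ} (hf : Integrable f) :
    ∫ x, f x = ∫ t in Ioi (0 : ℝ), t ^ (n - 1) * ∫ σ : USphere n, f (t • (σ : Eu n))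
      ∂(sphereMeasure n) := by
  obtain ⟨h1, h2⟩ := polar_aux hf
  rw [h2, integral_prod _ h1]
  simp only [integral_const_mul]

theorem integrableOn_polar [NeZero n] {f : Eu n → ℝ} (hf : Integrable f) :
    IntegrableOn (fun t : ℝ => t ^ (n - 1) * ∫ σ : USphere n, f (t • (σ : Eu n))
      ∂(sphereMeasure n)) (Ioi 0) := by
  have := (polar_aux hf).1.integral_prod_left
  simpa only [integral_const_mul, IntegrableOn] using this

theorem sphereMeasure_real_univ [NeZero n] :
    (sphereMeasure n).real univ = n * (volume : Measure (Eu n)).real (UBall n) := by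
  rw [sphereMeasure, Measure.toSphere_real_apply_univ]
  simp [measureReal_def, Measure.addHaar_closedBall_eq_addHaar_ball]

theorem volume_ball_pos : 0 < (volume : Measure (Eu n)).real (UBall n) :=
  ENNReal.toReal_pos (Metric.measure_closedBall_pos _ _ one_pos).ne'
    measure_closedBall_lt_top.ne

/-- The factor `n` is the ratio of the area of the unit sphere to the volume of the unit ball. -/
theorem ball_average_eq [NeZero n] {f : Eu n → ℝ} (hf : IntegrableOn f (UBall n)) :
    ⨍ x in UBall n, f x = n * ∫ t in Ioc (0 : ℝ) 1, t ^ (n - 1) *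
      ⨍ σ : USphere n, f (t • (σ : Eu n)) ∂(sphereMeasure n) := by
  have h1 := integral_polar (hf.integrable_indicator Metric.isClosed_closedBall.measurableSet)
  rw [integral_indicator Metric.isClosed_closedBall.measurableSet] at h1
  have hn : (n : ℝ) ≠ 0 := by exact_mod_cast NeZero.ne n
  have hv := (volume_ball_pos (n := n)).ne'
  have h2 : ∀ t ∈ Ioi (0 : ℝ), t ^ (n - 1) * ∫ σ : USphere n,
      (UBall n).indicator f (t • (σ : Eu n)) ∂(sphereMeasure n) =
      (Ioc (0 : ℝ) 1).indicator (fun t => t ^ (n - 1) * ∫ σ : USphere n, f (t • (σ : Eu n))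
        ∂(sphereMeasure n)) t := by
    intro t ht
    have ht' : (0 : ℝ) < t := ht
    by_cases h : t ≤ 1
    · have h3 : ∀ σ : USphere n, (UBall n).indicator f (t • (σ : Eu n)) = f (t • (σ : Eu n)) :=
        fun σ => indicator_of_mem (by simp [norm_smul, abs_of_pos ht', h]) _
      simp only [h3]
      rw [indicator_of_mem (show t ∈ Ioc (0 : ℝ) 1 from ⟨ht', h⟩)]
    · have h3 : ∀ σ : USphere n, (UBall n).indicator f (t • (σ : Eu n)) = 0 :=
        fun σ => indicator_of_notMem (by simpa [norm_smul, abs_of_pos ht'] using h) _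
      simp only [h3]
      rw [indicator_of_notMem (fun hh : t ∈ Ioc (0 : ℝ) 1 => h hh.2)]
      simp
  rw [setIntegral_congr_fun measurableSet_Ioi h2, integral_indicator measurableSet_Ioc,
    Measure.restrict_restrict measurableSet_Ioc,
    inter_eq_self_of_subset_left (Ioc_subset_Ioi_self : Ioc (0 : ℝ) 1 ⊆ Ioi 0)] at h1
  rw [setAverage_eq, h1]
  simp only [average_eq, sphereMeasure_real_univ, smul_eq_mul]
  rw [← integral_const_mul, ← integral_const_mul]
  congr 1
  ext t
  field_simp

theorem integrableOn_pow_mul_sphereAverage [NeZero n] {f : Eu n → ℝ}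
    (hf : IntegrableOn f (UBall n)) :
    IntegrableOn (fun t : ℝ => t ^ (n - 1) * ⨍ σ : USphere n, f (t • (σ : Eu n))
      ∂(sphereMeasure n)) (Ioc 0 1) := by
  have h1 := (integrableOn_polar (hf.integrable_indicator
    Metric.isClosed_closedBall.measurableSet)).mono_set
      (Ioc_subset_Ioi_self : Ioc (0 : ℝ) 1 ⊆ Ioi 0)
  have h2 : IntegrableOn _ (Ioc (0 : ℝ) 1) := h1.const_mul ((sphereMeasure n).real univ)⁻¹
  refine h2.congr_fun (fun t ht => ?_) measurableSet_Ioc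
  have h3 : ∀ σ : USphere n, (UBall n).indicator f (t • (σ : Eu n)) = f (t • (σ : Eu n)) :=
    fun σ => indicator_of_mem (by simp [norm_smul, abs_of_pos ht.1, ht.2]) _
  simp only [h3, average_eq, smul_eq_mul]
  ring

theorem integral_pow_mul_const [NeZero n] (c : ℝ) :
    n * ∫ t in Ioc (0 : ℝ) 1, t ^ (n - 1) * c = c := by
  have hn : (n : ℝ) ≠ 0 := by exact_mod_cast NeZero.ne n
  have hn' : n - 1 + 1 = n := Nat.succ_pred_eq_of_pos (NeZero.pos n)
  rw [integral_mul_const, ← intervalIntegral.integral_of_le zero_le_one, integral_pow, hn']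
  have : ((n - 1 : ℕ) : ℝ) + 1 = n := by exact_mod_cast hn'
  rw [this]; simp [NeZero.ne n]

theorem le_ball_average_of_le_sphere [NeZero n] {f : Eu n → ℝ} (hf : IntegrableOn f (UBall n))
    {c : ℝ} (h : ∀ t ∈ Ioc (0 : ℝ) 1, c ≤ ⨍ σ : USphere n, f (t • (σ : Eu n))
      ∂(sphereMeasure n)) : c ≤ ⨍ z in UBall n, f z := by
  rw [ball_average_eq hf, ← integral_pow_mul_const (n := n) c]
  refine mul_le_mul_of_nonneg_left ?_ (Nat.cast_nonneg n)
  refine setIntegral_mono_on ((continuous_pow _).mul continuous_const).integrableOn_Ioc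
    (integrableOn_pow_mul_sphereAverage hf) measurableSet_Ioc fun t ht => ?_
  exact mul_le_mul_of_nonneg_left (h t ht) (pow_nonneg ht.1.le _)

theorem ball_average_le_of_sphere_le [NeZero n] {f : Eu n → ℝ} (hf : IntegrableOn f (UBall n))
    {c : ℝ} (h : ∀ t ∈ Ioc (0 : ℝ) 1, ⨍ σ : USphere n, f (t • (σ : Eu n))
      ∂(sphereMeasure n) ≤ c) : ⨍ z in UBall n, f z ≤ c := by
  rw [ball_average_eq hf, ← integral_pow_mul_const (n := n) c]
  refine mul_le_mul_of_nonneg_left ?_ (Nat.cast_nonneg n)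
  refine setIntegral_mono_on (integrableOn_pow_mul_sphereAverage hf)
    ((continuous_pow _).mul continuous_const).integrableOn_Ioc measurableSet_Ioc fun t ht => ?_
  exact mul_le_mul_of_nonneg_left (h t ht) (pow_nonneg ht.1.le _)

/-! ### Ellipsoids -/

/-- `v` is a viscosity subsolution of the equation with the coefficients `C Cᵗ`. -/
def OpSub (C : Matrix (Fin n) (Fin n) ℝ) (v : Eu n → ℝ) (X : Set (Eu n)) : Prop :=
  ∀ x ∈ X, ∀ φ : Eu n → ℝ, ContDiffAt ℝ 2 φ x → (∀ᶠ y in 𝓝 x, v y ≤ φ y) → v x = φ x →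
    0 ≤ (Cᵀ * hessian φ x * C).trace

theorem matrix_of_mlin (A : Matrix (Fin n) (Fin n) ℝ) :
    (Matrix.of fun i j => (mlin A (EuclideanSpace.single j 1)) i) = A := by
  ext i j
  simp [Matrix.ofLp_toEuclideanCLM]

/-- The substitution `x = a + C y` turns the operator with coefficients `C Cᵗ` into the Laplacian;
test functions in the new variable are carried back by `D = C⁻¹`. -/
theorem OpSub.traceSub_comp {C D : Matrix (Fin n) (Fin n) ℝ} (hDC : D * C = 1) (hCD : C * D = 1)
    {v : Eu n → ℝ} {X : Set (Eu n)} (hv : OpSub C v X) (a : Eu n) :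
    TraceSub (fun y => v (a + mlin C y)) {y | a + mlin C y ∈ X} := by
  intro y hy ψ hψ hle heq
  have hinv : ∀ z, mlin D (mlin C z) = z := fun z => by rw [← mlin_mul, hDC]; simp
  have hinv' : ∀ z, mlin C (mlin D z) = z := fun z => by rw [← mlin_mul, hCD]; simp
  let x := a + mlin C y
  have hDx : -mlin D a + mlin D x = y := by simp [x, hinv]
  have hψ' : ContDiffAt ℝ 2 ψ (-mlin D a + mlin D x) := by rwa [hDx]
  have hcd : ContDiffAt ℝ 2 (fun z => ψ (-mlin D a + mlin D z)) x :=
    hψ'.comp x (contDiffAt_const.add (mlin D).contDiff.contDiffAt)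
  have hlim : Tendsto (fun z => -mlin D a + mlin D z) (𝓝 x) (𝓝 y) := by
    have : Continuous fun z => -mlin D a + mlin D z := by fun_prop
    simpa [hDx] using this.tendsto x
  have h1 := hv x hy (fun z => ψ (-mlin D a + mlin D z)) hcd (by
    filter_upwards [hlim.eventually hle] with z hz
    simpa [hinv'] using hz) (by simpa [hDx] using heq)
  rw [hessian_comp_affine (mlin D) (-mlin D a) x hψ', hDx, matrix_of_mlin] at h1
  have h2 : Cᵀ * (Dᵀ * hessian ψ y * D) * C = (D * C)ᵀ * hessian ψ y * (D * C) := by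
    simp only [Matrix.transpose_mul, Matrix.mul_assoc]
  rwa [h2, hDC, Matrix.transpose_one, Matrix.one_mul, Matrix.mul_one] at h1

theorem OpSub.smul {C : Matrix (Fin n) (Fin n) ℝ} {v : Eu n → ℝ} {X : Set (Eu n)}
    (hv : OpSub C v X) (t : ℝ) : OpSub (t • C) v X := by
  intro x hx φ h1 h2 h3
  have := hv x hx φ h1 h2 h3
  simp only [Matrix.transpose_smul, Matrix.smul_mul, Matrix.mul_smul, Matrix.trace_smul, smul_eq_mul]
  rw [← mul_assoc]
  exact mul_nonneg (mul_self_nonneg t) this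

theorem traceSub_iff_opSub_one {v : Eu n → ℝ} {X : Set (Eu n)} : TraceSub v X ↔ OpSub 1 v X := by
  simp [TraceSub, OpSub]

theorem mlin_smul (t : ℝ) (C : Matrix (Fin n) (Fin n) ℝ) (x : Eu n) :
    mlin (t • C) x = t • mlin C x := by
  simp [mlin]

theorem integrableOn_ball_of_bound {v : Eu n → ℝ} (hv : Measurable v) {K : ℝ}
    (hK : ∀ x, |v x| ≤ K) : IntegrableOn v (UBall n) := by
  have : IsFiniteMeasure (volume.restrict (UBall n)) :=
    ⟨by rw [Measure.restrict_apply_univ]; exact measure_closedBall_lt_top⟩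
  exact Integrable.of_bound hv.aestronglyMeasurable K (Eventually.of_forall hK)

/-- Subsolutions lie below their averages over ellipsoids. -/
theorem OpSub.le_ellipsoid_average [NeZero n] {F : Set (Matrix (Fin n) (Fin n) ℝ)}
    (R : RotationFamily F) {C D : Matrix (Fin n) (Fin n) ℝ} (hDC : D * C = 1) (hCD : C * D = 1)
    {v : Eu n → ℝ} {X : Set (Eu n)} (hsub : OpSub C v X) (hv : UpperSemicontinuous v) {K : ℝ}
    (hK : ∀ x, |v x| ≤ K) {x : Eu n} (hX : ∀ z ∈ UBall n, x + mlin C z ∈ X) :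
    v x ≤ ⨍ z in UBall n, v (x + mlin C z) := by
  -- The operator with `C` replaced by `t C` has the same subsolutions, so the spherical inequality
  -- holds on every concentric ellipsoid, and these are integrated over `t`.
  have hsph : ∀ t ∈ Ioc (0 : ℝ) 1, v x ≤ ⨍ σ : USphere n, v (x + mlin C (t • (σ : Eu n)))
      ∂(sphereMeasure n) := by
    intro t ht
    have h1 := (hsub.smul t).traceSub_comp (D := t⁻¹ • D) (by
      rw [Matrix.smul_mul, Matrix.mul_smul, hDC, smul_smul, inv_mul_cancel₀ ht.1.ne', one_smul])
      (by rw [Matrix.smul_mul, Matrix.mul_smul, hCD, smul_smul, mul_inv_cancel₀ ht.1.ne',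
        one_smul]) x
    have h2 := le_sphere_average R (v := fun y => v (x + mlin (t • C) y))
      (hv.comp (by fun_prop)) (fun y => hK _) (fun y hy => h1 y (by
        change x + mlin (t • C) y ∈ X
        rw [mlin_smul, ← map_smul]
        refine hX _ ?_
        rw [mem_ball_zero_iff] at hy
        rw [mem_closedBall_zero_iff, norm_smul, Real.norm_eq_abs, abs_of_pos ht.1]
        nlinarith [ht.1, ht.2, norm_nonneg y]))
    simpa only [map_zero, add_zero, mlin_smul, ← map_smul] using h2
  have hmeas : Measurable fun z => v (x + mlin C z) :=
    (hv.comp (g := fun z => x + mlin C z) (by fun_prop)).measurable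
  have hint : IntegrableOn (fun z => v (x + mlin C z)) (UBall n) :=
    integrableOn_ball_of_bound hmeas fun z => hK _
  exact le_ball_average_of_le_sphere hint hsph

/-- Subsolutions of the Laplace equation lie below their averages over balls. -/
theorem TraceSub.le_ball_average [NeZero n] {F : Set (Matrix (Fin n) (Fin n) ℝ)}
    (R : RotationFamily F) {v : Eu n → ℝ} {X : Set (Eu n)} (hsub : TraceSub v X)
    (hv : UpperSemicontinuous v) {K : ℝ} (hK : ∀ x, |v x| ≤ K) {x : Eu n} {r : ℝ} (hr : 0 < r)
    (hX : ∀ z ∈ UBall n, x + r • z ∈ X) :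
    v x ≤ ⨍ z in UBall n, v (x + r • z) := by
  have h1 := (traceSub_iff_opSub_one.1 hsub).smul r
  have hl : ∀ z : Eu n, mlin (r • (1 : Matrix (Fin n) (Fin n) ℝ)) z = r • z := fun z => by
    rw [mlin_smul]; simp
  have h2 := h1.le_ellipsoid_average R (D := r⁻¹ • 1) (by simp [smul_smul, hr.ne'])
    (by simp [smul_smul, hr.ne']) hv hK (x := x) (by simpa only [hl] using hX)
  simpa only [hl] using h2

/-! ### The Riesz kernel -/

/-- The factor in `K_p'(t) = k t ^ (1 - p)`. -/
def kernelSlope (p : ℝ) : ℝ := if p = 2 then 1 else |p - 2|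

theorem kernelSlope_pos (p : ℝ) : 0 < kernelSlope p := by
  unfold kernelSlope
  split_ifs with h
  · exact one_pos
  · exact abs_pos.2 (sub_ne_zero.2 h)

theorem hasDerivAt_rieszKernel (p : ℝ) {t : ℝ} (ht : 0 < t) :
    HasDerivAt (rieszKernel p) (kernelSlope p * t ^ (1 - p)) t := by
  rcases lt_trichotomy p 2 with h | h | h
  · have h1 : rieszKernel p = fun t => t ^ (2 - p) := by ext t; simp [rieszKernel, h]
    rw [h1, kernelSlope, if_neg h.ne, abs_of_neg (by linarith)]
    convert Real.hasDerivAt_rpow_const (p := 2 - p) (Or.inl ht.ne') using 1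
    rw [show (2 - p - 1 : ℝ) = 1 - p by ring]; ring
  · have h1 : rieszKernel p = Real.log := by ext t; simp [rieszKernel, h]
    rw [h1, kernelSlope, if_pos h, h]
    convert Real.hasDerivAt_log ht.ne' using 1
    rw [show (1 - 2 : ℝ) = -1 by norm_num, Real.rpow_neg_one, one_mul]
  · have h1 : rieszKernel p =ᶠ[𝓝 t] fun t => -t ^ (2 - p) := by
      filter_upwards [eventually_gt_nhds ht] with s hs
      rw [rieszKernel, if_neg (by linarith), if_neg h.ne', one_div, ← Real.rpow_neg hs.le]
      simp
    rw [kernelSlope, if_neg h.ne', abs_of_pos (by linarith)]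
    refine HasDerivAt.congr_of_eventuallyEq ?_ h1
    refine (Real.hasDerivAt_rpow_const (p := 2 - p) (Or.inl ht.ne')).neg.congr_deriv ?_
    rw [show (2 - p - 1 : ℝ) = 1 - p by ring]; ring

theorem rieszKernel_strictMonoOn (p : ℝ) : StrictMonoOn (rieszKernel p) (Ioi 0) := by
  refine strictMonoOn_of_deriv_pos (convex_Ioi 0)
    (fun t ht => (hasDerivAt_rieszKernel p ht).continuousAt.continuousWithinAt) fun t ht => ?_
  rw [interior_Ioi] at ht
  rw [(hasDerivAt_rieszKernel p ht).deriv]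
  exact mul_pos (kernelSlope_pos p) (Real.rpow_pos_of_pos ht _)

theorem rieszKernel_lt (p : ℝ) {s t : ℝ} (hs : 0 < s) (hst : s < t) :
    rieszKernel p s < rieszKernel p t :=
  rieszKernel_strictMonoOn p hs (hs.trans hst) hst

theorem rieszKernel_le (p : ℝ) {s t : ℝ} (hs : 0 < s) (hst : s ≤ t) :
    rieszKernel p s ≤ rieszKernel p t :=
  (rieszKernel_strictMonoOn p).monotoneOn hs (hs.trans_le hst) hst

/-- `ψ` is increasing and convex as a function of `K_p` on `(0, δ)`. -/
def KernelConvex (p : ℝ) (ψ : ℝ → ℝ) (δ : ℝ) : Prop :=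
  ∀ s t r, 0 < s → s < t → t < r → r < δ → ψ s ≤ ψ t ∧
    (ψ t - ψ s) * (rieszKernel p r - rieszKernel p t) ≤
      (ψ r - ψ t) * (rieszKernel p t - rieszKernel p s)

/-- Stated without quotients, kernel convexity is closed under pointwise limits, so that it passes
from the truncations to `u`. -/
theorem KernelConvex.of_tendsto {p δ : ℝ} {f : ℕ → ℝ → ℝ} {ψ : ℝ → ℝ}
    (hf : ∀ N, KernelConvex p (f N) δ)
    (hlim : ∀ t, 0 < t → t < δ → Tendsto (fun N => f N t) atTop (𝓝 (ψ t))) :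
    KernelConvex p ψ δ := by
  intro s t r hs hst htr hr
  have ls := hlim s hs (hst.trans (htr.trans hr))
  have lt := hlim t (hs.trans hst) (htr.trans hr)
  have lr := hlim r (hs.trans (hst.trans htr)) hr
  exact ⟨le_of_tendsto_of_tendsto' ls lt fun N => (hf N s t r hs hst htr hr).1,
    le_of_tendsto_of_tendsto' ((lt.sub ls).mul_const _) ((lr.sub lt).mul_const _)
      fun N => (hf N s t r hs hst htr hr).2⟩

theorem KernelConvex.congr {p δ : ℝ} {f g : ℝ → ℝ} (hf : KernelConvex p f δ)
    (h : ∀ t, 0 < t → t < δ → f t = g t) : KernelConvex p g δ :=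
  .of_tendsto (f := fun _ => f) (fun _ => hf) fun t h0 h1 => by
    rw [h t h0 h1]; exact tendsto_const_nhds

/-! ### Comparison with the Riesz kernel -/

/-- Viscosity subsolutions, for real functions. -/
def FSub (F : Set (Matrix (Fin n) (Fin n) ℝ)) (v : Eu n → ℝ) (X : Set (Eu n)) : Prop :=
  ∀ x ∈ X, ∀ φ : Eu n → ℝ, ContDiffAt ℝ 2 φ x → (∀ᶠ y in 𝓝 x, v y ≤ φ y) → v x = φ x →
    hessian φ x ∈ F

theorem FSub.mono {F : Set (Matrix (Fin n) (Fin n) ℝ)} {v : Eu n → ℝ} {X Y : Set (Eu n)}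
    (h : FSub F v X) (hY : Y ⊆ X) : FSub F v Y := fun x hx => h x (hY hx)

theorem FSub.traceSub {F : Set (Matrix (Fin n) (Fin n) ℝ)} {p : ℝ} (hF : Admissible F p)
    {v : Eu n → ℝ} {X : Set (Eu n)} (h : FSub F v X) : TraceSub v X :=
  fun x hx φ h1 h2 h3 => hF.trace_nonneg (h x hx φ h1 h2 h3)

theorem hasDerivAt_kernel_sqrt (p : ℝ) {τ : ℝ} (hτ : 0 < τ) :
    HasDerivAt (fun τ => rieszKernel p (√τ)) (kernelSlope p / 2 * τ ^ (-(p / 2))) τ := by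
  have h := (hasDerivAt_rieszKernel p (Real.sqrt_pos.2 hτ)).comp τ (Real.hasDerivAt_sqrt hτ.ne')
  refine h.congr_deriv ?_
  have h1 : (√τ) ^ (1 - p) = √τ * τ ^ (-(p / 2)) := by
    rw [Real.sqrt_eq_rpow, ← Real.rpow_mul hτ.le, ← Real.rpow_add hτ]
    congr 1; ring
  have h2 := (Real.sqrt_pos.2 hτ).ne'
  rw [h1]; field_simp

/-- The comparison functions are strict supersolutions. -/
theorem hessian_barrier_notMem {F : Set (Matrix (Fin n) (Fin n) ℝ)} {p : ℝ}
    (hF : Admissible F p) {a b ε : ℝ} (hb : 0 < b) (hε : 0 < ε) {x : Eu n} (hx : x ≠ 0)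
    (hεx : ε < kernelSlope p / 2 * (‖x‖ ^ 2) ^ (-(p / 2))) :
    ContDiffAt ℝ 2 (fun y : Eu n => a + b * (rieszKernel p ‖y‖ - ε * ‖y‖ ^ 2)) x ∧
    hessian (fun y : Eu n => a + b * (rieszKernel p ‖y‖ - ε * ‖y‖ ^ 2)) x ∉ F := by
  have hx2 : 0 < ‖x‖ ^ 2 := by positivity
  set k := kernelSlope p / 2 * (‖x‖ ^ 2) ^ (-(p / 2)) with hk
  let f : ℝ → ℝ := fun τ => a + b * (rieszKernel p (√τ) - ε * τ)
  let f' : ℝ → ℝ := fun τ => b * (kernelSlope p / 2 * τ ^ (-(p / 2)) - ε)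
  have hf : ∀ τ, 0 < τ → HasDerivAt f (f' τ) τ := fun τ hτ => by
    have h1 := (((hasDerivAt_kernel_sqrt p hτ).sub ((hasDerivAt_id τ).const_mul ε)).const_mul
      b).const_add a
    exact h1.congr_deriv (by simp only [f', mul_one])
  have hf' : HasDerivAt f' (b * (kernelSlope p / 2 * (-(p / 2) * (‖x‖ ^ 2) ^ (-(p / 2) - 1))))
      (‖x‖ ^ 2) :=
    (((Real.hasDerivAt_rpow_const (Or.inl hx2.ne')).const_mul _).sub_const ε).const_mul b
  have hfun : (fun y : Eu n => a + b * (rieszKernel p ‖y‖ - ε * ‖y‖ ^ 2)) =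
      fun y => f (‖y‖ ^ 2) := by
    ext y; simp only [f, Real.sqrt_sq (norm_nonneg y)]
  have hfc : ContDiffAt ℝ 2 f (‖x‖ ^ 2) := by
    have h2 : ContDiffOn ℝ 2 f (Ioi 0) := by
      rw [show (2 : ℕ∞ω) = 1 + 1 by norm_num, contDiffOn_succ_iff_deriv_of_isOpen isOpen_Ioi]
      refine ⟨fun τ hτ => (hf τ hτ).differentiableAt.differentiableWithinAt, by simp, ?_⟩
      have h3 : ContDiffOn ℝ 1 f' (Ioi 0) := fun τ hτ => by
        refine ContDiffAt.contDiffWithinAt ?_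
        exact contDiffAt_const.mul ((contDiffAt_const.mul
          (Real.contDiffAt_rpow_const_of_ne (ne_of_gt hτ))).sub contDiffAt_const)
      exact h3.congr fun τ hτ => (hf τ hτ).deriv
    exact h2.contDiffAt (Ioi_mem_nhds hx2)
  rw [hfun]
  refine ⟨ContDiffAt.comp (g := f) x hfc (contDiff_norm_sq ℝ).contDiffAt, ?_⟩
  rw [hessian_comp_normSq (f' := f') (by
    filter_upwards [eventually_gt_nhds hx2] with τ hτ using hf τ hτ) hf']
  intro hmem
  let e : Eu n := ‖x‖⁻¹ • x
  have hx' : ‖x‖ ≠ 0 := norm_ne_zero_iff.2 hx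
  have he : ‖e‖ = 1 := by simp [e, norm_smul, hx']
  have hkε : 0 < k - ε := by linarith
  have hk0 : 0 < k := hε.trans hεx
  have hp : 0 < p := by linarith [hF.one_le]
  -- With `k` the derivative of `K_p(√τ)` at `τ = |x|²`, the Hessian is `2b((k - ε) I - p k P_e)`.
  -- This is `2b(k - ε)` times `P_{e^⊥} - (q-1) P_e` with `q = pk/(k - ε) > p`.
  refine hF.not_mem_of_gt (q := p * k / (k - ε)) ?_ he ?_
  · rw [lt_div_iff₀ hkε]; nlinarith
  have h4 := hF.cone (2 * b * (k - ε))⁻¹ (by positivity) _ hmem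
  convert h4 using 1
  have hpow : (‖x‖ ^ 2) ^ (-(p / 2) - 1) = (‖x‖ ^ 2) ^ (-(p / 2)) * (‖x‖ ^ 2)⁻¹ := by
    rw [Real.rpow_sub_one hx2.ne', div_eq_mul_inv]
  have hline : lineProj e = (‖x‖ ^ 2)⁻¹ • Matrix.vecMulVec x.ofLp x.ofLp := by
    ext i j
    simp [lineProj, e, Matrix.vecMulVec_apply]
    ring
  rw [hline, hpow, smul_add, smul_smul, smul_smul, smul_smul]
  have e1 : (2 * b * (k - ε))⁻¹ * (2 * f' (‖x‖ ^ 2)) = 1 := by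
    simp only [f', ← hk]; field_simp
  have e2 : (2 * b * (k - ε))⁻¹ * (4 * (b * (kernelSlope p / 2 * (-(p / 2) *
      ((‖x‖ ^ 2) ^ (-(p / 2)) * (‖x‖ ^ 2)⁻¹))))) = -(p * k / (k - ε)) * (‖x‖ ^ 2)⁻¹ := by
    rw [show (4 * (b * (kernelSlope p / 2 * (-(p / 2) *
      ((‖x‖ ^ 2) ^ (-(p / 2)) * (‖x‖ ^ 2)⁻¹))))) = -2 * b * p * k * (‖x‖ ^ 2)⁻¹ by
        rw [hk]; ring]
    field_simp
  rw [e1, e2]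
  module

theorem isCompact_annulus (s r : ℝ) : IsCompact {x : Eu n | s ≤ ‖x‖ ∧ ‖x‖ ≤ r} := by
  have : {x : Eu n | s ≤ ‖x‖ ∧ ‖x‖ ≤ r} = Metric.closedBall 0 r ∩ {x | s ≤ ‖x‖} := by
    ext x; simp [and_comm]
  rw [this]
  exact (isCompact_closedBall _ _).inter_right (isClosed_le continuous_const continuous_norm)

/-- Comparison on annuli. -/
theorem FSub.le_barrier {F : Set (Matrix (Fin n) (Fin n) ℝ)} {p : ℝ} (hF : Admissible F p)
    {v : Eu n → ℝ} {R : ℝ} (hsub : FSub F v (Metric.ball 0 R)) (hv : UpperSemicontinuous v)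
    {s r a b : ℝ} (hs : 0 < s) (hrR : r < R) (hb : 0 < b)
    (h1 : ∀ x : Eu n, ‖x‖ = s → v x ≤ a + b * rieszKernel p s)
    (h2 : ∀ x : Eu n, ‖x‖ = r → v x ≤ a + b * rieszKernel p r) :
    ∀ x : Eu n, s ≤ ‖x‖ → ‖x‖ ≤ r → v x ≤ a + b * rieszKernel p ‖x‖ := by
  intro x₁ hx₁ hx₁'
  by_contra! hcon
  have hr : 0 < r := hs.trans_le (hx₁.trans hx₁')
  have hp : 0 < p := by linarith [hF.one_le]
  set d := v x₁ - (a + b * rieszKernel p ‖x₁‖) with hd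
  have hd0 : 0 < d := by linarith
  have hmin : 0 < kernelSlope p / 2 * (r ^ 2) ^ (-(p / 2)) :=
    mul_pos (half_pos (kernelSlope_pos p)) (Real.rpow_pos_of_pos (by positivity) _)
  -- The first condition keeps the barrier strict on the whole annulus, its worst point being `|x| =
  -- r` since `τ^(-p/2)` decreases. The second keeps the correction `bεr²` below the assumed excess
  -- `d`.
  obtain ⟨ε, hε, hε1, hε2⟩ : ∃ ε > 0, ε < kernelSlope p / 2 * (r ^ 2) ^ (-(p / 2)) ∧
      b * ε * r ^ 2 < d := by
    refine ⟨min (kernelSlope p / 2 * (r ^ 2) ^ (-(p / 2))) (d / (b * r ^ 2)) / 2, ?_, ?_, ?_⟩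
    · have := lt_min hmin (show 0 < d / (b * r ^ 2) by positivity)
      linarith
    · have := min_le_left (kernelSlope p / 2 * (r ^ 2) ^ (-(p / 2))) (d / (b * r ^ 2))
      linarith
    · have h3 := min_le_right (kernelSlope p / 2 * (r ^ 2) ^ (-(p / 2))) (d / (b * r ^ 2))
      have h4 : d / (b * r ^ 2) * (b * r ^ 2) = d := by field_simp
      have h5 : 0 < b * r ^ 2 := by positivity
      nlinarith
  let w : Eu n → ℝ := fun y => (a + b * ε * r ^ 2) + b * (rieszKernel p ‖y‖ - ε * ‖y‖ ^ 2)
  have hwc : ∀ y : Eu n, y ≠ 0 → ContinuousAt w y := fun y hy => by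
    have h3 : ContinuousAt (fun y : Eu n => rieszKernel p ‖y‖) y :=
      ContinuousAt.comp' (g := rieszKernel p)
        (hasDerivAt_rieszKernel p (norm_pos_iff.2 hy)).continuousAt continuous_norm.continuousAt
    exact continuousAt_const.add (continuousAt_const.mul (h3.sub
      (continuous_const.mul (continuous_norm.pow 2)).continuousAt))
  have husc : UpperSemicontinuousOn (fun y => v y - w y) {x : Eu n | s ≤ ‖x‖ ∧ ‖x‖ ≤ r} := by
    have h3 : ContinuousOn (fun y => -w y) {x : Eu n | s ≤ ‖x‖ ∧ ‖x‖ ≤ r} := fun y hy =>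
      (hwc y (norm_pos_iff.1 (hs.trans_le hy.1))).neg.continuousWithinAt
    simpa only [sub_eq_add_neg] using
      (hv.upperSemicontinuousOn _).add h3.upperSemicontinuousOn
  obtain ⟨y, hy, hmax⟩ := husc.exists_isMaxOn
    (show {x : Eu n | s ≤ ‖x‖ ∧ ‖x‖ ≤ r}.Nonempty from ⟨x₁, hx₁, hx₁'⟩) (isCompact_annulus s r)
  have hy0 : y ≠ 0 := norm_pos_iff.1 (hs.trans_le hy.1)
  have hpos : 0 < v y - w y := by
    have h3 : v x₁ - w x₁ ≤ v y - w y := hmax (a := x₁) ⟨hx₁, hx₁'⟩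
    have h4 : 0 < v x₁ - w x₁ := by
      simp only [w]
      have : 0 ≤ b * ε * ‖x₁‖ ^ 2 := by positivity
      nlinarith
    linarith
  have hwle : ∀ y : Eu n, ‖y‖ ≤ r → a + b * rieszKernel p ‖y‖ ≤ w y := fun y hyr => by
    simp only [w]
    have h3 : ‖y‖ ^ 2 ≤ r ^ 2 := by gcongr
    have h4 : 0 < b * ε := by positivity
    nlinarith
  have hys : s < ‖y‖ := lt_of_le_of_ne hy.1 fun h => by
    have := h1 y h.symm
    have h5 := hwle y hy.2
    rw [← h] at h5
    linarith
  have hyr : ‖y‖ < r := lt_of_le_of_ne hy.2 fun h => by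
    have := h2 y h
    have h5 := hwle y hy.2
    rw [h] at h5
    linarith
  -- Raised by the maximum of `v - w`, the barrier touches `v` from above at the interior maximum
  -- point.
  have hbar := hessian_barrier_notMem hF (a := a + b * ε * r ^ 2 + (v y - w y)) hb hε hy0
    (hε1.trans_le (by
      refine mul_le_mul_of_nonneg_left ?_ (half_pos (kernelSlope_pos p)).le
      exact Real.rpow_le_rpow_of_nonpos (by positivity) (by gcongr) (by linarith)))
  refine hbar.2 (hsub y (by simpa using hyr.trans hrR) _ hbar.1 ?_ ?_)
  · have h3 : {x : Eu n | s < ‖x‖ ∧ ‖x‖ < r} ∈ 𝓝 y :=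
      ((isOpen_lt continuous_const continuous_norm).inter
        (isOpen_lt continuous_norm continuous_const)).mem_nhds ⟨hys, hyr⟩
    filter_upwards [h3] with z hz
    have h4 : v z - w z ≤ v y - w y := hmax ⟨hz.1.le, hz.2.le⟩
    simp only [w] at h4 ⊢
    linarith
  · simp only [w]; ring

/-- The maximum over balls about `0`. -/
def radialMax (v : Eu n → ℝ) (r : ℝ) : ℝ := sSup (v '' Metric.closedBall 0 r)

theorem radialMax_spec {v : Eu n → ℝ} (hv : UpperSemicontinuous v) {r : ℝ} (hr : 0 ≤ r) :
    (∃ x : Eu n, ‖x‖ ≤ r ∧ v x = radialMax v r) ∧ ∀ x : Eu n, ‖x‖ ≤ r → v x ≤ radialMax v r := by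
  obtain ⟨y, hy, hmax⟩ := (hv.upperSemicontinuousOn _).exists_isMaxOn
    (Metric.nonempty_closedBall.2 hr) (isCompact_closedBall (0 : Eu n) r)
  have hbdd : BddAbove (v '' Metric.closedBall 0 r) := ⟨v y, by
    rintro _ ⟨z, hz, rfl⟩; exact hmax hz⟩
  have h2 : ∀ x : Eu n, ‖x‖ ≤ r → v x ≤ radialMax v r := fun x hx =>
    le_csSup hbdd ⟨x, by simpa using hx, rfl⟩
  refine ⟨⟨y, by simpa using hy, le_antisymm (h2 y (by simpa using hy)) ?_⟩, h2⟩
  refine csSup_le ⟨v y, y, hy, rfl⟩ ?_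
  rintro _ ⟨z, hz, rfl⟩; exact hmax hz

theorem radialMax_mono {v : Eu n → ℝ} (hv : UpperSemicontinuous v) {s r : ℝ} (hs : 0 ≤ s)
    (hsr : s ≤ r) : radialMax v s ≤ radialMax v r := by
  obtain ⟨⟨x, hx, hxe⟩, -⟩ := radialMax_spec hv hs
  rw [← hxe]
  exact (radialMax_spec hv (hs.trans hsr)).2 x (hx.trans hsr)

/-- A three circles theorem. The function `a + b K_p` with the values of the maximum at `s` and `r`
dominates `v` on the annulus between them; inside `|x| ≤ s` the bound is immediate. Comparison needs
`b > 0`, so a maximum constant on `[s, r]` is treated apart. -/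
theorem FSub.kernelConvex_radialMax {F : Set (Matrix (Fin n) (Fin n) ℝ)} {p : ℝ}
    (hF : Admissible F p) {v : Eu n → ℝ} {R : ℝ} (hsub : FSub F v (Metric.ball 0 R))
    (hv : UpperSemicontinuous v) : KernelConvex p (radialMax v) R := by
  intro s t r hs hst htr hrR
  have ht := hs.trans hst
  have hr := ht.trans htr
  have hKst := rieszKernel_lt p hs hst
  have hKtr := rieszKernel_lt p ht htr
  have hst' := radialMax_mono hv hs.le hst.le
  have htr' := radialMax_mono hv ht.le htr.le
  refine ⟨hst', ?_⟩
  rcases (hst'.trans htr').eq_or_lt with h0 | h0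
  · have h1 : radialMax v t = radialMax v s := le_antisymm (htr'.trans h0.ge) hst'
    rw [h1, h0]; simp
  set b := (radialMax v r - radialMax v s) / (rieszKernel p r - rieszKernel p s) with hb
  set a := radialMax v s - b * rieszKernel p s with ha
  have hden : 0 < rieszKernel p r - rieszKernel p s := by linarith
  have hb0 : 0 < b := div_pos (by linarith) hden
  have hbd : b * (rieszKernel p r - rieszKernel p s) = radialMax v r - radialMax v s :=
    div_mul_cancel₀ _ hden.ne'
  have hcmp := hsub.le_barrier hF hv (a := a) hs hrR hb0
    (fun x hx => by rw [ha]; linarith [(radialMax_spec hv hs.le).2 x hx.le])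
    (fun x hx => by rw [ha]; linarith [(radialMax_spec hv hr.le).2 x hx.le])
  have hle : radialMax v t ≤ a + b * rieszKernel p t := by
    obtain ⟨⟨x, hx, hxe⟩, -⟩ := radialMax_spec hv ht.le
    rw [← hxe]
    rcases le_total s ‖x‖ with h | h
    · have h1 := hcmp x h (hx.trans htr.le)
      have h2 := rieszKernel_le p (hs.trans_le h) hx
      nlinarith
    · have h1 := (radialMax_spec hv hs.le).2 x h
      nlinarith
  nlinarith

/-! ### Second moments of the unit ball -/

theorem average_ball_comp (e : Eu n ≃ₗᵢ[ℝ] Eu n) (f : Eu n → ℝ) :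
    ⨍ z in UBall n, f (e z) = ⨍ z in UBall n, f z := by
  have h := e.measurePreserving.setIntegral_preimage_emb e.toHomeomorph.measurableEmbedding f
    (UBall n)
  have h2 : e ⁻¹' UBall n = UBall n := by
    ext z; simp
  rw [h2] at h
  rw [setAverage_eq, setAverage_eq, h]

theorem average_ball_neg (f : Eu n → ℝ) : ⨍ z in UBall n, f (-z) = ⨍ z in UBall n, f z :=
  average_ball_comp (LinearIsometryEquiv.neg ℝ) f

theorem Continuous.integrableOn_ball {f : Eu n → ℝ} (hf : Continuous f) :
    IntegrableOn f (UBall n) :=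
  hf.continuousOn.integrableOn_compact (isCompact_closedBall _ _)

instance : IsFiniteMeasure ((volume : Measure (Eu n)).restrict (UBall n)) :=
  ⟨by rw [Measure.restrict_apply_univ]; exact measure_closedBall_lt_top⟩

instance : NeZero ((volume : Measure (Eu n)).restrict (UBall n)) :=
  ⟨fun h => (Metric.measure_closedBall_pos volume (0 : Eu n) one_pos).ne'
    (by rw [← Measure.restrict_apply_univ, h]; rfl)⟩

/-- The second moment of the unit ball. -/
def secondMoment (n : ℕ) : ℝ := (⨍ z in UBall n, ‖z‖ ^ 2) / n

theorem secondMoment_pos [NeZero n] : 0 < secondMoment n := by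
  have := nontrivial_eu (n := n)
  have hn : (0 : ℝ) < n := by exact_mod_cast NeZero.pos n
  refine div_pos ?_ hn
  rw [setAverage_eq, smul_eq_mul]
  refine mul_pos (inv_pos.2 volume_ball_pos) ?_
  rw [setIntegral_pos_iff_support_of_nonneg_ae (Eventually.of_forall fun z => by positivity)
    (Continuous.integrableOn_ball (by fun_prop))]
  have h1 : Function.support (fun z : Eu n => ‖z‖ ^ 2) ∩ UBall n = UBall n \ {0} := by
    ext z; simp [and_comm]
  rw [h1, measure_sdiff_null (measure_singleton _)]
  exact Metric.measure_closedBall_pos _ _ one_pos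

/-- Off the diagonal the moment changes sign under reflection of one coordinate; on the diagonal all
moments agree by exchanging coordinates. -/
theorem average_coord_mul [NeZero n] (i j : Fin n) :
    ⨍ z in UBall n, z i * z j = if i = j then secondMoment n else 0 := by
  split_ifs with h
  · subst h
    have hperm : ∀ k, ⨍ z in UBall n, z k * z k = ⨍ z in UBall n, z i * z i := fun k => by
      rw [← average_ball_comp (LinearIsometryEquiv.piLpCongrLeft 2 ℝ ℝ (Equiv.swap i k))]
      simp [LinearIsometryEquiv.piLpCongrLeft_apply, Equiv.piCongrLeft'_apply]
    have hn : (n : ℝ) ≠ 0 := by exact_mod_cast NeZero.ne n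
    have hsum : ⨍ z in UBall n, ‖z‖ ^ 2 = ∑ k, ⨍ z in UBall n, z k * z k := by
      simp only [setAverage_eq, smul_eq_mul]
      rw [← Finset.mul_sum, ← integral_finsetSum]
      · congr 2
        ext z
        rw [EuclideanSpace.norm_sq_eq]
        simp [pow_two]
      · intro k _
        exact Continuous.integrableOn_ball (by fun_prop)
    rw [secondMoment, hsum, Finset.sum_congr rfl fun k _ => hperm k]
    simp [hn]
  · let e : Eu n ≃ₗᵢ[ℝ] Eu n := LinearIsometryEquiv.piLpCongrRight 2 fun k =>
      if k = i then LinearIsometryEquiv.neg ℝ else LinearIsometryEquiv.refl ℝ ℝ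
    have h1 := average_ball_comp e fun z => z i * z j
    have h2 : ∀ z : Eu n, e z i * e z j = -(z i * z j) := fun z => by
      simp [e, LinearIsometryEquiv.piLpCongrRight_apply, Ne.symm h]
    simp only [h2, setAverage_eq, integral_neg, smul_eq_mul] at h1 ⊢
    linarith

theorem average_quadratic [NeZero n] (A : Matrix (Fin n) (Fin n) ℝ) :
    ⨍ z in UBall n, ∑ i, ∑ j, z i * z j * A i j = secondMoment n * A.trace := by
  have h1 : ∀ i j, Integrable (fun z : Eu n => z i * z j * A i j) (volume.restrict (UBall n)) :=
    fun i j => Continuous.integrableOn_ball (by fun_prop)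
  have h2 : ⨍ z in UBall n, ∑ i, ∑ j, z i * z j * A i j =
      ∑ i, ∑ j, (⨍ z in UBall n, z i * z j) * A i j := by
    simp only [setAverage_eq, smul_eq_mul]
    rw [integral_finsetSum _ fun i _ => integrable_finsetSum _ fun j _ => h1 i j, Finset.mul_sum]
    refine Finset.sum_congr rfl fun i _ => ?_
    rw [integral_finsetSum _ fun j _ => h1 i j, Finset.mul_sum]
    refine Finset.sum_congr rfl fun j _ => ?_
    rw [integral_mul_const]; ring
  rw [h2]
  simp [average_coord_mul, Matrix.trace, Finset.mul_sum]

theorem average_linear (L : Eu n →L[ℝ] ℝ) : ⨍ z in UBall n, L z = 0 := by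
  have h := average_ball_neg fun z => L z
  simp only [map_neg, setAverage_eq, integral_neg, smul_eq_mul] at h ⊢
  linarith

theorem quadratic_mlin (A C : Matrix (Fin n) (Fin n) ℝ) (z : Eu n) :
    ∑ i, ∑ j, (mlin C z) i * (mlin C z) j * A i j = ∑ i, ∑ j, z i * z j * (Cᵀ * A * C) i j := by
  have h : ∀ (B : Matrix (Fin n) (Fin n) ℝ) (w : Fin n → ℝ),
      ∑ i, ∑ j, w i * w j * B i j = w ⬝ᵥ (B *ᵥ w) := fun B w => by
    simp only [dotProduct, Matrix.mulVec, Finset.mul_sum]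
    exact Finset.sum_congr rfl fun i _ => Finset.sum_congr rfl fun j _ => by ring
  rw [h, h, Matrix.ofLp_toEuclideanCLM, ← Matrix.mulVec_mulVec, ← Matrix.mulVec_mulVec,
    Matrix.dotProduct_mulVec z.ofLp Cᵀ, Matrix.vecMul_transpose]

/-! ### Averages over the rotations -/

section rotation

variable {F : Set (Matrix (Fin n) (Fin n) ℝ)} {p : ℝ}

/-- The average of `v` over the rotations. -/
def rotationMean (R : RotationFamily F) (v : Eu n → ℝ) (x : Eu n) : ℝ :=
  ∫ k, v (mlin (R.mat k) x) ∂(R.ν)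

variable (R : RotationFamily F) {v : Eu n → ℝ} {K : ℝ}

theorem integrable_rotation (hv : UpperSemicontinuous v) (hK : ∀ x, |v x| ≤ K) (x : Eu n) :
    Integrable (fun k => v (mlin (R.mat k) x)) R.ν :=
  Integrable.of_bound (hv.measurable.comp
    (continuous_rotation R continuous_id continuous_const).measurable).aestronglyMeasurable K
    (Eventually.of_forall fun _ => hK _)

theorem abs_rotationMean_le (hK : ∀ x, |v x| ≤ K) (x : Eu n) : |rotationMean R v x| ≤ K := by
  have := norm_integral_le_of_norm_le_const (μ := R.ν) (f := fun k => v (mlin (R.mat k) x))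
    (Eventually.of_forall fun _ => hK _)
  simpa [rotationMean] using this

/-- Fatou's lemma for the nonnegative functions `K - v`, along a sequence `u j → x` on which the
mean would stay at least `y`. -/
theorem upperSemicontinuous_rotationMean (hv : UpperSemicontinuous v) (hK : ∀ x, |v x| ≤ K) :
    UpperSemicontinuous (rotationMean R v) := by
  intro x y hy
  by_contra hcon
  rw [not_eventually] at hcon
  obtain ⟨u, hu, huy⟩ := exists_seq_forall_of_frequently hcon
  simp only [not_lt] at huy
  have hyK : y ≤ K := (huy 0).trans ((le_abs_self _).trans (abs_rotationMean_le R hK _))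
  have hmeas : ∀ x, Measurable fun k => ENNReal.ofReal (K - v (mlin (R.mat k) x)) := fun x =>
    ENNReal.measurable_ofReal.comp (measurable_const.sub (hv.measurable.comp
      (continuous_rotation R continuous_id continuous_const).measurable))
  have hlint : ∀ x, ∫⁻ k, ENNReal.ofReal (K - v (mlin (R.mat k) x)) ∂(R.ν) =
      ENNReal.ofReal (K - rotationMean R v x) := fun x => by
    rw [← ofReal_integral_eq_lintegral_ofReal (f := fun k => K - v (mlin (R.mat k) x))
      ((integrable_const K).sub (integrable_rotation R hv hK x))
      (Eventually.of_forall fun k => by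
        have := (le_abs_self _).trans (hK (mlin (R.mat k) x))
        simp only [Pi.zero_apply]; linarith)]
    rw [integral_sub (integrable_const K) (integrable_rotation R hv hK x)]
    simp [rotationMean]
  have hfatou := lintegral_liminf_le (u := atTop) (μ := R.ν) (fun j => hmeas (u j))
  have h1 : ∫⁻ k, ENNReal.ofReal (K - v (mlin (R.mat k) x)) ∂(R.ν) ≤
      ∫⁻ k, liminf (fun j => ENNReal.ofReal (K - v (mlin (R.mat k) (u j)))) atTop ∂(R.ν) := by
    refine lintegral_mono fun k => ?_
    rw [le_liminf_iff]
    intro c hc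
    have hct := hc.ne_top
    rw [ENNReal.lt_ofReal_iff_toReal_lt hct] at hc
    have hlim : Tendsto (fun j => mlin (R.mat k) (u j)) atTop (𝓝 (mlin (R.mat k) x)) :=
      ((mlin (R.mat k)).continuous.tendsto x).comp hu
    filter_upwards [hlim.eventually (hv _ (K - c.toReal) (by linarith))] with j hj
    rw [ENNReal.lt_ofReal_iff_toReal_lt hct]
    linarith
  have h2 : liminf (fun j => ∫⁻ k, ENNReal.ofReal (K - v (mlin (R.mat k) (u j))) ∂(R.ν)) atTop ≤
      ENNReal.ofReal (K - y) := by
    refine (liminf_le_of_frequently_le' (Eventually.of_forall fun j => ?_).frequently)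
    rw [hlint]
    exact ENNReal.ofReal_le_ofReal (by linarith [huy j])
  have h3 := (h1.trans hfatou).trans h2
  rw [hlint, ENNReal.ofReal_le_ofReal_iff (by linarith)] at h3
  linarith

theorem FSub.rotate {X : ℝ} (hsub : FSub F v (Metric.ball 0 X)) (k : R.Ω) :
    FSub F (fun x => v (mlin (R.mat k) x)) (Metric.ball 0 X) := by
  intro x hx φ hφ hle heq
  let A := R.mat k
  have hA : A ∈ Matrix.orthogonalGroup (Fin n) ℝ := R.orth k
  have hAA : Aᵀ * A = 1 := (Matrix.mem_orthogonalGroup_iff' (Fin n) ℝ).1 hA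
  have hAA' : A * Aᵀ = 1 := (Matrix.mem_orthogonalGroup_iff (Fin n) ℝ).1 hA
  have hinv : ∀ z, mlin Aᵀ (mlin A z) = z := fun z => by rw [← mlin_mul, hAA]; simp
  have hinv' : ∀ z, mlin A (mlin Aᵀ z) = z := fun z => by rw [← mlin_mul, hAA']; simp
  have hφ' : ContDiffAt ℝ 2 φ (0 + mlin Aᵀ (mlin A x)) := by rwa [hinv, zero_add]
  have hlim : Tendsto (fun z => 0 + mlin Aᵀ z) (𝓝 (mlin A x)) (𝓝 x) := by
    have : Continuous fun z : Eu n => 0 + mlin Aᵀ z := by fun_prop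
    simpa [hinv] using this.tendsto (mlin A x)
  have h1 := hsub (mlin A x) (by simpa [norm_mlin_of_orthogonal hA] using hx)
    (fun z => φ (0 + mlin Aᵀ z))
    (ContDiffAt.comp (g := φ) _ hφ' (contDiffAt_const.add (mlin Aᵀ).contDiff.contDiffAt))
    (by filter_upwards [hlim.eventually hle] with z hz
        have h0 : mlin (R.mat k) (mlin Aᵀ z) = z := hinv' z
        simpa [h0] using hz) (by simpa [hinv] using heq)
  rw [hessian_comp_affine (mlin Aᵀ) 0 _ hφ', matrix_of_mlin, hinv, zero_add] at h1
  have h2 := R.inv k _ h1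
  change Aᵀ * (Aᵀᵀ * hessian φ x * Aᵀ) * A ∈ F at h2
  have h3 : Aᵀ * (Aᵀᵀ * hessian φ x * Aᵀ) * A = (Aᵀ * A) * hessian φ x * (Aᵀ * A) := by
    simp only [Matrix.transpose_transpose, Matrix.mul_assoc]
  rwa [h3, hAA, Matrix.one_mul, Matrix.mul_one] at h2

/-- Each rotated copy of `v` is a subsolution for the operator given by `C`. Its mean value
inequality is linear, so it can be integrated over the rotations, unlike the viscosity condition
itself. -/
theorem FSub.rotationMean_le_ellipsoid [NeZero n] {X : ℝ} (hsub : FSub F v (Metric.ball 0 X))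
    (hv : UpperSemicontinuous v) (hK : ∀ x, |v x| ≤ K) {C D : Matrix (Fin n) (Fin n) ℝ}
    (hDC : D * C = 1) (hCD : C * D = 1) (hC : ∀ M ∈ F, 0 ≤ (Cᵀ * M * C).trace) {x : Eu n}
    (hx : ∀ z ∈ UBall n, x + mlin C z ∈ Metric.ball 0 X) :
    rotationMean R v x ≤ ⨍ z in UBall n, rotationMean R v (x + mlin C z) := by
  have h1 : ∀ k, v (mlin (R.mat k) x) ≤ ⨍ z in UBall n, v (mlin (R.mat k) (x + mlin C z)) :=
    fun k => OpSub.le_ellipsoid_average R hDC hCD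
      (fun y hy φ h1 h2 h3 => hC _ (hsub.rotate R k y hy φ h1 h2 h3))
      (v := fun x => v (mlin (R.mat k) x)) (hv.comp (mlin (R.mat k)).continuous)
      (fun y => hK _) hx
  have hprod : Integrable (fun z : Eu n × R.Ω => v (mlin (R.mat z.2) (x + mlin C z.1)))
      ((volume.restrict (UBall n)).prod R.ν) := by
    refine Integrable.of_bound (Measurable.aestronglyMeasurable (hv.measurable.comp
      (measurable_rotation R (S := Eu n) (g := fun z => x + mlin C z) (by fun_prop)))) K
      (Eventually.of_forall fun z => hK _)
  have h2 : rotationMean R v x ≤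
      ∫ k, (⨍ z in UBall n, v (mlin (R.mat k) (x + mlin C z))) ∂(R.ν) := by
    refine integral_mono (integrable_rotation R hv hK x) ?_ h1
    simp only [setAverage_eq]
    exact hprod.integral_prod_right.smul ((volume : Measure (Eu n)).real (UBall n))⁻¹
  refine h2.trans_eq ?_
  simp only [setAverage_eq, rotationMean]
  rw [integral_smul ((volume : Measure (Eu n)).real (UBall n))⁻¹]
  congr 1
  exact integral_integral_swap (f := fun k z => v (mlin (R.mat k) (x + mlin C z))) hprod.swap

/-- Suppose the Hessian of a test function `φ` at `x` is outside `F`, and let `tr(Cᵗ · C)` be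
nonnegative on `F` with value `τ < 0` there. By Taylor expansion the average over the ellipsoid of
scale `t` is at most `φ(x) + t²(mτ/2 + εN²)`, where `m` is the second moment of the ball. The choice
of `ε` makes the bracket `mτ/4 < 0`, against the ellipsoid inequality. -/
theorem FSub.of_rotationMean (hF : Admissible F p) {X : ℝ} (hsub : FSub F v (Metric.ball 0 X))
    (hv : UpperSemicontinuous v) (hK : ∀ x, |v x| ≤ K) :
    FSub F (rotationMean R v) (Metric.ball 0 X) := by
  have := hF.ne_zero
  intro x hx φ hφ hle heq
  by_contra hnot
  obtain ⟨C, D, hCD, hDC, hC, hneg⟩ := hF.exists_factor (hessian_isSymm hφ) hnot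
  set τ := (Cᵀ * hessian φ x * C).trace with hτ
  set N := ‖mlin C‖ + 1 with hN
  have hN0 : 0 < N := by positivity
  have hm := secondMoment_pos (n := n)
  set ε := -(secondMoment n * τ) / (4 * N ^ 2) with hε
  have hετ : ε * (4 * N ^ 2) = -(secondMoment n * τ) := div_mul_cancel₀ _ (by positivity)
  have hε0 : 0 < ε := div_pos (by nlinarith) (by positivity)
  obtain ⟨δ, hδ, hT⟩ := taylor_two hφ hε0
  obtain ⟨δ', hδ', hle'⟩ := Metric.eventually_nhds_iff_ball.1
    (hle.and (Metric.isOpen_ball.eventually_mem hx))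
  set t := min δ δ' / (2 * N) with ht
  have hmin : 0 < min δ δ' := lt_min hδ hδ'
  have ht0 : 0 < t := by positivity
  have htN : t * N < min δ δ' := by
    have : t * N = min δ δ' / 2 := by rw [ht]; field_simp
    linarith
  have hz : ∀ z ∈ UBall n, ‖mlin (t • C) z‖ ≤ t * N := fun z hz => by
    rw [mlin_smul, norm_smul, Real.norm_eq_abs, abs_of_pos ht0]
    refine mul_le_mul_of_nonneg_left ?_ ht0.le
    have h1 := (mlin C).le_opNorm z
    rw [mem_closedBall_zero_iff] at hz
    nlinarith [norm_nonneg (mlin C), norm_nonneg z]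
  have hsm := hsub.rotationMean_le_ellipsoid R hv hK (C := t • C) (D := t⁻¹ • D)
    (by rw [Matrix.smul_mul, Matrix.mul_smul, hDC, smul_smul, inv_mul_cancel₀ ht0.ne', one_smul])
    (by rw [Matrix.smul_mul, Matrix.mul_smul, hCD, smul_smul, mul_inv_cancel₀ ht0.ne', one_smul])
    (fun M hM => by
      have := hC M hM
      simp only [Matrix.transpose_smul, Matrix.smul_mul, Matrix.mul_smul, Matrix.trace_smul,
        smul_eq_mul]
      positivity)
    (x := x) (fun z hz' => (hle' _ (by
      rw [Metric.mem_ball, dist_eq_norm, add_sub_cancel_left]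
      exact ((hz z hz').trans_lt htN).trans_le (min_le_right _ _))).2)
  have hbound : ∀ z ∈ UBall n, rotationMean R v (x + mlin (t • C) z) ≤
      φ x + (fderiv ℝ φ x).comp (mlin (t • C)) z +
        (1 / 2) * (∑ i, ∑ j, z i * z j * ((t • C)ᵀ * hessian φ x * (t • C)) i j) +
          ε * (t * N) ^ 2 := by
    intro z hz'
    have h1 := (hle' (x + mlin (t • C) z) (by
      rw [Metric.mem_ball, dist_eq_norm, add_sub_cancel_left]
      exact ((hz z hz').trans_lt htN).trans_le (min_le_right _ _))).1
    have h2 := (abs_le.1 (hT _ (((hz z hz').trans_lt htN).trans_le (min_le_left _ _)))).2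
    rw [d2_apply, quadratic_mlin] at h2
    have h3 : ‖mlin (t • C) z‖ ^ 2 ≤ (t * N) ^ 2 := by
      have := hz z hz'
      gcongr
    have h4 : ε * ‖mlin (t • C) z‖ ^ 2 ≤ ε * (t * N) ^ 2 := by gcongr
    change _ ≤ φ x + fderiv ℝ φ x (mlin (t • C) z) + _ + _
    linarith
  have havg : ⨍ z in UBall n, rotationMean R v (x + mlin (t • C) z) ≤
      φ x + (1 / 2) * (secondMoment n * (t ^ 2 * τ)) + ε * (t * N) ^ 2 := by
    have hi1 : IntegrableOn (fun z => rotationMean R v (x + mlin (t • C) z))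
        (UBall n) := integrableOn_ball_of_bound (K := K)
      (((upperSemicontinuous_rotationMean R hv hK).comp
        (g := fun z => x + mlin (t • C) z) (by fun_prop)).measurable)
      (fun z => abs_rotationMean_le R hK _)
    have hq : Continuous fun z : Eu n => ∑ i, ∑ j, z i * z j *
      ((t • C)ᵀ * hessian φ x * (t • C)) i j := by fun_prop
    have hl : Continuous fun z : Eu n => (fderiv ℝ φ x).comp (mlin (t • C)) z := by fun_prop
    have h1 : ⨍ z in UBall n, rotationMean R v (x + mlin (t • C) z) ≤
      ⨍ z in UBall n, (φ x + (fderiv ℝ φ x).comp (mlin (t • C)) z +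
        (1 / 2) * (∑ i, ∑ j, z i * z j * ((t • C)ᵀ * hessian φ x * (t • C)) i j) +
          ε * (t * N) ^ 2) := by
      simp only [setAverage_eq, smul_eq_mul]
      refine mul_le_mul_of_nonneg_left ?_ (by positivity)
      exact setIntegral_mono_on hi1 (Continuous.integrableOn_ball (by fun_prop))
        Metric.isClosed_closedBall.measurableSet hbound
    refine h1.trans_eq ?_
    have hav : ∀ f g : Eu n → ℝ, Continuous f → Continuous g →
        ⨍ z in UBall n, (f z + g z) = (⨍ z in UBall n, f z) + ⨍ z in UBall n, g z := by
      intro f g hf hg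
      simp only [setAverage_eq]
      rw [integral_add (Continuous.integrableOn_ball hf) (Continuous.integrableOn_ball hg), smul_add]
    rw [hav _ _ (by fun_prop) continuous_const, hav _ _ (by fun_prop) (by fun_prop),
      hav _ _ continuous_const hl, average_linear, average_const, average_const]
    have hmul : ⨍ z in UBall n, (1 / 2 : ℝ) * (∑ i, ∑ j, z i * z j *
        ((t • C)ᵀ * hessian φ x * (t • C)) i j) =
        (1 / 2) * (secondMoment n * (t ^ 2 * τ)) := by
      have := average_quadratic ((t • C)ᵀ * hessian φ x * (t • C))
      simp only [setAverage_eq, smul_eq_mul] at this ⊢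
      rw [integral_const_mul, mul_left_comm, this]
      simp only [Matrix.transpose_smul, Matrix.smul_mul, Matrix.mul_smul, Matrix.trace_smul,
        smul_eq_mul, ← hτ]
      ring
    rw [hmul]; ring
  rw [heq] at hsm
  have h1 : 0 < t ^ 2 := by positivity
  have h2 : 0 ≤ (t ^ 2) * ((1 / 2) * (secondMoment n * τ) + ε * N ^ 2) := by
    nlinarith
  have h3 := nonneg_of_mul_nonneg_right h2 h1
  nlinarith

end rotation

/-! ### Spherical averages of bounded subsolutions -/

theorem rotationMean_eq [NeZero n] {F : Set (Matrix (Fin n) (Fin n) ℝ)} (R : RotationFamily F)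
    {v : Eu n → ℝ} {K : ℝ} (hv : UpperSemicontinuous v) (hK : ∀ x, |v x| ≤ K) (x : Eu n) :
    rotationMean R v x = ⨍ σ : USphere n, v (‖x‖ • (σ : Eu n)) ∂(sphereMeasure n) :=
  integral_rotation_eq R hv.measurable x fun y _ => hK y

/-- The rotation mean is a radial subsolution whose value on `|x| = t` is the spherical average. By
the maximum principle its maximum over the ball is that boundary value, so the three circles theorem
applies. -/
theorem FSub.kernelConvex_sphereAverage {F : Set (Matrix (Fin n) (Fin n) ℝ)} {p : ℝ}
    (hF : Admissible F p) (R : RotationFamily F) {v : Eu n → ℝ} {K ρ : ℝ}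
    (hsub : FSub F v (Metric.ball 0 ρ)) (hv : UpperSemicontinuous v) (hK : ∀ x, |v x| ≤ K) :
    KernelConvex p (fun t => ⨍ σ : USphere n, v (t • (σ : Eu n)) ∂(sphereMeasure n)) ρ := by
  have := hF.ne_zero
  have husc := upperSemicontinuous_rotationMean R hv hK
  have hrot := hsub.of_rotationMean R hF hv hK
  refine (hrot.kernelConvex_radialMax hF husc).congr fun t ht htρ => ?_
  obtain ⟨σ⟩ : Nonempty (USphere n) := inferInstance
  have hσ : ‖(σ : Eu n)‖ = 1 := by simp
  have hval : ∀ x : Eu n, ‖x‖ = t → rotationMean R v x =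
      ⨍ σ : USphere n, v (t • (σ : Eu n)) ∂(sphereMeasure n) := fun x hx => by
    rw [rotationMean_eq R hv hK, hx]
  have htσ : ‖t • (σ : Eu n)‖ = t := by rw [norm_smul, hσ, Real.norm_eq_abs, abs_of_pos ht, mul_one]
  obtain ⟨⟨x, hx, hxe⟩, hmax⟩ := radialMax_spec husc ht.le
  refine le_antisymm ?_ ?_
  · rw [← hxe]
    refine le_of_le_on_sphere (husc.upperSemicontinuousOn _)
      ((hrot.mono (Metric.ball_subset_ball htρ.le)).traceSub hF) contDiff_const
      (fun y => by rw [hessian_const]; simp) (fun y hy => ?_) x (by simpa using hx)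
    exact (hval y (by simpa using hy)).le
  · rw [← hval _ htσ]
    exact hmax _ htσ.le

/-! ### Truncations -/

open Classical in
/-- The function `max(u, -N)` on `S`, and `-N` elsewhere. -/
def trunc (u : Eu n → EReal) (S : Set (Eu n)) (N : ℕ) (x : Eu n) : ℝ :=
  if x ∈ S then (max (u x) ((-(N : ℝ) : ℝ) : EReal)).toReal else -N

section trunc

variable {F : Set (Matrix (Fin n) (Fin n) ℝ)} {p : ℝ} {u : Eu n → EReal} {X S : Set (Eu n)}

theorem trunc_of_notMem {x : Eu n} (hx : x ∉ S) (N : ℕ) : trunc u S N x = -N := if_neg hx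

theorem coe_trunc (hu : IsSubharmonicOn F u X) (hSX : S ⊆ X) {x : Eu n} (hx : x ∈ S) (N : ℕ) :
    (trunc u S N x : EReal) = max (u x) ((-(N : ℝ) : ℝ) : EReal) := by
  rw [trunc, if_pos hx, EReal.coe_toReal]
  · exact (max_lt (lt_top_iff_ne_top.2 (hu.ne_top x (hSX hx))) (EReal.coe_lt_top _)).ne
  · exact (lt_max_of_lt_right (EReal.bot_lt_coe _)).ne'

theorem exists_upper_bound (hu : IsSubharmonicOn F u X) (hSX : S ⊆ X) (hS : IsCompact S) :
    ∃ B : ℝ, 0 ≤ B ∧ ∀ x ∈ S, u x ≤ B := by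
  rcases S.eq_empty_or_nonempty with rfl | hne
  · exact ⟨0, le_rfl, by simp⟩
  obtain ⟨y, hy, hmax⟩ := (hu.usc.mono hSX).exists_isMaxOn hne hS
  refine ⟨max (u y).toReal 0, le_max_right _ _, fun x hx => (hmax hx).trans ?_⟩
  refine (EReal.le_coe_toReal (hu.ne_top y (hSX hy))).trans ?_
  exact_mod_cast le_max_left _ _

theorem neg_le_trunc (hu : IsSubharmonicOn F u X) (hSX : S ⊆ X) (N : ℕ) (x : Eu n) :
    -(N : ℝ) ≤ trunc u S N x := by
  by_cases hx : x ∈ S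
  · have := coe_trunc hu hSX hx N
    have h2 : ((-(N : ℝ) : ℝ) : EReal) ≤ trunc u S N x := by rw [this]; exact le_max_right _ _
    exact_mod_cast h2
  · rw [trunc_of_notMem hx]

theorem trunc_le (hu : IsSubharmonicOn F u X) (hSX : S ⊆ X) {B : ℝ} (hB0 : 0 ≤ B)
    (hB : ∀ x ∈ S, u x ≤ B) (N : ℕ) (x : Eu n) : trunc u S N x ≤ B := by
  have hN : -(N : ℝ) ≤ B := by linarith [(Nat.cast_nonneg N : (0 : ℝ) ≤ N)]
  by_cases hx : x ∈ S
  · have h1 := coe_trunc hu hSX hx N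
    have h2 : (trunc u S N x : EReal) ≤ B := by
      rw [h1]; exact max_le (hB x hx) (by exact_mod_cast hN)
    exact_mod_cast h2
  · rwa [trunc_of_notMem hx]

theorem abs_trunc_le (hu : IsSubharmonicOn F u X) (hSX : S ⊆ X) {B : ℝ} (hB0 : 0 ≤ B)
    (hB : ∀ x ∈ S, u x ≤ B) (N : ℕ) (x : Eu n) : |trunc u S N x| ≤ B + N := by
  have h1 := neg_le_trunc hu hSX N x
  have h2 := trunc_le hu hSX hB0 hB N x
  rw [abs_le]
  constructor <;> linarith [(Nat.cast_nonneg N : (0 : ℝ) ≤ N)]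

theorem upperSemicontinuous_trunc (hu : IsSubharmonicOn F u X) (hX : IsOpen X) (hSX : S ⊆ X)
    (hS : IsClosed S) (N : ℕ) : UpperSemicontinuous (trunc u S N) := by
  intro x y hy
  have hNy : -(N : ℝ) < y := (neg_le_trunc hu hSX N x).trans_lt hy
  by_cases hx : x ∈ S
  · have hux : u x < (y : EReal) := by
      have h1 := coe_trunc hu hSX hx N
      have h2 : (trunc u S N x : EReal) < y := by exact_mod_cast hy
      rw [h1] at h2
      exact (le_max_left _ _).trans_lt h2
    have hev := hu.usc x (hSX hx) y hux
    rw [hX.nhdsWithin_eq (hSX hx)] at hev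
    filter_upwards [hev] with z hz
    by_cases hzS : z ∈ S
    · have h1 := coe_trunc hu hSX hzS N
      have h2 : (trunc u S N z : EReal) < y := by
        rw [h1]; exact max_lt hz (by exact_mod_cast hNy)
      exact_mod_cast h2
    · rwa [trunc_of_notMem hzS]
  · filter_upwards [hS.isOpen_compl.mem_nhds hx] with z hz
    rwa [trunc_of_notMem hz]

/-- Where `u ≥ -N`, a test function for the truncation also touches `u`. Where `u < -N`, it has a
local minimum, because the truncation is at least `-N`, and positive semidefinite matrices belong to
`F`. -/
theorem fsub_trunc (hF : Admissible F p) (hu : IsSubharmonicOn F u X) (hSX : S ⊆ X) (N : ℕ) :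
    FSub F (trunc u S N) (interior S) := by
  intro x hx φ hφ hle heq
  have hxS := interior_subset hx
  rcases le_or_gt ((-(N : ℝ) : ℝ) : EReal) (u x) with h | h
  · refine hu.viscosity x (hSX hxS) φ hφ ?_ ?_
    · filter_upwards [hle, isOpen_interior.mem_nhds hx] with y hy hyS
      refine (le_max_left _ _).trans ((coe_trunc hu hSX (interior_subset hyS) N).symm.le.trans ?_)
      exact_mod_cast hy
    · rw [← heq, coe_trunc hu hSX hxS, max_eq_left h]
  · have h1 : trunc u S N x = -N := by
      have := coe_trunc hu hSX hxS N
      rw [max_eq_right h.le] at this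
      exact_mod_cast this
    refine hF.posSemidef_mem (hessian_posSemidef_of_isLocalMin hφ ?_)
    filter_upwards [hle] with y hy
    rw [← heq, h1]
    exact (neg_le_trunc hu hSX N y).trans hy

end trunc

/-- Monotone convergence for `B - g N ≥ 0`: the uniform lower bound `L` bounds the integral of the
supremum, which is `B - f`. Hence `f` is finite almost everywhere and integrable, and dominated
convergence applies. Measurability of `f` is not assumed; it comes from the almost everywhere limit.
-/
theorem integrable_of_truncations {α : Type*} [MeasurableSpace α] {μ : Measure α}
    [IsFiniteMeasure μ] {f : α → EReal} {g : ℕ → α → ℝ} {B L : ℝ} (hB : 0 ≤ B)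
    (hgm : ∀ N, Measurable (g N))
    (hg : ∀ᵐ x ∂μ, f x ≤ B ∧ ∀ N : ℕ, (g N x : EReal) = max (f x) ((-(N : ℝ) : ℝ) : EReal))
    (hL : ∀ N, L ≤ ∫ x, g N x ∂μ) :
    (∀ᵐ x ∂μ, f x ≠ ⊥) ∧ Integrable (fun x => (f x).toReal) μ ∧
      Tendsto (fun N => ∫ x, g N x ∂μ) atTop (𝓝 (∫ x, (f x).toReal ∂μ)) := by
  have hgB : ∀ᵐ x ∂μ, ∀ N : ℕ, -(N : ℝ) ≤ g N x ∧ g N x ≤ B := by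
    filter_upwards [hg] with x hx N
    have h1 : ((-(N : ℝ) : ℝ) : EReal) ≤ g N x := by rw [hx.2 N]; exact le_max_right _ _
    have hN : -(N : ℝ) ≤ B := by linarith [(Nat.cast_nonneg N : (0 : ℝ) ≤ N)]
    have h2 : (g N x : EReal) ≤ B := by
      rw [hx.2 N]; exact max_le hx.1 (by exact_mod_cast hN)
    exact ⟨by exact_mod_cast h1, by exact_mod_cast h2⟩
  have hgi : ∀ N, Integrable (g N) μ := fun N => by
    refine Integrable.of_bound (hgm N).aestronglyMeasurable (B + N) ?_
    filter_upwards [hgB] with x hx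
    have := hx N
    rw [Real.norm_eq_abs, abs_le]
    constructor <;> linarith [(Nat.cast_nonneg N : (0 : ℝ) ≤ N)]
  let h : ℕ → α → ENNReal := fun N x => ENNReal.ofReal (B - g N x)
  have hhm : ∀ N, Measurable (h N) := fun N =>
    ENNReal.measurable_ofReal.comp (measurable_const.sub (hgm N))
  have hmono : ∀ᵐ x ∂μ, Monotone fun N => h N x := by
    filter_upwards [hg] with x hx N M hNM
    refine ENNReal.ofReal_le_ofReal (sub_le_sub_left ?_ _)
    have h1 : (g M x : EReal) ≤ g N x := by
      rw [hx.2, hx.2]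
      refine max_le_max le_rfl ?_
      have : -(M : ℝ) ≤ -(N : ℝ) := by simpa using hNM
      exact_mod_cast this
    exact_mod_cast h1
  have hint : ∀ N, ∫⁻ x, h N x ∂μ ≤ ENNReal.ofReal (B * μ.real univ - L) := fun N => by
    rw [← ofReal_integral_eq_lintegral_ofReal (f := fun x => B - g N x)
      ((integrable_const B).sub (hgi N)) (by
        filter_upwards [hgB] with x hx
        simpa using (hx N).2)]
    refine ENNReal.ofReal_le_ofReal ?_
    rw [integral_sub (integrable_const B) (hgi N), integral_const, smul_eq_mul]
    linarith [hL N, mul_comm B (μ.real univ)]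
  have hsup : ∫⁻ x, ⨆ N, h N x ∂μ < ⊤ := by
    rw [lintegral_iSup' (fun N => (hhm N).aemeasurable) hmono]
    exact (iSup_le hint).trans_lt ENNReal.ofReal_lt_top
  have hfin := ae_lt_top (Measurable.iSup hhm) hsup.ne
  have hbot : ∀ᵐ x ∂μ, f x ≠ ⊥ := by
    filter_upwards [hfin, hg] with x hx hgx hbot
    obtain ⟨N, hN⟩ := exists_nat_gt (⨆ N, h N x).toReal
    have h1 : g N x = -N := by
      have := hgx.2 N
      rw [hbot, max_eq_right bot_le] at this
      exact_mod_cast this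
    have h2 : h N x ≤ ⨆ N, h N x := le_iSup (fun N => h N x) N
    have h3 := ENNReal.toReal_mono hx.ne h2
    simp only [h, h1] at h3
    rw [ENNReal.toReal_ofReal (by linarith [(Nat.cast_nonneg N : (0 : ℝ) ≤ N)])] at h3
    simp only [h] at hN
    linarith
  have hev : ∀ᵐ x ∂μ, ∀ᶠ N in atTop, g N x = (f x).toReal := by
    filter_upwards [hbot, hg] with x hx hgx
    have hcoe : ((f x).toReal : EReal) = f x :=
      EReal.coe_toReal (hgx.1.trans_lt (EReal.coe_lt_top _)).ne hx
    obtain ⟨M, hM⟩ := exists_nat_gt (-(f x).toReal)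
    filter_upwards [eventually_ge_atTop M] with N hN
    have h1 : -(N : ℝ) ≤ (f x).toReal := by
      have : (M : ℝ) ≤ N := by exact_mod_cast hN
      linarith
    have h2 := hgx.2 N
    rw [← hcoe, max_eq_left (by exact_mod_cast h1)] at h2
    exact_mod_cast h2
  have hmeas : AEStronglyMeasurable (fun x => (f x).toReal) μ := by
    refine aestronglyMeasurable_of_tendsto_ae atTop (fun N => (hgm N).aestronglyMeasurable) ?_
    filter_upwards [hev] with x hx
    exact tendsto_const_nhds.congr' (by filter_upwards [hx] with N hN using hN.symm)
  have hfi : Integrable (fun x => (f x).toReal) μ := by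
    have h1 : Integrable (fun x => B - (f x).toReal) μ := by
      refine ⟨aestronglyMeasurable_const.sub hmeas, ?_⟩
      refine lt_of_le_of_lt (lintegral_mono_ae ?_) hsup
      filter_upwards [hev, hgB] with x hx hxB
      obtain ⟨N, hN⟩ := hx.exists
      rw [← hN, Real.enorm_eq_ofReal (by linarith [(hxB N).2])]
      exact le_iSup (fun N => h N x) N
    exact ((integrable_const B).sub h1).congr (Eventually.of_forall fun x => by simp)
  refine ⟨hbot, hfi, ?_⟩
  refine tendsto_integral_of_dominated_convergence (fun x => |(f x).toReal| + B)
    (fun N => (hgm N).aestronglyMeasurable) (hfi.abs.add (integrable_const B)) (fun N => ?_) ?_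
  · filter_upwards [hbot, hg, hgB] with x hx hgx hxB
    have hcoe : ((f x).toReal : EReal) = f x :=
      EReal.coe_toReal (hgx.1.trans_lt (EReal.coe_lt_top _)).ne hx
    have h1 : ((f x).toReal : EReal) ≤ g N x := by rw [hgx.2, hcoe]; exact le_max_left _ _
    have h2 : (f x).toReal ≤ g N x := by exact_mod_cast h1
    rw [Real.norm_eq_abs, abs_le]
    have := hxB N
    have h3 := neg_abs_le (f x).toReal
    have h4 := abs_nonneg (f x).toReal
    constructor <;> linarith
  · filter_upwards [hev] with x hx
    exact tendsto_const_nhds.congr' (by filter_upwards [hx] with N hN using hN.symm)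

/-! ### Local integrability -/

theorem setIntegral_closedBall_eq (f : Eu n → ℝ) (x : Eu n) {r : ℝ} (hr : 0 < r) :
    ∫ y in Metric.closedBall x r, f y = r ^ n * ∫ z in UBall n, f (x + r • z) := by
  have h1 : ∀ z : Eu n, (UBall n).indicator (fun z => f (x + r • z)) z =
      (Metric.closedBall x r).indicator f (x + r • z) := fun z => by
    by_cases hz : z ∈ UBall n
    · rw [indicator_of_mem hz, indicator_of_mem]
      rw [mem_closedBall_zero_iff] at hz
      rw [Metric.mem_closedBall, dist_eq_norm, add_sub_cancel_left, norm_smul, Real.norm_eq_abs,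
        abs_of_pos hr]
      nlinarith
    · rw [indicator_of_notMem hz, indicator_of_notMem]
      rw [mem_closedBall_zero_iff] at hz
      rw [Metric.mem_closedBall, dist_eq_norm, add_sub_cancel_left, norm_smul, Real.norm_eq_abs,
        abs_of_pos hr]
      nlinarith
  rw [← integral_indicator Metric.isClosed_closedBall.measurableSet,
    ← integral_indicator Metric.isClosed_closedBall.measurableSet]
  simp only [h1]
  rw [Measure.integral_comp_smul volume (fun y => (Metric.closedBall x r).indicator f (x + y)) r,
    integral_add_left_eq_self (μ := volume) ((Metric.closedBall x r).indicator f) x]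
  rw [finrank_euclideanSpace_fin, abs_of_pos (by positivity), smul_eq_mul,
    mul_inv_cancel_left₀ (by positivity)]

section local_integrability

variable {F : Set (Matrix (Fin n) (Fin n) ℝ)} {p : ℝ} {u : Eu n → EReal} {X : Set (Eu n)}

theorem trunc_le_ball_average (hF : Admissible F p) (R : RotationFamily F)
    (hu : IsSubharmonicOn F u X) (hX : IsOpen X) {S : Set (Eu n)} (hSX : S ⊆ X)
    (hS : IsCompact S) (N : ℕ) {x : Eu n} {r : ℝ} (hr : 0 < r)
    (hxS : Metric.closedBall x r ⊆ interior S) :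
    trunc u S N x ≤ ⨍ z in UBall n, trunc u S N (x + r • z) := by
  have := hF.ne_zero
  obtain ⟨B, hB0, hB⟩ := exists_upper_bound hu hSX hS
  refine ((fsub_trunc hF hu hSX N).traceSub hF).le_ball_average R
    (upperSemicontinuous_trunc hu hX hSX hS.isClosed N) (abs_trunc_le hu hSX hB0 hB N) hr
    fun z hz => hxS ?_
  rw [mem_closedBall_zero_iff] at hz
  rw [Metric.mem_closedBall, dist_eq_norm, add_sub_cancel_left, norm_smul, Real.norm_eq_abs,
    abs_of_pos hr]
  nlinarith

/-- The sub-mean value inequality at the centre, where `u` is finite, bounds the integrals of all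
truncations from below. -/
theorem integrableOn_closedBall (hF : Admissible F p) (R : RotationFamily F)
    (hu : IsSubharmonicOn F u X) (hX : IsOpen X) {z : Eu n} {r ρ : ℝ} (hr : 0 < r) (hρ : r < ρ)
    (hzX : Metric.closedBall z ρ ⊆ X) (hz : u z ≠ ⊥) :
    (∀ᵐ x ∂(volume.restrict (Metric.closedBall z r)), u x ≠ ⊥) ∧
      IntegrableOn (fun x => (u x).toReal) (Metric.closedBall z r) := by
  have := hF.ne_zero
  have hS := isCompact_closedBall z ρ
  obtain ⟨B, hB0, hB⟩ := exists_upper_bound hu hzX hS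
  have hsub := Metric.closedBall_subset_closedBall (x := z) hρ.le
  have hfin : IsFiniteMeasure ((volume : Measure (Eu n)).restrict (Metric.closedBall z r)) :=
    ⟨by rw [Measure.restrict_apply_univ]; exact measure_closedBall_lt_top⟩
  have hzr : z ∈ Metric.closedBall z ρ := Metric.mem_closedBall_self (hr.trans hρ).le
  have h := integrable_of_truncations (μ := volume.restrict (Metric.closedBall z r)) (f := u)
    (g := fun N => trunc u (Metric.closedBall z ρ) N) (B := B)
    (L := r ^ n * (volume.real (UBall n) * (u z).toReal)) hB0
    (fun N => (upperSemicontinuous_trunc hu hX hzX hS.isClosed N).measurable)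
    ((ae_restrict_mem Metric.isClosed_closedBall.measurableSet).mono fun x hx =>
      ⟨hB x (hsub hx), fun N => coe_trunc hu hzX (hsub hx) N⟩) fun N => by
      rw [setIntegral_closedBall_eq _ _ hr]
      refine mul_le_mul_of_nonneg_left ?_ (by positivity)
      have h1 := trunc_le_ball_average hF R hu hX hzX hS N hr (x := z)
        ((Metric.closedBall_subset_ball hρ).trans Metric.ball_subset_interior_closedBall)
      rw [setAverage_eq, smul_eq_mul, inv_mul_eq_div, le_div_iff₀ volume_ball_pos] at h1
      refine le_trans ?_ h1
      rw [mul_comm]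
      refine mul_le_mul_of_nonneg_right ?_ volume_ball_pos.le
      have h2 : ((u z).toReal : EReal) ≤ trunc u (Metric.closedBall z ρ) N z := by
        rw [EReal.coe_toReal (hu.ne_top z (hzX hzr)) hz, coe_trunc hu hzX hzr]
        exact le_max_left _ _
      exact_mod_cast h2
  exact ⟨h.1, h.2.1⟩

/-- The points with an integrable ball about them form an open set `A` that meets `X`. If `x` is in
`X` and the closure of `A`, there is a point `w` within `ρ/4` of `x` with `u w ≠ ⊥`; the ball of
radius `ρ/2` about `w` is then good and contains the ball of radius `ρ/4` about `x`. Connectedness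
finishes. -/
theorem exists_integrableOn_closedBall (hF : Admissible F p) (R : RotationFamily F)
    (hu : IsSubharmonicOn F u X) (hX : IsOpen X) (hc : IsConnected X) (hne : ∃ x ∈ X, u x ≠ ⊥) :
    ∀ x ∈ X, ∃ r > 0, (∀ᵐ y ∂(volume.restrict (Metric.closedBall x r)), u y ≠ ⊥) ∧
      IntegrableOn (fun x => (u x).toReal) (Metric.closedBall x r) := by
  have := hF.ne_zero
  let A : Set (Eu n) := {x | ∃ r > 0, (∀ᵐ y ∂(volume.restrict (Metric.closedBall x r)), u y ≠ ⊥) ∧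
      IntegrableOn (fun x => (u x).toReal) (Metric.closedBall x r)}
  have hmono : ∀ {x y : Eu n} {r s : ℝ}, Metric.closedBall y s ⊆ Metric.closedBall x r →
      (∀ᵐ y ∂(volume.restrict (Metric.closedBall x r)), u y ≠ ⊥) ∧
      IntegrableOn (fun x => (u x).toReal) (Metric.closedBall x r) →
      (∀ᵐ y ∂(volume.restrict (Metric.closedBall y s)), u y ≠ ⊥) ∧
      IntegrableOn (fun x => (u x).toReal) (Metric.closedBall y s) := fun hsub h =>
    ⟨ae_restrict_of_ae_restrict_of_subset hsub h.1, h.2.mono_set hsub⟩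
  suffices X ⊆ A from fun x hx => this hx
  have hAo : IsOpen A := by
    rw [Metric.isOpen_iff]
    rintro x ⟨r, hr, h⟩
    refine ⟨r / 2, by positivity, fun y hy => ⟨r / 2, by positivity, hmono ?_ h⟩⟩
    refine Metric.closedBall_subset_closedBall' ?_
    rw [Metric.mem_ball] at hy
    linarith
  have hball : ∀ x ∈ X, ∃ ρ > 0, Metric.closedBall x ρ ⊆ X := fun x hx =>
    Metric.nhds_basis_closedBall.mem_iff.1 (hX.mem_nhds hx)
  refine hc.isPreconnected.subset_of_closure_inter_subset hAo ?_ ?_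
  · obtain ⟨x, hx, hux⟩ := hne
    obtain ⟨ρ, hρ, hρX⟩ := hball x hx
    exact ⟨x, hx, ρ / 2, by positivity,
      integrableOn_closedBall hF R hu hX (by positivity) (by linarith) hρX hux⟩
  · rintro x ⟨hxA, hx⟩
    obtain ⟨ρ, hρ, hρX⟩ := hball x hx
    obtain ⟨y, ⟨r, hr, hy1, -⟩, hyx⟩ := Metric.mem_closure_iff.1 hxA (ρ / 8) (by positivity)
    have hmin : 0 < min r (ρ / 8) := lt_min hr (by positivity)
    have h1 : ∀ᵐ w ∂(volume.restrict (Metric.closedBall y (min r (ρ / 8)))), u w ≠ ⊥ :=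
      ae_restrict_of_ae_restrict_of_subset
        (Metric.closedBall_subset_closedBall (min_le_left _ _)) hy1
    have hne0 : (ae ((volume : Measure (Eu n)).restrict
        (Metric.closedBall y (min r (ρ / 8))))).NeBot := by
      rw [ae_neBot, Ne, Measure.restrict_eq_zero]
      exact (Metric.measure_closedBall_pos _ _ hmin).ne'
    obtain ⟨w, hw, hwm⟩ := (h1.and
      (ae_restrict_mem Metric.isClosed_closedBall.measurableSet)).exists
    have hwx : dist w x ≤ ρ / 4 := by
      have h2 : dist w y ≤ ρ / 8 := (Metric.mem_closedBall.1 hwm).trans (min_le_right _ _)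
      have h3 := dist_triangle w y x
      rw [dist_comm x y] at hyx
      linarith
    have h4 := integrableOn_closedBall hF R hu hX (z := w) (r := ρ / 2) (ρ := 3 * ρ / 4)
      (by positivity) (by linarith)
      ((Metric.closedBall_subset_closedBall' (by linarith)).trans hρX) hw
    exact ⟨ρ / 4, by positivity, hmono (Metric.closedBall_subset_closedBall' (by
      rw [dist_comm]; linarith)) h4⟩

theorem isLocallyIntegrableOn (hF : Admissible F p) (R : RotationFamily F)
    (hu : IsSubharmonicOn F u X) (hX : IsOpen X) (hc : IsConnected X) (hne : ∃ x ∈ X, u x ≠ ⊥) :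
    IsLocallyIntegrableOn u X := by
  have h := exists_integrableOn_closedBall hF R hu hX hc hne
  constructor
  · have h1 : ∀ᵐ x ∂((volume : Measure (Eu n)).restrict X), u x ≠ ⊥ := by
      rw [ae_restrict_iff' hX.measurableSet]
      have h2 : (volume : Measure (Eu n)) {x | x ∈ X ∧ u x = ⊥} = 0 := by
        refine measure_null_of_locally_null _ fun x hx => ?_
        obtain ⟨r, hr, h3, -⟩ := h x hx.1
        rw [ae_restrict_iff' Metric.isClosed_closedBall.measurableSet] at h3
        refine ⟨{x | x ∈ X ∧ u x = ⊥} ∩ Metric.closedBall x r,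
          inter_mem_nhdsWithin _ (Metric.closedBall_mem_nhds x hr),
          measure_mono_null (fun y hy => ?_) h3⟩
        exact fun hcon => hcon hy.2 hy.1.2
      refine measure_mono_null (fun y hy => ?_) h2
      simpa using hy
    filter_upwards [h1, ae_restrict_mem hX.measurableSet] with x hx hxX
    exact ⟨hx, hu.ne_top x hxX⟩
  · intro x hx
    obtain ⟨r, hr, -, h4⟩ := h x hx
    exact ⟨Metric.closedBall x r, mem_nhdsWithin_of_mem_nhds (Metric.closedBall_mem_nhds x hr), h4⟩

end local_integrability

/-! ### The means at a point -/

section means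

variable {F : Set (Matrix (Fin n) (Fin n) ℝ)} {p : ℝ}

theorem FSub.translate {v : Eu n → ℝ} {X : Set (Eu n)} (hv : FSub F v X) (a : Eu n) :
    FSub F (fun y => v (a + y)) {y | a + y ∈ X} := by
  intro y hy ψ hψ hle heq
  have hy' : -a + ContinuousLinearMap.id ℝ (Eu n) (a + y) = y := by simp
  have hψ' : ContDiffAt ℝ 2 ψ (-a + ContinuousLinearMap.id ℝ (Eu n) (a + y)) := by rwa [hy']
  have hlim : Tendsto (fun z => -a + ContinuousLinearMap.id ℝ (Eu n) z) (𝓝 (a + y)) (𝓝 y) := by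
    have : Continuous fun z => -a + ContinuousLinearMap.id ℝ (Eu n) z := by fun_prop
    have h := this.tendsto (a + y)
    rwa [hy'] at h
  have h1 := hv (a + y) hy (fun z => ψ (-a + ContinuousLinearMap.id ℝ (Eu n) z))
    (ContDiffAt.comp (g := ψ) _ hψ'
      (contDiffAt_const.add (ContinuousLinearMap.id ℝ (Eu n)).contDiff.contDiffAt))
    (by filter_upwards [hlim.eventually hle] with z hz
        simpa using hz) (by rw [hy']; exact heq)
  rw [hessian_comp_affine _ (-a) _ hψ', hy'] at h1
  have h2 : (Matrix.of fun i j => (ContinuousLinearMap.id ℝ (Eu n)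
      (EuclideanSpace.single j 1)) i) = (1 : Matrix (Fin n) (Fin n) ℝ) := by
    ext i j
    simp [Matrix.one_apply]
  rwa [h2, Matrix.transpose_one, Matrix.one_mul, Matrix.mul_one] at h1

theorem KernelConvex.monotoneOn {ψ : ℝ → ℝ} {δ : ℝ} (h : KernelConvex p ψ δ) {s t : ℝ}
    (hs : 0 < s) (hst : s ≤ t) (ht : t < δ) : ψ s ≤ ψ t := by
  rcases hst.eq_or_lt with rfl | hlt
  · exact le_rfl
  · exact (h s t ((t + δ) / 2) hs hlt (by linarith) (by linarith)).1

theorem FSub.ball_average_le_sphereAverage (hF : Admissible F p) (R : RotationFamily F)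
    {v : Eu n → ℝ} {K ρ r : ℝ} (hsub : FSub F v (Metric.ball 0 ρ)) (hv : UpperSemicontinuous v)
    (hK : ∀ x, |v x| ≤ K) (hr : 0 < r) (hrρ : r < ρ) :
    ⨍ z in UBall n, v (r • z) ≤ ⨍ σ : USphere n, v (r • (σ : Eu n)) ∂(sphereMeasure n) := by
  have := hF.ne_zero
  refine ball_average_le_of_sphere_le (f := fun z => v (r • z)) (integrableOn_ball_of_bound
    (hv.comp (g := fun z => r • z) (by fun_prop)).measurable fun z => hK _) fun t ht => ?_
  have h := (hsub.kernelConvex_sphereAverage hF R hv hK).monotoneOn (s := r * t) (t := r)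
    (mul_pos hr ht.1) (by nlinarith [ht.2]) hrρ
  simpa only [smul_smul] using h

theorem average_sphere_le_radialMax [NeZero n] {v : Eu n → ℝ} {K r : ℝ}
    (hv : UpperSemicontinuous v) (hK : ∀ x, |v x| ≤ K) (hr : 0 < r) :
    ⨍ σ : USphere n, v (r • (σ : Eu n)) ∂(sphereMeasure n) ≤ radialMax v r := by
  have h1 : Integrable (fun σ : USphere n => v (r • (σ : Eu n))) (sphereMeasure n) :=
    Integrable.of_bound (hv.comp (g := fun σ : USphere n => r • (σ : Eu n))
      (by fun_prop)).measurable.aestronglyMeasurable K (Eventually.of_forall fun _ => hK _)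
  have h2 : ⨍ σ : USphere n, v (r • (σ : Eu n)) ∂(sphereMeasure n) ≤
      ⨍ _σ : USphere n, radialMax v r ∂(sphereMeasure n) := by
    refine integral_mono h1.to_average (integrable_const _) fun σ => ?_
    exact (radialMax_spec hv hr.le).2 _ (by
      rw [norm_smul, Real.norm_eq_abs, abs_of_pos hr]; simp)
  rwa [average_const] at h2

/-- A Harnack inequality. -/
theorem FSub.harnack (hF : Admissible F p) (R : RotationFamily F)
    {v : Eu n → ℝ} {K ρ r l : ℝ} (hsub : FSub F v (Metric.ball 0 ρ)) (hv : UpperSemicontinuous v)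
    (hK : ∀ x, |v x| ≤ K) (hr : 0 < r) (hrρ : r < ρ) (hl : 0 < l) (hl' : l < 1 / 2) :
    radialMax v (l * r) - radialMax v r ≤ ((1 - 2 * l) / (1 - l)) ^ n *
      ((⨍ z in UBall n, v (((1 - 2 * l) * r) • z)) - radialMax v r) := by
  have := hF.ne_zero
  -- Let `x` be a maximum point in the ball of radius `lr`. The ball of radius `(1-l)r` about `x`
  -- lies in that of radius `r` about `0`, where `m - v ≥ 0`, and contains that of radius `(1-2l)r`
  -- about `0`. Comparing the integrals of `m - v` over the two gives the ratio of volumes.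
  obtain ⟨⟨x, hx, hxe⟩, -⟩ := radialMax_spec hv (mul_pos hl hr).le
  have hmax := (radialMax_spec hv hr.le).2
  set m := radialMax v r
  rw [← hxe]
  have hr1 : 0 < (1 - l) * r := mul_pos (by linarith) hr
  have hr2 : 0 < (1 - 2 * l) * r := mul_pos (by linarith) hr
  have hnorm : ∀ y ∈ Metric.closedBall x ((1 - l) * r), ‖y‖ ≤ r := fun y hy => by
    rw [mem_closedBall_iff_norm] at hy
    have h := norm_add_le (y - x) x
    rw [sub_add_cancel] at h
    linarith
  have h1 : v x ≤ ⨍ z in UBall n, v (x + ((1 - l) * r) • z) := by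
    refine (hsub.traceSub hF).le_ball_average R hv hK hr1 fun z hz => ?_
    rw [mem_ball_zero_iff]
    refine (hnorm _ ?_).trans_lt hrρ
    rw [mem_closedBall_zero_iff] at hz
    rw [mem_closedBall_iff_norm, add_sub_cancel_left, norm_smul, Real.norm_eq_abs, abs_of_pos hr1]
    nlinarith
  have hint : ∀ (a : Eu n) (s : ℝ), IntegrableOn (fun z => v (a + s • z)) (UBall n) := fun a s =>
    integrableOn_ball_of_bound (hv.comp (g := fun z => a + s • z) (by fun_prop)).measurable
      fun z => hK _
  have hconst : IntegrableOn (fun _ : Eu n => m) (UBall n) := integrable_const _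
  have hsubset : Metric.closedBall 0 ((1 - 2 * l) * r) ⊆ Metric.closedBall x ((1 - l) * r) := by
    refine Metric.closedBall_subset_closedBall' ?_
    rw [dist_zero_left]; linarith
  have h2 : ∫ y in Metric.closedBall 0 ((1 - 2 * l) * r), (m - v y) ≤
      ∫ y in Metric.closedBall x ((1 - l) * r), (m - v y) := by
    have hfin : IsFiniteMeasure
        ((volume : Measure (Eu n)).restrict (Metric.closedBall x ((1 - l) * r))) :=
      ⟨by rw [Measure.restrict_apply_univ]; exact measure_closedBall_lt_top⟩
    refine setIntegral_mono_set ?_ ?_ hsubset.eventuallyLE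
    · exact (integrable_const _).sub (Integrable.of_bound hv.measurable.aestronglyMeasurable K
        (Eventually.of_forall hK))
    · filter_upwards [ae_restrict_mem Metric.isClosed_closedBall.measurableSet] with y hy
      simpa using hmax y (hnorm y hy)
  rw [setIntegral_closedBall_eq _ _ hr1, setIntegral_closedBall_eq _ _ hr2,
    integral_sub hconst (hint _ _), integral_sub hconst (hint _ _)] at h2
  have hav : ∀ f : Eu n → ℝ, ∫ z in UBall n, f z = volume.real (UBall n) * ⨍ z in UBall n, f z :=
    fun f => by
      rw [setAverage_eq, smul_eq_mul, mul_inv_cancel_left₀ volume_ball_pos.ne']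
  have hV := volume_ball_pos (n := n)
  rw [hav (fun z => v (0 + ((1 - 2 * l) * r) • z)), hav (fun z => v (x + ((1 - l) * r) • z)),
    setIntegral_const, smul_eq_mul, ← mul_sub, ← mul_sub] at h2
  simp only [zero_add] at h2
  set A := ⨍ z in UBall n, v (((1 - 2 * l) * r) • z)
  set A' := ⨍ z in UBall n, v (x + ((1 - l) * r) • z)
  have h3 : ((1 - 2 * l) / (1 - l)) ^ n = ((1 - 2 * l) * r) ^ n / ((1 - l) * r) ^ n := by
    rw [← div_pow, mul_div_mul_right _ _ hr.ne']
  have hp1 : 0 < ((1 - l) * r) ^ n := by positivity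
  have h4 : ((1 - 2 * l) * r) ^ n * (m - A) ≤ ((1 - l) * r) ^ n * (m - A') := by
    have := h2
    rw [mul_left_comm, mul_left_comm (((1 - l) * r) ^ n)] at this
    exact le_of_mul_le_mul_left this hV
  rw [h3, div_mul_eq_mul_div, le_div_iff₀ hp1]
  nlinarith

variable {u : Eu n → EReal} {X : Set (Eu n)}

/-- The means are finite, and they are the limits of the means of bounded subsolutions. -/
theorem exists_approx (hF : Admissible F p) (R : RotationFamily F) (hu : IsSubharmonicOn F u X)
    (hX : IsOpen X) (hloc : IsLocallyIntegrableOn u X) {x₀ : Eu n} {ρ : ℝ}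
    (hρX : Metric.closedBall x₀ ρ ⊆ X) :
    (∀ r, 0 < r → r < ρ → MeansFinite u x₀ r) ∧
    ∃ v : ℕ → Eu n → ℝ, (∀ N, UpperSemicontinuous (v N)) ∧ (∀ N, ∃ K, ∀ x, |v N x| ≤ K) ∧
      (∀ N, FSub F (v N) (Metric.ball 0 ρ)) ∧ ∀ r, 0 < r → r < ρ →
        Tendsto (fun N => radialMax (v N) r) atTop (𝓝 (maxMean u x₀ r)) ∧
        Tendsto (fun N => ⨍ σ : USphere n, v N (r • (σ : Eu n)) ∂(sphereMeasure n)) atTop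
          (𝓝 (sphereMean u x₀ r)) ∧
        Tendsto (fun N => ⨍ z in UBall n, v N (r • z)) atTop (𝓝 (volumeMean u x₀ r)) := by
  have := hF.ne_zero
  set S := Metric.closedBall x₀ ρ with hSdef
  have hS : IsCompact S := isCompact_closedBall _ _
  obtain ⟨B, hB0, hB⟩ := exists_upper_bound hu hρX hS
  let v : ℕ → Eu n → ℝ := fun N y => trunc u S N (x₀ + y)
  have hv : ∀ N, UpperSemicontinuous (v N) := fun N =>
    (upperSemicontinuous_trunc hu hX hρX hS.isClosed N).comp (g := fun y => x₀ + y) (by fun_prop)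
  have hK : ∀ N x, |v N x| ≤ B + N := fun N x => abs_trunc_le hu hρX hB0 hB N _
  have hsub : ∀ N, FSub F (v N) (Metric.ball 0 ρ) := fun N =>
    ((fsub_trunc hF hu hρX N).translate x₀).mono fun y hy =>
      Metric.ball_subset_interior_closedBall (by simpa using hy)
  have hmemS : ∀ {r : ℝ}, 0 < r → r < ρ → ∀ z ∈ UBall n, x₀ + r • z ∈ S := fun hr hrρ z hz => by
    rw [mem_closedBall_zero_iff] at hz
    rw [hSdef, mem_closedBall_iff_norm, add_sub_cancel_left, norm_smul, Real.norm_eq_abs,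
      abs_of_pos hr]
    nlinarith
  have hui : IntegrableOn (fun x => (u x).toReal) S := hloc.2.integrableOn_compact_subset hρX hS
  have hbot : ∀ᵐ x ∂(volume.restrict S), u x ≠ ⊥ :=
    ae_restrict_of_ae_restrict_of_subset hρX (hloc.1.mono fun x hx => hx.1)
  have hlow : ∀ r, 0 < r → r < ρ → ∀ N, (r ^ n)⁻¹ * ∫ x in Metric.closedBall x₀ r, (u x).toReal ≤
      ∫ z in UBall n, v N (r • z) := fun r hr hrρ N => by
    have hsubs := Metric.closedBall_subset_closedBall (x := x₀) hrρ.le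
    have hfin : IsFiniteMeasure ((volume : Measure (Eu n)).restrict
      (Metric.closedBall x₀ r)) :=
      ⟨by rw [Measure.restrict_apply_univ]; exact measure_closedBall_lt_top⟩
    rw [inv_mul_le_iff₀ (by positivity),
      ← setIntegral_closedBall_eq (fun y => trunc u S N y) x₀ hr]
    refine integral_mono_ae (hui.mono_set hsubs) (Integrable.of_bound
      (upperSemicontinuous_trunc hu hX hρX
        hS.isClosed N).measurable.aestronglyMeasurable (B + N)
      (Eventually.of_forall fun x => abs_trunc_le hu hρX hB0 hB N x)) ?_
    filter_upwards [ae_restrict_of_ae_restrict_of_subset hsubs hbot,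
      ae_restrict_mem Metric.isClosed_closedBall.measurableSet] with x hx hxr
    have hxS : x ∈ S := hsubs hxr
    have h2 : ((u x).toReal : EReal) ≤ trunc u S N x := by
      rw [EReal.coe_toReal (hu.ne_top x (hρX hxS)) hx, coe_trunc hu hρX hxS]
      exact le_max_left _ _
    exact_mod_cast h2
  have hball : ∀ r, 0 < r → r < ρ → _ := fun r hr hrρ =>
    integrable_of_truncations (μ := volume.restrict (UBall n)) (f := fun z => u (x₀ + r • z))
      (g := fun N z => v N (r • z)) (B := B)
      (L := (r ^ n)⁻¹ * ∫ x in Metric.closedBall x₀ r, (u x).toReal) hB0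
      (fun N => ((hv N).comp (g := fun z => r • z) (by fun_prop)).measurable)
      ((ae_restrict_mem Metric.isClosed_closedBall.measurableSet).mono fun z hz =>
        ⟨hB _ (hmemS hr hrρ z hz), fun N => coe_trunc hu hρX (hmemS hr hrρ z hz) N⟩) (hlow r hr hrρ)
  -- Local integrability says nothing about a single sphere. The lower bound for the spherical
  -- integrals comes from that for balls, because ball averages do not exceed spherical averages.
  have hsphere : ∀ r, 0 < r → r < ρ → _ := fun r hr hrρ =>
    integrable_of_truncations (μ := sphereMeasure n) (f := fun σ => u (x₀ + r • (σ : Eu n)))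
      (g := fun N σ => v N (r • (σ : Eu n))) (B := B)
      (L := (sphereMeasure n).real univ * ((volume.real (UBall n))⁻¹ *
        ((r ^ n)⁻¹ * ∫ x in Metric.closedBall x₀ r, (u x).toReal))) hB0
      (fun N => ((hv N).comp (g := fun σ : USphere n => r • (σ : Eu n)) (by fun_prop)).measurable)
      (Eventually.of_forall fun σ => by
        have hσ := hmemS hr hrρ (σ : Eu n) (by simp)
        exact ⟨hB _ hσ, fun N => coe_trunc hu hρX hσ N⟩) fun N => by
        have h1 := (hsub N).ball_average_le_sphereAverage hF R (hv N) (hK N) hr hrρ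
        rw [setAverage_eq, average_eq, smul_eq_mul, smul_eq_mul] at h1
        have h2 : 0 < (sphereMeasure n).real univ :=
          measureReal_univ_pos
        rw [← le_div_iff₀' h2, div_eq_inv_mul]
        exact (mul_le_mul_of_nonneg_left (hlow r hr hrρ N)
          (inv_pos.2 volume_ball_pos).le).trans h1
  have hsup : ∀ r, 0 < r → r < ρ → ballSup u x₀ r ≠ ⊥ ∧ ballSup u x₀ r ≠ ⊤ ∧
      ∀ N : ℕ, ((radialMax (v N) r : ℝ) : EReal) =
        max (ballSup u x₀ r) ((-(N : ℝ) : ℝ) : EReal) := fun r hr hrρ => by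
    have hle : ∀ z ∈ UBall n, u (x₀ + r • z) ≤ ballSup u x₀ r := fun z hz =>
      le_iSup₂ (f := fun z (_ : z ∈ UBall n) => u (x₀ + r • z)) z hz
    refine ⟨?_, ?_, fun N => ?_⟩
    · obtain ⟨z, hz, hzm⟩ := ((hball r hr hrρ).1.and
        (ae_restrict_mem Metric.isClosed_closedBall.measurableSet)).exists
      intro h
      exact hz (le_bot_iff.1 (h ▸ hle z hzm))
    · have : ballSup u x₀ r ≤ B := iSup₂_le fun z hz => hB _ (hmemS hr hrρ z hz)
      exact (this.trans_lt (EReal.coe_lt_top _)).ne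
    · obtain ⟨⟨x, hx, hxe⟩, hmax⟩ := radialMax_spec (hv N) hr.le
      have hxz : ∀ x : Eu n, ‖x‖ ≤ r → ∃ z ∈ UBall n, r • z = x := fun x hx =>
        ⟨r⁻¹ • x, by
          rw [mem_closedBall_zero_iff, norm_smul, Real.norm_eq_abs, abs_of_pos (inv_pos.2 hr),
            inv_mul_le_iff₀ hr, mul_one]; exact hx, by simp [smul_smul, hr.ne']⟩
      refine le_antisymm ?_ (max_le (iSup₂_le fun z hz => ?_) ?_)
      · obtain ⟨z, hz, rfl⟩ := hxz x hx
        rw [← hxe, coe_trunc hu hρX (hmemS hr hrρ z hz)]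
        exact max_le_max (hle z hz) le_rfl
      · have h1 : ((v N (r • z) : ℝ) : EReal) ≤ radialMax (v N) r := by
          have := hmax (r • z) (by
            rw [mem_closedBall_zero_iff] at hz
            rw [norm_smul, Real.norm_eq_abs, abs_of_pos hr]; nlinarith)
          exact_mod_cast this
        refine le_trans ?_ h1
        rw [coe_trunc hu hρX (hmemS hr hrρ z hz)]
        exact le_max_left _ _
      · have h1 : -(N : ℝ) ≤ radialMax (v N) r :=
          (neg_le_trunc hu hρX N _).trans (hmax 0 (by simpa using hr.le))
        exact_mod_cast h1
  refine ⟨fun r hr hrρ => ⟨(hsup r hr hrρ).1, (hsup r hr hrρ).2.1, (hsphere r hr hrρ).1,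
    (hsphere r hr hrρ).2.1, (hball r hr hrρ).1, (hball r hr hrρ).2.1⟩, v, hv,
    fun N => ⟨_, hK N⟩, hsub, fun r hr hrρ => ⟨?_, ?_, ?_⟩⟩
  · obtain ⟨h1, h2, h3⟩ := hsup r hr hrρ
    have hcoe := EReal.coe_toReal h2 h1
    obtain ⟨M, hM⟩ := exists_nat_gt (-(ballSup u x₀ r).toReal)
    refine tendsto_const_nhds.congr' ?_
    filter_upwards [eventually_ge_atTop M] with N hN
    have h4 : -(N : ℝ) ≤ (ballSup u x₀ r).toReal := by
      have : (M : ℝ) ≤ N := by exact_mod_cast hN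
      linarith
    have h5 := h3 N
    rw [← hcoe, max_eq_left (by exact_mod_cast h4)] at h5
    exact_mod_cast h5.symm
  · simp only [average_eq, sphereMean]
    exact (hsphere r hr hrρ).2.2.const_smul _
  · simp only [setAverage_eq, volumeMean]
    exact (hball r hr hrρ).2.2.const_smul _

variable {x₀ : Eu n} {ρ : ℝ}

/-- The properties of the means of a subsolution near a point that determine its densities. -/
structure MeanData (n : ℕ) (p ρ : ℝ) (M S V : ℝ → ℝ) : Prop where
  maxConvex : KernelConvex p M ρ
  sphereConvex : KernelConvex p S ρ
  sphere_le_max : ∀ r, 0 < r → r < ρ → S r ≤ M r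
  harnack : ∀ r l, 0 < r → r < ρ → 0 < l → l < 1 / 2 →
    M (l * r) - M r ≤ ((1 - 2 * l) / (1 - l)) ^ n * (V ((1 - 2 * l) * r) - M r)
  volume_eq : ∀ r, 0 < r → r < ρ → V r = n * ∫ t in Ioc (0 : ℝ) 1, t ^ (n - 1) * S (r * t)
  integrableOn : ∀ r, 0 < r → r < ρ → IntegrableOn (fun t => t ^ (n - 1) * S (r * t)) (Ioc 0 1)

theorem meanData (hF : Admissible F p) (R : RotationFamily F) (hu : IsSubharmonicOn F u X)
    (hX : IsOpen X) (hloc : IsLocallyIntegrableOn u X) (hρ : 0 < ρ)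
    (hρX : Metric.closedBall x₀ ρ ⊆ X) :
    MeanData n p ρ (maxMean u x₀) (sphereMean u x₀) (volumeMean u x₀) := by
  have := hF.ne_zero
  obtain ⟨hfin, v, hv, hK, hsub, hlim⟩ := exists_approx hF R hu hX hloc hρX
  choose K hK using hK
  have hpolar : ∀ r t : ℝ, ⨍ σ : USphere n, (u (x₀ + r • t • (σ : Eu n))).toReal
      ∂(sphereMeasure n) = sphereMean u x₀ (r * t) := fun r t => by
    simp only [smul_smul, sphereMean]
  refine ⟨?_, ?_, fun r hr hrρ => ?_, fun r l hr hrρ hl hl' => ?_, fun r hr hrρ => ?_,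
    fun r hr hrρ => ?_⟩
  · exact .of_tendsto (fun N => (hsub N).kernelConvex_radialMax hF (hv N))
      fun t ht htρ => (hlim t ht htρ).1
  · exact .of_tendsto (fun N => (hsub N).kernelConvex_sphereAverage hF R (hv N) (hK N))
      fun t ht htρ => (hlim t ht htρ).2.1
  · exact le_of_tendsto_of_tendsto' (hlim r hr hrρ).2.1 (hlim r hr hrρ).1
      fun N => average_sphere_le_radialMax (hv N) (hK N) hr
  · have h1 := (hlim (l * r) (by positivity) (by nlinarith)).1
    have h2 := (hlim r hr hrρ).1
    have h3 := (hlim ((1 - 2 * l) * r) (mul_pos (by linarith) hr) (by nlinarith)).2.2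
    exact le_of_tendsto_of_tendsto' (h1.sub h2) ((h3.sub h2).const_mul _)
      fun N => (hsub N).harnack hF R (hv N) (hK N) hr hrρ hl hl'
  · have h := ball_average_eq (hfin r hr hrρ).ball_integrable
    simp only [hpolar] at h
    exact h
  · have h := integrableOn_pow_mul_sphereAverage (hfin r hr hrρ).ball_integrable
    simp only [hpolar] at h
    exact h

end means

/-! ### Positivity of the Laplacian -/

theorem continuous_hessian {φ : Eu n → ℝ} (h : ContDiff ℝ 2 φ) (i j : Fin n) :
    Continuous fun x => hessian φ x i j := by
  simp only [hessian_apply]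
  have h1 : ContDiff ℝ 1 (fderiv ℝ φ) := h.fderiv_right (by norm_num)
  have h2 := h1.continuous_fderiv one_ne_zero
  fun_prop

theorem continuous_trace_hessian {φ : Eu n → ℝ} (h : ContDiff ℝ 2 φ) :
    Continuous fun x => (hessian φ x).trace :=
  continuous_finsetSum _ fun i _ => continuous_hessian h i i

theorem hessian_eq_zero_of_notMem_tsupport {φ : Eu n → ℝ} {x : Eu n} (hx : x ∉ tsupport φ) :
    hessian φ x = 0 := by
  ext i j
  have h1 : fderiv ℝ φ =ᶠ[𝓝 x] fun _ => 0 := by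
    filter_upwards [(isClosed_tsupport φ).isOpen_compl.mem_nhds hx] with y hy
    by_contra hne
    exact hy (support_fderiv_subset ℝ hne)
  rw [hessian_apply, Matrix.zero_apply, d2, h1.fderiv_eq]
  simp

theorem tendsto_second_difference {φ : Eu n → ℝ} {x : Eu n} (h : ContDiffAt ℝ 2 φ x) (z : Eu n) :
    Tendsto (fun r : ℝ => (r ^ 2)⁻¹ * (φ (x + r • z) + φ (x - r • z) - 2 * φ x)) (𝓝[>] 0)
      (𝓝 (d2 φ x z z)) := by
  rw [Metric.tendsto_nhdsWithin_nhds]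
  intro ε hε
  obtain ⟨δ, hδ, hT⟩ := taylor_two h (show 0 < ε / (4 * (‖z‖ ^ 2 + 1)) by positivity)
  refine ⟨δ / (‖z‖ + 1), by positivity, fun {r} hr0 hr => ?_⟩
  have hr0' : 0 < r := hr0
  rw [Real.dist_eq, sub_zero, abs_of_pos hr0', lt_div_iff₀ (by positivity)] at hr
  have hrz : ‖r • z‖ < δ := by
    rw [norm_smul, Real.norm_eq_abs, abs_of_pos hr0']; nlinarith
  have h1 := abs_le.1 (hT (r • z) hrz)
  have h2 := abs_le.1 (hT (-(r • z)) (by rwa [norm_neg]))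
  have hd : d2 φ x (r • z) (r • z) = r ^ 2 * d2 φ x z z := by
    simp only [d2, map_smul, _root_.smul_apply, smul_eq_mul]; ring
  have hd' : d2 φ x (-(r • z)) (-(r • z)) = r ^ 2 * d2 φ x z z := by
    simp only [d2, map_neg, _root_.neg_apply, neg_neg] at hd ⊢; exact hd
  rw [hd, norm_smul, Real.norm_eq_abs, abs_of_pos hr0', mul_pow] at h1
  rw [hd', map_neg, norm_neg, norm_smul, Real.norm_eq_abs, abs_of_pos hr0', mul_pow,
    ← sub_eq_add_neg] at h2
  have hr2 : 0 < r ^ 2 := by positivity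
  have he : ε / (4 * (‖z‖ ^ 2 + 1)) * ‖z‖ ^ 2 ≤ ε / 4 := by
    rw [div_mul_eq_mul_div, div_le_div_iff₀ (by positivity) (by norm_num)]
    nlinarith
  have he' : ε / (4 * (‖z‖ ^ 2 + 1)) * (r ^ 2 * ‖z‖ ^ 2) ≤ r ^ 2 * (ε / 4) := by
    rw [mul_left_comm]; exact mul_le_mul_of_nonneg_left he hr2.le
  have hkey : |φ (x + r • z) + φ (x - r • z) - 2 * φ x - r ^ 2 * d2 φ x z z| ≤ r ^ 2 * (ε / 2) := by
    rw [abs_le]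
    constructor <;> linarith [h1.1, h1.2, h2.1, h2.2]
  rw [Real.dist_eq]
  have h5 : (r ^ 2)⁻¹ * (φ (x + r • z) + φ (x - r • z) - 2 * φ x) - d2 φ x z z =
      (r ^ 2)⁻¹ * (φ (x + r • z) + φ (x - r • z) - 2 * φ x - r ^ 2 * d2 φ x z z) := by
    field_simp
  rw [h5, abs_mul, abs_of_pos (inv_pos.2 hr2), inv_mul_lt_iff₀ hr2]
  nlinarith

/-- The weak form of the mean value inequality: `φ(x)(v(x + rz) - v(x))` has nonnegative integral, a
translation moves the shift onto `φ`, and `z ↦ -z` symmetrizes it. Since `r ≤ 1`, the shifted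
supports stay in the ball of radius `A + 1`. -/
theorem integral_second_difference_nonneg [NeZero n] {F : Set (Matrix (Fin n) (Fin n) ℝ)}
    (R : RotationFamily F) {v : Eu n → ℝ} {Y : Set (Eu n)} (hsub : TraceSub v Y)
    (hv : UpperSemicontinuous v) {K : ℝ} (hK : ∀ x, |v x| ≤ K) {φ : Eu n → ℝ}
    (hφ : Continuous φ) (hφ0 : ∀ x, 0 ≤ φ x) {L : ℝ} (hφL : ∀ x, |φ x| ≤ L) {A r : ℝ} (hr : 0 < r)
    (hr1 : r ≤ 1) (hA : ∀ x, φ x ≠ 0 → ‖x‖ ≤ A)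
    (hY : ∀ x, φ x ≠ 0 → ∀ z ∈ UBall n, x + r • z ∈ Y) :
    0 ≤ ∫ w : Eu n × Eu n, v w.2 * (φ (w.2 + r • w.1) + φ (w.2 - r • w.1) - 2 * φ w.2)
      ∂((volume.restrict (UBall n)).prod (volume.restrict (Metric.closedBall 0 (A + 1)))) := by
  set T : Set (Eu n) := Metric.closedBall 0 (A + 1)
  have hfin : IsFiniteMeasure ((volume : Measure (Eu n)).restrict T) :=
    ⟨by rw [Measure.restrict_apply_univ]; exact measure_closedBall_lt_top⟩
  have hvm := hv.measurable
  have hφm := hφ.measurable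
  have hvK : ∀ x y, |φ x * v y| ≤ L * K := fun x y => by
    rw [abs_mul]
    exact mul_le_mul (hφL x) (hK y) (abs_nonneg _) ((abs_nonneg _).trans (hφL x))
  have hi1 : Integrable (fun w : Eu n × Eu n => φ w.2 * v (w.2 + r • w.1))
      ((volume.restrict (UBall n)).prod (volume.restrict T)) :=
    Integrable.of_bound ((hφm.comp measurable_snd).mul
      (hvm.comp (by fun_prop))).aestronglyMeasurable (L * K) (Eventually.of_forall fun w => hvK _ _)
  have hi2 : ∀ s : ℝ, Integrable (fun w : Eu n × Eu n => φ (w.2 + s • w.1) * v w.2)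
      ((volume.restrict (UBall n)).prod (volume.restrict T)) := fun s =>
    Integrable.of_bound ((hφm.comp (by fun_prop)).mul
      (hvm.comp measurable_snd)).aestronglyMeasurable (L * K)
        (Eventually.of_forall fun w => hvK _ _)
  have hi0 : Integrable (fun w : Eu n × Eu n => φ w.2 * v w.2)
      ((volume.restrict (UBall n)).prod (volume.restrict T)) := by simpa using hi2 0
  have h1 : 0 ≤ ∫ w : Eu n × Eu n, (φ w.2 * v (w.2 + r • w.1) - φ w.2 * v w.2)
      ∂((volume.restrict (UBall n)).prod (volume.restrict T)) := by
    have hi : Integrable (fun w : Eu n × Eu n => φ w.2 * v (w.2 + r • w.1) - φ w.2 * v w.2)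
        ((volume.restrict (UBall n)).prod (volume.restrict T)) := hi1.sub hi0
    rw [integral_prod_symm _ hi]
    refine integral_nonneg fun x => ?_
    simp only [Pi.zero_apply, ← mul_sub]
    rw [integral_const_mul]
    by_cases hx : φ x = 0
    · simp [hx]
    refine mul_nonneg (hφ0 x) ?_
    have h2 := hsub.le_ball_average R hv hK hr (hY x hx)
    rw [integral_sub (f := fun z => v (x + r • z)) (integrableOn_ball_of_bound
      (hv.comp (g := fun z => x + r • z) (by fun_prop)).measurable fun z => hK _)
      (integrable_const _), setIntegral_const, smul_eq_mul]
    rw [setAverage_eq, smul_eq_mul, inv_mul_eq_div, le_div_iff₀ volume_ball_pos] at h2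
    linarith
  have hshift : ∀ z ∈ UBall n, ∫ x in T, φ x * v (x + r • z) = ∫ x in T, φ (x - r • z) * v x := by
    intro z hz
    have hrz : ‖r • z‖ ≤ 1 := by
      rw [mem_closedBall_zero_iff] at hz
      rw [norm_smul, Real.norm_eq_abs, abs_of_pos hr]
      nlinarith [norm_nonneg z]
    rw [setIntegral_eq_integral_of_forall_compl_eq_zero,
      setIntegral_eq_integral_of_forall_compl_eq_zero]
    · have := integral_add_right_eq_self (μ := volume) (fun x => φ (x - r • z) * v x) (r • z)
      simpa using this
    · intro x hx
      by_contra hne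
      have h3 := hA _ (left_ne_zero_of_mul hne)
      refine hx ?_
      rw [mem_closedBall_zero_iff]
      have h4 := norm_add_le (x - r • z) (r • z)
      rw [sub_add_cancel] at h4
      linarith
    · intro x hx
      by_contra hne
      have h3 := hA _ (left_ne_zero_of_mul hne)
      exact hx (by rw [mem_closedBall_zero_iff]; linarith)
  let G : Eu n → ℝ := fun z => ∫ x in T, φ (x - r • z) * v x
  have hG1 : ∫ w : Eu n × Eu n, φ w.2 * v (w.2 + r • w.1)
      ∂((volume.restrict (UBall n)).prod (volume.restrict T)) = ∫ z in UBall n, G z := by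
    rw [integral_prod _ hi1]
    exact setIntegral_congr_fun Metric.isClosed_closedBall.measurableSet hshift
  have hG2 : ∫ w : Eu n × Eu n, φ (w.2 + (-r) • w.1) * v w.2
      ∂((volume.restrict (UBall n)).prod (volume.restrict T)) = ∫ z in UBall n, G z := by
    rw [integral_prod _ (hi2 (-r))]
    simp only [neg_smul, ← sub_eq_add_neg, G]
  have hG3 : ∫ w : Eu n × Eu n, φ (w.2 + r • w.1) * v w.2
      ∂((volume.restrict (UBall n)).prod (volume.restrict T)) = ∫ z in UBall n, G z := by
    rw [integral_prod _ (hi2 r)]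
    have h := average_ball_neg G
    rw [setAverage_eq, setAverage_eq, smul_eq_mul, smul_eq_mul] at h
    have h' := mul_left_cancel₀ (inv_ne_zero (volume_ball_pos (n := n)).ne') h
    rw [← h']
    simp only [smul_neg, sub_neg_eq_add, G]
  rw [integral_sub hi1 hi0, hG1] at h1
  have h5 : ∀ w : Eu n × Eu n, v w.2 * (φ (w.2 + r • w.1) + φ (w.2 - r • w.1) - 2 * φ w.2) =
      (φ (w.2 + r • w.1) * v w.2 + φ (w.2 + (-r) • w.1) * v w.2) - 2 * (φ w.2 * v w.2) := fun w => by
    rw [neg_smul, ← sub_eq_add_neg]; ring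
  simp only [h5]
  have hi3 : Integrable (fun w : Eu n × Eu n => φ (w.2 + r • w.1) * v w.2 +
      φ (w.2 + (-r) • w.1) * v w.2) ((volume.restrict (UBall n)).prod (volume.restrict T)) :=
    (hi2 r).add (hi2 (-r))
  rw [integral_sub hi3 (hi0.const_mul 2), integral_add (hi2 r) (hi2 (-r)),
    hG2, hG3, integral_const_mul]
  linarith

/-- Divide the previous inequality by `r²` and let `r → 0`, the uniform bound on second differences
giving domination. Integrated over `z` in the unit ball, the quadratic form `D²φ(z, z)` becomes a
positive multiple of the Laplacian. -/
theorem TraceSub.integral_trace_hessian_nonneg [NeZero n] {F : Set (Matrix (Fin n) (Fin n) ℝ)}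
    (R : RotationFamily F) {v : Eu n → ℝ} {Y : Set (Eu n)} (hYo : IsOpen Y) (hsub : TraceSub v Y)
    (hv : UpperSemicontinuous v) {K : ℝ} (hK : ∀ x, |v x| ≤ K) {φ : Eu n → ℝ}
    (hφ : ContDiff ℝ 2 φ) (hφc : HasCompactSupport φ) (hφY : tsupport φ ⊆ Y)
    (hφ0 : ∀ x, 0 ≤ φ x) : 0 ≤ ∫ x, v x * (hessian φ x).trace := by
  obtain ⟨L, hL⟩ := hφc.exists_bound_of_continuous hφ.continuous
  obtain ⟨A, hA⟩ := hφc.isBounded.exists_norm_le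
  obtain ⟨δ, hδ, hδY⟩ := hφc.exists_cthickening_subset_open hYo hφY
  obtain ⟨C, hC⟩ := second_difference_le hφ hφc
  have hC0 : 0 ≤ C := by
    obtain ⟨w⟩ : Nonempty (USphere n) := inferInstance
    have := (abs_nonneg _).trans (hC 0 (w : Eu n))
    simpa using this
  have hK0 : 0 ≤ K := (abs_nonneg _).trans (hK 0)
  have hA' : ∀ x, φ x ≠ 0 → ‖x‖ ≤ A := fun x hx => hA x (subset_tsupport φ hx)
  set T : Set (Eu n) := Metric.closedBall 0 (A + 1) with hT
  set P := (volume.restrict (UBall n)).prod ((volume : Measure (Eu n)).restrict T) with hP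
  have hfin : IsFiniteMeasure ((volume : Measure (Eu n)).restrict T) :=
    ⟨by rw [Measure.restrict_apply_univ]; exact measure_closedBall_lt_top⟩
  have hvm := hv.measurable
  have hφm := hφ.continuous.measurable
  have hlim : Tendsto (fun r : ℝ => ∫ w, v w.2 * ((r ^ 2)⁻¹ *
      (φ (w.2 + r • w.1) + φ (w.2 - r • w.1) - 2 * φ w.2)) ∂P) (𝓝[>] 0)
      (𝓝 (∫ w, v w.2 * d2 φ w.2 w.1 w.1 ∂P)) := by
    refine tendsto_integral_filter_of_dominated_convergence (fun _ => K * C) ?_ ?_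
      (integrable_const _) ?_
    · refine Eventually.of_forall fun r => Measurable.aestronglyMeasurable ?_
      exact (hvm.comp measurable_snd).mul (measurable_const.mul (((hφm.comp (by fun_prop)).add
        (hφm.comp (by fun_prop))).sub (measurable_const.mul (hφm.comp measurable_snd))))
    · filter_upwards [self_mem_nhdsWithin] with r hr
      have hr' : (0 : ℝ) < r := hr
      have hmem : ∀ᵐ w ∂P, w.1 ∈ UBall n := by
        refine Measure.quasiMeasurePreserving_fst.ae ?_
        exact ae_restrict_mem Metric.isClosed_closedBall.measurableSet
      filter_upwards [hmem] with w hw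
      rw [mem_closedBall_zero_iff] at hw
      rw [norm_mul, Real.norm_eq_abs, Real.norm_eq_abs, abs_mul,
        abs_of_pos (show 0 < (r ^ 2)⁻¹ by positivity)]
      refine mul_le_mul (hK _) ?_ (by positivity) hK0
      rw [inv_mul_le_iff₀ (by positivity)]
      refine (hC w.2 (r • w.1)).trans ?_
      rw [norm_smul, mul_pow, Real.norm_eq_abs, sq_abs]
      have h1 : ‖w.1‖ ^ 2 ≤ 1 := pow_le_one₀ (norm_nonneg _) hw
      have h2 : 0 ≤ C * r ^ 2 := by positivity
      nlinarith
    · exact Eventually.of_forall fun w =>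
        (tendsto_second_difference hφ.contDiffAt w.1).const_mul (v w.2)
  have h0 : 0 ≤ ∫ w, v w.2 * d2 φ w.2 w.1 w.1 ∂P := by
    refine ge_of_tendsto hlim ?_
    filter_upwards [Ioo_mem_nhdsGT (lt_min hδ one_pos)] with r hr
    have h1 := integral_second_difference_nonneg R hsub hv hK hφ.continuous hφ0 hL hr.1
      (hr.2.le.trans (min_le_right _ _)) hA' fun x hx z hz => hδY (by
        refine Metric.mem_cthickening_of_dist_le _ x _ _ (subset_tsupport φ hx) ?_
        rw [mem_closedBall_zero_iff] at hz
        rw [dist_eq_norm, add_sub_cancel_left, norm_smul, Real.norm_eq_abs, abs_of_pos hr.1]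
        have := hr.2.le.trans (min_le_left _ _)
        nlinarith [hr.1, norm_nonneg z])
    simp only [mul_left_comm (v _) ((r ^ 2)⁻¹)]
    rw [integral_const_mul]
    exact mul_nonneg (by positivity) h1
  have hz : ∀ i j, Integrable (fun z : Eu n => z i * z j) (volume.restrict (UBall n)) :=
    fun i j => Continuous.integrableOn_ball (by fun_prop)
  have hx : ∀ i j, Integrable (fun x : Eu n => v x * hessian φ x i j) (volume.restrict T) := by
    intro i j
    have h1 : IntegrableOn (fun x => hessian φ x i j) T :=
      (continuous_hessian hφ i j).continuousOn.integrableOn_compact (isCompact_closedBall _ _)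
    exact h1.bdd_mul hvm.aestronglyMeasurable (Eventually.of_forall hK)
  have h1 : ∫ w, v w.2 * d2 φ w.2 w.1 w.1 ∂P = ∑ i, ∑ j, (∫ z in UBall n, z i * z j) *
      ∫ x in T, v x * hessian φ x i j := by
    have h2 : ∀ w : Eu n × Eu n, v w.2 * d2 φ w.2 w.1 w.1 =
        ∑ i, ∑ j, (w.1 i * w.1 j) * (v w.2 * hessian φ w.2 i j) := fun w => by
      rw [d2_apply, Finset.mul_sum]
      refine Finset.sum_congr rfl fun i _ => ?_
      rw [Finset.mul_sum]
      exact Finset.sum_congr rfl fun j _ => by ring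
    simp only [h2]
    have h3 : ∀ i j, Integrable (fun w : Eu n × Eu n => (w.1 i * w.1 j) *
        (v w.2 * hessian φ w.2 i j)) P := fun i j => (hz i j).mul_prod (hx i j)
    rw [integral_finsetSum _ fun i _ => integrable_finsetSum _ fun j _ => h3 i j]
    refine Finset.sum_congr rfl fun i _ => ?_
    rw [integral_finsetSum _ fun j _ => h3 i j]
    refine Finset.sum_congr rfl fun j _ => ?_
    exact integral_prod_mul (fun z : Eu n => z i * z j) fun x => v x * hessian φ x i j
  have hmom : ∀ i j : Fin n, ∫ z in UBall n, z i * z j =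
      volume.real (UBall n) * if i = j then secondMoment n else 0 := fun i j => by
    rw [← average_coord_mul, setAverage_eq, smul_eq_mul, mul_inv_cancel_left₀ volume_ball_pos.ne']
  have h2 : ∫ w, v w.2 * d2 φ w.2 w.1 w.1 ∂P =
      volume.real (UBall n) * secondMoment n * ∫ x in T, v x * (hessian φ x).trace := by
    rw [h1]
    simp only [hmom, mul_ite, mul_zero, ite_mul, zero_mul, Finset.sum_ite_eq, Finset.mem_univ,
      if_true]
    rw [← Finset.mul_sum, ← integral_finsetSum _ fun i _ => hx i i]
    simp only [Matrix.trace, Matrix.diag, Finset.mul_sum]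
  have h3 : ∫ x in T, v x * (hessian φ x).trace = ∫ x, v x * (hessian φ x).trace := by
    refine setIntegral_eq_integral_of_forall_compl_eq_zero fun x hx => ?_
    rw [hessian_eq_zero_of_notMem_tsupport fun hxt => hx ?_]
    · simp
    · rw [hT, mem_closedBall_zero_iff]
      linarith [hA x hxt]
  rw [h2, h3] at h0
  exact nonneg_of_mul_nonneg_right h0 (mul_pos volume_ball_pos secondMoment_pos)

section

open scoped CompactlySupported

/-! ### The Riesz measure -/

section measure

variable {F : Set (Matrix (Fin n) (Fin n) ℝ)} {p : ℝ} {u : Eu n → EReal} {X : Set (Eu n)}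

theorem abs_trunc_le_of_ne_bot {S : Set (Eu n)} (hu : IsSubharmonicOn F u X) (hSX : S ⊆ X) {B : ℝ}
    (hB0 : 0 ≤ B) (hB : ∀ x ∈ S, u x ≤ B) (N : ℕ) {x : Eu n} (hx : x ∈ S) (hbot : u x ≠ ⊥) :
    |trunc u S N x| ≤ |(u x).toReal| + B := by
  have h1 : ((u x).toReal : EReal) ≤ trunc u S N x := by
    rw [EReal.coe_toReal (hu.ne_top x (hSX hx)) hbot, coe_trunc hu hSX hx]
    exact le_max_left _ _
  have h2 : (u x).toReal ≤ trunc u S N x := by exact_mod_cast h1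
  have h3 := trunc_le hu hSX hB0 hB N x
  rw [abs_le]
  constructor <;> linarith [neg_abs_le (u x).toReal, abs_nonneg (u x).toReal]

theorem eventually_trunc_eq {S : Set (Eu n)} (hu : IsSubharmonicOn F u X) (hSX : S ⊆ X) {x : Eu n}
    (hx : x ∈ S) (hbot : u x ≠ ⊥) : ∀ᶠ N in atTop, trunc u S N x = (u x).toReal := by
  have hcoe := EReal.coe_toReal (hu.ne_top x (hSX hx)) hbot
  obtain ⟨M, hM⟩ := exists_nat_gt (-(u x).toReal)
  filter_upwards [eventually_ge_atTop M] with N hN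
  have h1 : -(N : ℝ) ≤ (u x).toReal := by
    have : (M : ℝ) ≤ N := by exact_mod_cast hN
    linarith
  have h2 := coe_trunc hu hSX hx N
  rw [← hcoe, max_eq_left (by exact_mod_cast h1)] at h2
  exact_mod_cast h2

theorem integrable_mul_of_support (hloc : IsLocallyIntegrableOn u X) {S : Set (Eu n)}
    (hS : IsCompact S) (hSX : S ⊆ X) {g : Eu n → ℝ} (hg : Continuous g)
    (hgS : ∀ x ∉ S, g x = 0) : Integrable fun x => (u x).toReal * g x := by
  obtain ⟨L, hL⟩ := hS.exists_bound_of_continuousOn hg.continuousOn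
  have h1 : IntegrableOn (fun x => (u x).toReal * g x) S :=
    (hloc.2.integrableOn_compact_subset hSX hS).mul_bdd hg.aestronglyMeasurable
      ((ae_restrict_mem hS.measurableSet).mono hL)
  exact (integrableOn_iff_integrable_of_support_subset fun x hx => by
    by_contra hxS
    exact hx (by simp [hgS x hxS])).1 h1

theorem trace_hessian_eq_zero_of_notMem {φ : Eu n → ℝ} {x : Eu n} (hx : x ∉ tsupport φ) :
    (hessian φ x).trace = 0 := by
  rw [hessian_eq_zero_of_notMem_tsupport hx, Matrix.trace_zero]

/-- Passage from the truncations to `u`, dominated by `(|u| + B)|Δφ|`. -/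
theorem integral_mul_trace_hessian_nonneg (hF : Admissible F p) (R : RotationFamily F)
    (hu : IsSubharmonicOn F u X) (hX : IsOpen X) (hloc : IsLocallyIntegrableOn u X)
    {φ : Eu n → ℝ} (hφ : ContDiff ℝ 2 φ) (hφc : HasCompactSupport φ) (hφX : tsupport φ ⊆ X)
    (hφ0 : ∀ x, 0 ≤ φ x) : 0 ≤ ∫ x, (u x).toReal * (hessian φ x).trace := by
  have := hF.ne_zero
  obtain ⟨δ, hδ, hδX⟩ := hφc.exists_cthickening_subset_open hX hφX
  set S := Metric.cthickening δ (tsupport φ)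
  have hS : IsCompact S := IsCompact.cthickening hφc
  obtain ⟨B, hB0, hB⟩ := exists_upper_bound hu hδX hS
  have hsub : tsupport φ ⊆ interior S :=
    (Metric.self_subset_thickening hδ _).trans (interior_maximal
      (Metric.thickening_subset_cthickening _ _) Metric.isOpen_thickening)
  have hN : ∀ N : ℕ, 0 ≤ ∫ x, trunc u S N x * (hessian φ x).trace := fun N =>
    ((fsub_trunc hF hu hδX N).traceSub hF).integral_trace_hessian_nonneg R isOpen_interior
      (upperSemicontinuous_trunc hu hX hδX hS.isClosed N) (abs_trunc_le hu hδX hB0 hB N)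
      hφ hφc hsub hφ0
  have hcont := continuous_trace_hessian hφ
  have hz : ∀ x ∉ S, (hessian φ x).trace = 0 := fun x hx =>
    trace_hessian_eq_zero_of_notMem fun h => hx (interior_subset (hsub h))
  have hi1 := integrable_mul_of_support hloc hS hδX hcont hz
  have hi2 : Integrable fun x => (hessian φ x).trace :=
    hcont.integrable_of_hasCompactSupport (HasCompactSupport.intro hS hz)
  have hbot : ∀ᵐ x, x ∈ S → u x ≠ ⊥ := by
    rw [← ae_restrict_iff' hS.measurableSet]
    exact ae_restrict_of_ae_restrict_of_subset hδX (hloc.1.mono fun x hx => hx.1)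
  refine ge_of_tendsto (tendsto_integral_of_dominated_convergence
    (fun x => |(u x).toReal * (hessian φ x).trace| + B * |(hessian φ x).trace|) (fun N => ?_)
    (hi1.abs.add (hi2.abs.const_mul B)) (fun N => ?_) ?_) (Eventually.of_forall hN)
  · exact (upperSemicontinuous_trunc hu hX hδX hS.isClosed N).measurable.aestronglyMeasurable.mul
      hcont.aestronglyMeasurable
  · filter_upwards [hbot] with x hx
    by_cases hxS : x ∈ S
    · rw [norm_mul, Real.norm_eq_abs, Real.norm_eq_abs, abs_mul, ← add_mul]
      exact mul_le_mul_of_nonneg_right (abs_trunc_le_of_ne_bot hu hδX hB0 hB N hxS (hx hxS))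
        (abs_nonneg _)
    · simp [hz x hxS]
  · filter_upwards [hbot] with x hx
    by_cases hxS : x ∈ S
    · refine tendsto_const_nhds.congr' ?_
      filter_upwards [eventually_trunc_eq hu hδX hxS (hx hxS)] with N hN
      rw [hN]
    · simp [hz x hxS]

/-- The extension by `0` of a compactly supported function on `X`. -/
def extendZero (f : C_c(X, ℝ)) : Eu n → ℝ := Function.extend Subtype.val f 0

theorem extendZero_coe (f : C_c(X, ℝ)) (x : X) : extendZero f x = f x :=
  Subtype.val_injective.extend_apply _ _ _

theorem extendZero_of_notMem (f : C_c(X, ℝ)) {x : Eu n} (hx : x ∉ X) : extendZero f x = 0 :=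
  Function.extend_apply' _ _ _ fun ⟨y, hy⟩ => hx (hy ▸ y.2)

theorem extendZero_add (f g : C_c(X, ℝ)) :
    extendZero (f + g) = fun x => extendZero f x + extendZero g x := by
  ext x
  by_cases hx : x ∈ X
  · simpa using extendZero_coe (f + g) ⟨x, hx⟩ |>.trans (congrArg₂ (· + ·)
      (extendZero_coe f ⟨x, hx⟩).symm (extendZero_coe g ⟨x, hx⟩).symm)
  · simp [extendZero_of_notMem _ hx]

theorem extendZero_smul (c : ℝ) (f : C_c(X, ℝ)) :
    extendZero (c • f) = fun x => c * extendZero f x := by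
  ext x
  by_cases hx : x ∈ X
  · have h1 := extendZero_coe (c • f) ⟨x, hx⟩
    have h2 := extendZero_coe f ⟨x, hx⟩
    simp only at h1 h2
    rw [h1, h2]; simp
  · simp [extendZero_of_notMem _ hx]

theorem tsupport_extendZero_subset (f : C_c(X, ℝ)) :
    tsupport (extendZero f) ⊆ Subtype.val '' (tsupport f) ∧
      HasCompactSupport (extendZero f) := by
  have hK : IsCompact (Subtype.val '' (tsupport f) : Set (Eu n)) :=
    f.hasCompactSupport.isCompact.image continuous_subtype_val
  have hz : ∀ x ∉ (Subtype.val '' (tsupport f) : Set (Eu n)), extendZero f x = 0 := fun x hx => by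
    by_cases hxX : x ∈ X
    · have h1 := extendZero_coe f ⟨x, hxX⟩
      simp only at h1
      rw [h1]
      exact image_eq_zero_of_notMem_tsupport fun h => hx ⟨_, h, rfl⟩
    · exact extendZero_of_notMem f hxX
  refine ⟨closure_minimal (fun x hx => ?_) hK.isClosed, .intro hK hz⟩
  by_contra hxK
  exact hx (hz x hxK)

theorem tsupport_extendZero (f : C_c(X, ℝ)) : tsupport (extendZero f) ⊆ X :=
  (tsupport_extendZero_subset f).1.trans (by rintro _ ⟨y, -, rfl⟩; exact y.2)

theorem hessian_const_mul {φ : Eu n → ℝ} {x : Eu n} (h : ContDiffAt ℝ 2 φ x) (c : ℝ) :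
    hessian (fun y => c * φ y) x = c • hessian φ x := by
  ext i j
  have h1 : iteratedFDeriv ℝ 2 (fun y => c * φ y) x = c • iteratedFDeriv ℝ 2 φ x :=
    iteratedFDeriv_const_smul_apply (a := c) h
  simp [hessian, h1]

/-- The compactly supported functions on `X` whose extensions are smooth. -/
def smoothSubmodule (X : Set (Eu n)) : Submodule ℝ C_c(X, ℝ) where
  carrier := {f | ContDiff ℝ ∞ (extendZero f)}
  add_mem' {f g} hf hg := by
    change ContDiff ℝ ∞ (extendZero (f + g))
    rw [extendZero_add]; exact ContDiff.add hf hg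
  zero_mem' := by
    change ContDiff ℝ ∞ (extendZero (0 : C_c(X, ℝ)))
    have : extendZero (0 : C_c(X, ℝ)) = fun _ => 0 := by
      have := extendZero_smul 0 (0 : C_c(X, ℝ))
      simpa using this
    rw [this]; exact contDiff_const
  smul_mem' c f hf := by
    change ContDiff ℝ ∞ (extendZero (c • f))
    rw [extendZero_smul]; exact ContDiff.mul contDiff_const hf

theorem integrable_mul_laplacian (hloc : IsLocallyIntegrableOn u X) {φ : Eu n → ℝ}
    (hφ : ContDiff ℝ ∞ φ) (hφc : HasCompactSupport φ) (hφX : tsupport φ ⊆ X) :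
    Integrable fun x => (u x).toReal * (hessian φ x).trace :=
  integrable_mul_of_support hloc hφc hφX (continuous_trace_hessian (hφ.of_le two_le_infty))
    fun _ hx => trace_hessian_eq_zero_of_notMem hx

/-- The distribution `Δu`. -/
def laplacianFunctional (hloc : IsLocallyIntegrableOn u X) : C_c(X, ℝ) →ₗ.[ℝ] ℝ where
  domain := smoothSubmodule X
  toFun :=
    { toFun := fun f => ∫ x, (u x).toReal * (hessian (extendZero f.1) x).trace
      map_add' := fun f g => by
        have hi : ∀ f : smoothSubmodule X,
            Integrable fun x => (u x).toReal * (hessian (extendZero f.1) x).trace := fun f =>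
          integrable_mul_laplacian hloc f.2 (tsupport_extendZero_subset f.1).2
            (tsupport_extendZero f.1)
        rw [← integral_add (hi f) (hi g)]
        congr 1
        ext x
        have hf : ContDiff ℝ ∞ (extendZero f.1) := f.2
        have hg : ContDiff ℝ ∞ (extendZero g.1) := g.2
        rw [Submodule.coe_add, extendZero_add, hessian_add (hf.of_le two_le_infty).contDiffAt
          (hg.of_le two_le_infty).contDiffAt, Matrix.trace_add]
        ring
      map_smul' := fun c f => by
        rw [RingHom.id_apply, smul_eq_mul, ← integral_const_mul]
        congr 1
        ext x
        have hf : ContDiff ℝ ∞ (extendZero f.1) := f.2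
        rw [Submodule.coe_smul, extendZero_smul,
          hessian_const_mul (hf.of_le two_le_infty).contDiffAt, Matrix.trace_smul, smul_eq_mul]
        ring }

theorem isCompact_preimage_val {K : Set (Eu n)} (hK : IsCompact K) (hKX : K ⊆ X) :
    IsCompact (Subtype.val ⁻¹' K : Set X) := by
  rw [Subtype.isCompact_iff, Subtype.image_preimage_coe, inter_eq_self_of_subset_right hKX]
  exact hK

/-- The restriction to `X` of a function with compact support in `X`. -/
def restrictC {φ : Eu n → ℝ} (hφ : Continuous φ) (hφc : HasCompactSupport φ)
    (hφX : tsupport φ ⊆ X) : C_c(X, ℝ) where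
  toFun x := φ x
  continuous_toFun := hφ.comp continuous_subtype_val
  hasCompactSupport' := by
    refine HasCompactSupport.intro
      (isCompact_preimage_val hφc hφX) fun x hx => ?_
    exact image_eq_zero_of_notMem_tsupport hx

theorem extendZero_restrictC {φ : Eu n → ℝ} (hφ : Continuous φ) (hφc : HasCompactSupport φ)
    (hφX : tsupport φ ⊆ X) : extendZero (restrictC hφ hφc hφX) = φ := by
  ext x
  by_cases hx : x ∈ X
  · exact extendZero_coe (restrictC hφ hφc hφX) ⟨x, hx⟩
  · rw [extendZero_of_notMem _ hx, image_eq_zero_of_notMem_tsupport fun h => hx (hφX h)]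

/-- The cone of the nonnegative functions. -/
def nonnegCone (X : Set (Eu n)) : PointedCone ℝ C_c(X, ℝ) where
  carrier := {f | ∀ x, 0 ≤ f x}
  add_mem' hf hg x := by simpa using add_nonneg (hf x) (hg x)
  zero_mem' x := by simp
  smul_mem' c f hf x := mul_nonneg c.2 (hf x)

open Manifold in
theorem exists_cutoff (hX : IsOpen X) {K : Set (Eu n)} (hK : IsCompact K) (hKX : K ⊆ X) :
    ∃ χ : Eu n → ℝ, ContDiff ℝ ∞ χ ∧ HasCompactSupport χ ∧ tsupport χ ⊆ X ∧ (∀ x, 0 ≤ χ x) ∧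
      ∀ x ∈ K, χ x = 1 := by
  obtain ⟨δ, hδ, hδX⟩ := hK.exists_cthickening_subset_open hX hKX
  obtain ⟨χ, hχ, hrange, hsupp, hone⟩ := exists_contMDiff_support_eq_eq_one_iff 𝓘(ℝ, Eu n)
    (n := ⊤) Metric.isOpen_thickening hK.isClosed (Metric.self_subset_thickening hδ K)
  have hts : tsupport χ ⊆ Metric.cthickening δ K := by
    rw [tsupport, hsupp]; exact Metric.closure_thickening_subset_cthickening _ _
  refine ⟨χ, contMDiff_iff_contDiff.1 hχ,
    (IsCompact.cthickening hK).of_isClosed_subset (isClosed_tsupport χ) hts,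
    hts.trans hδX, fun x => (hrange ⟨x, rfl⟩).1, fun x hx => (hone x).1 hx⟩

/-- A positive distribution is a measure. The M. Riesz extension theorem extends the functional
positively from the smooth functions to all of `C_c(X)`, and the Riesz–Markov theorem on the locally
compact space `X` represents it; the measure is pushed forward to the ambient space. -/
theorem exists_isLaplacianOn (hF : Admissible F p) (R : RotationFamily F)
    (hu : IsSubharmonicOn F u X) (hX : IsOpen X) (hloc : IsLocallyIntegrableOn u X) :
    ∃ μ : Measure (Eu n), IsLaplacianOn u X μ := by
  have hlc : LocallyCompactSpace X := hX.locallyCompactSpace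
  obtain ⟨g, hg, hg0⟩ := riesz_extension (nonnegCone X) (laplacianFunctional hloc) (by
    intro f hf
    have hfs : ContDiff ℝ ∞ (extendZero f.1) := f.2
    refine integral_mul_trace_hessian_nonneg hF R hu hX hloc (hfs.of_le two_le_infty)
      (tsupport_extendZero_subset f.1).2 (tsupport_extendZero f.1) fun x => ?_
    by_cases hx : x ∈ X
    · have h1 := extendZero_coe f.1 ⟨x, hx⟩
      simp only at h1
      rw [h1]; exact hf _
    · rw [extendZero_of_notMem _ hx]) (by
    intro y
    obtain ⟨L, hL⟩ := y.hasCompactSupport.exists_bound_of_continuous y.continuous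
    obtain ⟨χ, hχ, hχc, hχX, hχ0, hχ1⟩ := exists_cutoff hX
      (y.hasCompactSupport.isCompact.image continuous_subtype_val)
      (by rintro _ ⟨z, -, rfl⟩; exact z.2)
    have hmem : restrictC hχ.continuous hχc hχX ∈ smoothSubmodule X := by
      change ContDiff ℝ ∞ (extendZero _)
      rwa [extendZero_restrictC]
    -- The extension theorem needs, for each `y`, a smooth function whose sum with `y` is
    -- nonnegative: a bound of `|y|` times a cut-off equal to `1` on the support.
    refine ⟨⟨max L 0 • restrictC hχ.continuous hχc hχX, Submodule.smul_mem _ _ hmem⟩, fun x => ?_⟩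
    change 0 ≤ max L 0 * χ x + y x
    by_cases hx : x ∈ tsupport y
    · rw [hχ1 x ⟨x, hx, rfl⟩, mul_one]
      have h1 := neg_abs_le (y x)
      have h2 : |y x| ≤ L := hL x
      linarith [le_max_left L 0]
    · rw [image_eq_zero_of_notMem_tsupport hx, add_zero]
      exact mul_nonneg (le_max_right _ _) (hχ0 _))
  let Λ : C_c(X, ℝ) →ₚ[ℝ] ℝ := PositiveLinearMap.mk₀ g fun f hf => hg0 f hf
  let μ := RealRMK.rieszMeasure Λ
  refine ⟨μ.map Subtype.val, ⟨fun K hK hKX => ?_, fun φ hφ hφc hφX => ?_⟩⟩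
  · rw [(MeasurableEmbedding.subtype_coe hX.measurableSet).map_apply]
    exact (isCompact_preimage_val hK hKX).measure_lt_top
  · rw [(MeasurableEmbedding.subtype_coe hX.measurableSet).integral_map]
    have h1 := RealRMK.integral_rieszMeasure Λ (restrictC hφ.continuous hφc hφX)
    have hmem : restrictC hφ.continuous hφc hφX ∈ smoothSubmodule X := by
      change ContDiff ℝ ∞ (extendZero _)
      rwa [extendZero_restrictC]
    have h2 : g (restrictC hφ.continuous hφc hφX) =
        ∫ x, (u x).toReal * (hessian (extendZero (restrictC hφ.continuous hφc hφX)) x).trace :=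
      hg ⟨_, hmem⟩
    rw [extendZero_restrictC] at h2
    simp only [laplacian_eq_trace_hessian]
    rw [← h2]
    exact h1.symm

end measure

end

section

/-! ### Densities -/

/-- The slopes of `ψ` with respect to `K_p` decrease to `Θ` at `0`. -/
def HasSlopeAtZero (p : ℝ) (ψ : ℝ → ℝ) (Θ : ℝ) : Prop :=
  0 ≤ Θ ∧ ∀ ε > 0, ∃ δ > 0, ∀ s r, 0 < s → s < r → r < δ →
    Θ * (rieszKernel p r - rieszKernel p s) ≤ ψ r - ψ s ∧
      ψ r - ψ s ≤ (Θ + ε) * (rieszKernel p r - rieszKernel p s)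

/-- `Θ` is the infimum of all slopes. If the slope on `[s₀, r₀]` is below `Θ + ε`, convexity puts
every slope on an interval to the left of `s₀` below it as well. -/
theorem KernelConvex.exists_hasSlopeAtZero {p ρ : ℝ} {ψ : ℝ → ℝ} (h : KernelConvex p ψ ρ)
    (hρ : 0 < ρ) : ∃ Θ, HasSlopeAtZero p ψ Θ := by
  let σ : ℝ → ℝ → ℝ := fun s r => (ψ r - ψ s) / (rieszKernel p r - rieszKernel p s)
  have hK : ∀ {s r : ℝ}, 0 < s → s < r → 0 < rieszKernel p r - rieszKernel p s :=
    fun hs hsr => sub_pos.2 (rieszKernel_lt p hs hsr)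
  have hσ : ∀ s t r, 0 < s → s < t → t < r → r < ρ → σ s t ≤ σ t r := fun s t r hs hst htr hr => by
    rw [div_le_div_iff₀ (hK hs hst) (hK (hs.trans hst) htr)]
    exact (h s t r hs hst htr hr).2
  let A : Set ℝ := {x | ∃ s r, 0 < s ∧ s < r ∧ r < ρ ∧ σ s r = x}
  have hA0 : ∀ x ∈ A, 0 ≤ x := by
    rintro _ ⟨s, r, hs, hsr, hr, rfl⟩
    exact div_nonneg (sub_nonneg.2 (h.monotoneOn hs hsr.le hr)) (hK hs hsr).le
  have hne : A.Nonempty := ⟨_, ρ / 4, ρ / 2, by positivity, by linarith, by linarith, rfl⟩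
  refine ⟨sInf A, le_csInf hne hA0, fun ε hε => ?_⟩
  obtain ⟨_, ⟨s₀, r₀, hs₀, hsr₀, hr₀, rfl⟩, hlt⟩ :=
    exists_lt_of_csInf_lt hne (show sInf A < sInf A + ε by linarith)
  refine ⟨s₀, hs₀, fun s r hs hsr hr => ⟨?_, ?_⟩⟩
  · rw [← le_div_iff₀ (hK hs hsr)]
    exact csInf_le ⟨0, hA0⟩ ⟨s, r, hs, hsr, hr.trans (hsr₀.trans hr₀), rfl⟩
  · rw [← div_le_iff₀ (hK hs hsr)]
    exact ((hσ s r s₀ hs hsr hr (hsr₀.trans hr₀)).trans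
      (hσ r s₀ r₀ (hs.trans hsr) hr hsr₀ hr₀)).trans hlt.le

theorem HasSlopeAtZero.hasRieszDensity {p Θ : ℝ} {ψ : ℝ → ℝ} (h : HasSlopeAtZero p ψ Θ) :
    HasRieszDensity p ψ Θ := by
  rw [HasRieszDensity, Metric.tendsto_nhdsWithin_nhds]
  intro ε hε
  obtain ⟨δ, hδ, h1⟩ := h.2 (ε / 2) (by positivity)
  refine ⟨δ, hδ, fun {q} hq hqd => ?_⟩
  have hq2 : q.2 < δ := by
    have h2 : dist q.2 0 < δ := (le_max_right _ _).trans_lt hqd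
    rw [Real.dist_eq, sub_zero] at h2
    exact (le_abs_self _).trans_lt h2
  obtain ⟨h3, h4⟩ := h1 q.1 q.2 hq.1 hq.2 hq2
  have hK := sub_pos.2 (rieszKernel_lt p hq.1 hq.2)
  rw [← le_div_iff₀ hK] at h3
  rw [← div_le_iff₀ hK] at h4
  rw [Real.dist_eq, abs_lt]
  constructor <;> linarith

/-! ### Scaling of the Riesz kernel and its behaviour at the origin -/

theorem rieszKernel_mul {p : ℝ} (hp : p ≠ 2) {l r : ℝ} (hl : 0 < l) (hr : 0 < r) :
    rieszKernel p (l * r) = l ^ (2 - p) * rieszKernel p r := by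
  unfold rieszKernel
  split_ifs with h1
  · rw [Real.mul_rpow hl.le hr.le]
  · rw [Real.mul_rpow hl.le hr.le, show 2 - p = -(p - 2) by ring, Real.rpow_neg hl.le]
    have := (Real.rpow_pos_of_pos hl (p - 2)).ne'
    have := (Real.rpow_pos_of_pos hr (p - 2)).ne'
    field_simp

theorem rieszKernel_two : rieszKernel 2 = Real.log := by ext; simp [rieszKernel]

theorem rieszKernel_mul_sub (p : ℝ) {l r s : ℝ} (hl : 0 < l) (hr : 0 < r) (hs : 0 < s) :
    rieszKernel p (l * r) - rieszKernel p (l * s) =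
      l ^ (2 - p) * (rieszKernel p r - rieszKernel p s) := by
  rcases eq_or_ne p 2 with rfl | hp
  · rw [rieszKernel_two, Real.log_mul hl.ne' hr.ne', Real.log_mul hl.ne' hs.ne']
    simp
  · rw [rieszKernel_mul hp hl hr, rieszKernel_mul hp hl hs, mul_sub]

theorem tendsto_rieszKernel_atBot {p : ℝ} (hp : 2 ≤ p) :
    Tendsto (rieszKernel p) (𝓝[>] 0) atBot := by
  rcases hp.eq_or_lt with rfl | hp
  · rw [rieszKernel_two]; exact Real.tendsto_log_nhdsGT_zero
  · have h1 : Tendsto (fun t : ℝ => t ^ (p - 2)) (𝓝[>] 0) (𝓝[>] 0) := by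
      refine tendsto_nhdsWithin_iff.2 ⟨?_, ?_⟩
      · have := (Real.continuousAt_rpow_const 0 (p - 2) (Or.inr (by linarith))).tendsto
        rw [Real.zero_rpow (by linarith)] at this
        exact this.mono_left nhdsWithin_le_nhds
      · filter_upwards [self_mem_nhdsWithin] with t ht using Real.rpow_pos_of_pos ht _
    have h2 := tendsto_neg_atTop_atBot.comp (tendsto_inv_nhdsGT_zero.comp h1)
    refine h2.congr fun t => ?_
    simp [rieszKernel, not_lt.2 hp.le, hp.ne']

theorem tendsto_rieszKernel_zero {p : ℝ} (hp : p < 2) :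
    Tendsto (rieszKernel p) (𝓝[>] 0) (𝓝 0) := by
  have h1 : rieszKernel p = fun t => t ^ (2 - p) := by ext t; simp [rieszKernel, hp]
  have := (Real.continuousAt_rpow_const 0 (2 - p) (Or.inr (by linarith))).tendsto
  rw [Real.zero_rpow (by linarith)] at this
  rw [h1]
  exact this.mono_left nhdsWithin_le_nhds

theorem tendsto_mul_nhdsGT {l : ℝ} (hl : 0 < l) :
    Tendsto (fun r : ℝ => l * r) (𝓝[>] 0) (𝓝[>] 0) := by
  refine tendsto_nhdsWithin_iff.2 ⟨?_, ?_⟩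
  · have : Continuous fun r : ℝ => l * r := by fun_prop
    simpa using (this.tendsto 0).mono_left nhdsWithin_le_nhds
  · filter_upwards [self_mem_nhdsWithin] with r hr using mul_pos hl hr

theorem tendsto_rieszKernel_mul_div (p : ℝ) {l : ℝ} (hl : 0 < l) :
    Tendsto (fun r => rieszKernel p (l * r) / rieszKernel p r) (𝓝[>] 0) (𝓝 (l ^ (2 - p))) := by
  rcases eq_or_ne p 2 with rfl | hp
  · have h1 := tendsto_rieszKernel_atBot (le_refl 2)
    have h2 : Tendsto (fun r => Real.log l / rieszKernel 2 r + 1) (𝓝[>] 0) (𝓝 (0 + 1)) :=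
      (h1.const_div_atBot _).add_const 1
    simp only [sub_self, Real.rpow_zero, zero_add] at h2 ⊢
    refine h2.congr' ?_
    filter_upwards [self_mem_nhdsWithin, h1.eventually_lt_atBot 0] with r hr hr'
    rw [div_add_one hr'.ne]
    congr 1
    rw [rieszKernel_two, Real.log_mul hl.ne' (ne_of_gt hr)]
  · refine tendsto_const_nhds.congr' ?_
    filter_upwards [self_mem_nhdsWithin] with r hr
    have hr' : 0 < r := hr
    have hne : rieszKernel p r ≠ 0 := by
      unfold rieszKernel
      split_ifs
      · exact (Real.rpow_pos_of_pos hr' _).ne'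
      · exact (neg_lt_zero.2 (one_div_pos.2 (Real.rpow_pos_of_pos hr' _))).ne
    rw [rieszKernel_mul hp hl hr', mul_div_cancel_right₀ _ hne]

/-- For `p ≥ 2` the kernel tends to `-∞`, so the additive constants in the slope bounds disappear
after division. -/
theorem HasSlopeAtZero.tendsto_div {p Θ : ℝ} {ψ : ℝ → ℝ} (h : HasSlopeAtZero p ψ Θ) (hp : 2 ≤ p) :
    Tendsto (fun r => ψ r / rieszKernel p r) (𝓝[>] 0) (𝓝 Θ) := by
  rw [Metric.tendsto_nhds]
  intro ε hε
  obtain ⟨δ, hδ, h1⟩ := h.2 (ε / 2) (by positivity)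
  set r := δ / 2 with hr
  set B := |ψ r - Θ * rieszKernel p r| + ε / 2 * |rieszKernel p r| with hB
  have hB0 : 0 ≤ B := by positivity
  filter_upwards [Ioo_mem_nhdsGT (show 0 < r by positivity),
    (tendsto_rieszKernel_atBot hp).eventually_lt_atBot (-(2 * B / ε) - 1)] with s hs hKs
  obtain ⟨h2, h3⟩ := h1 s r hs.1 hs.2 (by rw [hr]; linarith)
  have h4 : 0 ≤ 2 * B / ε := by positivity
  have hK0 : rieszKernel p s < 0 := by linarith
  have h5 : B < ε / 2 * (-rieszKernel p s) := by
    have h6 : 2 * B / ε < -rieszKernel p s := by linarith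
    rw [div_lt_iff₀ hε] at h6
    linarith
  have e1 : ψ s / rieszKernel p s - Θ = (ψ s - Θ * rieszKernel p s) / rieszKernel p s := by
    rw [sub_div, mul_div_cancel_right₀ _ hK0.ne]
  rw [Real.dist_eq, e1, abs_div, abs_of_neg hK0, div_lt_iff₀ (by linarith), abs_lt]
  have h7 := abs_le.1 (le_refl |ψ r - Θ * rieszKernel p r|)
  have h8 := mul_le_mul_of_nonneg_left (abs_le.1 (le_refl |rieszKernel p r|)).2
    (half_pos hε).le
  constructor <;> nlinarith

/-- For `p < 2` the kernel tends to `0`. Then `ψ`, being monotone and bounded below near `0`, has a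
limit `L`, and letting the smaller radius tend to `0` turns slopes into the quotients of `ψ - L` by
the kernel. -/
theorem HasSlopeAtZero.exists_tendsto_sub_div {p Θ : ℝ} {ψ : ℝ → ℝ} (h : HasSlopeAtZero p ψ Θ)
    (hp : p < 2) : ∃ L, Tendsto ψ (𝓝[>] 0) (𝓝 L) ∧
      Tendsto (fun r => (ψ r - L) / rieszKernel p r) (𝓝[>] 0) (𝓝 Θ) := by
  have hKpos : ∀ r, 0 < r → 0 < rieszKernel p r := fun r hr => by
    simp only [rieszKernel, hp, if_true]; exact Real.rpow_pos_of_pos hr _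
  obtain ⟨δ, hδ, h1⟩ := h.2 1 one_pos
  have hmono : MonotoneOn ψ (Ioo 0 δ) := fun s hs r hr hsr => by
    rcases hsr.eq_or_lt with rfl | hlt
    · exact le_rfl
    · have := (h1 s r hs.1 hlt hr.2).1
      have h2 := mul_nonneg h.1 (sub_pos.2 (rieszKernel_lt p hs.1 hlt)).le
      linarith
  have hbdd : BddBelow (ψ '' Ioo 0 δ) := by
    refine ⟨ψ (δ / 2) - (Θ + 1) * rieszKernel p (δ / 2), ?_⟩
    rintro _ ⟨s, hs, rfl⟩
    have hΘ := h.1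
    have h3 := hKpos (δ / 2) (by positivity)
    rcases lt_or_ge s (δ / 2) with hlt | hge
    · have h2 := (h1 s (δ / 2) hs.1 hlt (by linarith)).2
      have h4 := hKpos s hs.1
      nlinarith
    · have h2 := hmono ⟨by positivity, by linarith⟩ hs hge
      nlinarith
  have hlim := hmono.tendsto_nhdsWithin_Ioo_right (nonempty_Ioo.2 hδ) hbdd
  set L := sInf (ψ '' Ioo 0 δ)
  refine ⟨L, hlim, ?_⟩
  rw [Metric.tendsto_nhds]
  intro ε hε
  obtain ⟨η, hη, h2⟩ := h.2 (ε / 2) (by positivity)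
  filter_upwards [Ioo_mem_nhdsGT hη] with r hr
  have hKr := hKpos r hr.1
  have hK0 := tendsto_rieszKernel_zero hp
  have hev : ∀ᶠ s in 𝓝[>] (0 : ℝ), 0 < s ∧ s < r := Ioo_mem_nhdsGT hr.1
  have h3 : Θ * (rieszKernel p r - 0) ≤ ψ r - L :=
    le_of_tendsto_of_tendsto ((hK0.const_sub _).const_mul Θ) (hlim.const_sub _)
      (hev.mono fun s hs => (h2 s r hs.1 hs.2 hr.2).1)
  have h4 : ψ r - L ≤ (Θ + ε / 2) * (rieszKernel p r - 0) :=
    le_of_tendsto_of_tendsto (hlim.const_sub _) ((hK0.const_sub _).const_mul _)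
      (hev.mono fun s hs => (h2 s r hs.1 hs.2 hr.2).2)
  rw [sub_zero, ← le_div_iff₀ hKr] at h3
  rw [sub_zero, ← div_le_iff₀ hKr] at h4
  rw [Real.dist_eq, abs_lt]
  constructor <;> linarith

theorem integral_pow_mul_rpow [NeZero n] {p : ℝ} (hp : p ≤ n) :
    IntegrableOn (fun t : ℝ => t ^ (n - 1) * t ^ (2 - p)) (Ioc 0 1) ∧
      n * ∫ t in Ioc (0 : ℝ) 1, t ^ (n - 1) * t ^ (2 - p) = n / ((n : ℝ) - p + 2) := by
  have hn : ((n - 1 : ℕ) : ℝ) = n - 1 := by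
    rw [Nat.cast_sub (NeZero.one_le), Nat.cast_one]
  have h1 : ∀ t ∈ Ioc (0 : ℝ) 1, t ^ ((n : ℝ) + 1 - p) = t ^ (n - 1) * t ^ (2 - p) := fun t ht => by
    rw [← Real.rpow_natCast, hn, ← Real.rpow_add ht.1]
    congr 1; ring
  have h2 : IntegrableOn (fun t : ℝ => t ^ ((n : ℝ) + 1 - p)) (Ioc 0 1) := by
    rw [← intervalIntegrable_iff_integrableOn_Ioc_of_le zero_le_one]
    exact intervalIntegral.intervalIntegrable_rpow' (by linarith)
  refine ⟨h2.congr_fun h1 measurableSet_Ioc, ?_⟩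
  rw [← setIntegral_congr_fun measurableSet_Ioc h1,
    ← intervalIntegral.integral_of_le zero_le_one, integral_rpow (Or.inl (by linarith))]
  rw [Real.one_rpow, Real.zero_rpow (by linarith), sub_zero, mul_one_div]
  congr 1; ring

/-! ### Relations between the densities of the three means -/

namespace MeanData

variable {p ρ : ℝ} {M S V : ℝ → ℝ}

/-- By scaling, the slope bounds for `S` at radii `st < rt` carry the weight `t^(2-p)`; the factor
is `n ∫ t^(n-1) t^(2-p) dt` over `(0, 1]`. -/
theorem hasSlopeAtZero_volume [NeZero n] (h : MeanData n p ρ M S V) (hρ : 0 < ρ) (hp : p ≤ n)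
    {Θ : ℝ} (hS : HasSlopeAtZero p S Θ) :
    HasSlopeAtZero p V (n / ((n : ℝ) - p + 2) * Θ) := by
  have hn : (0 : ℝ) < n := by exact_mod_cast NeZero.pos n
  have hc : 0 < n / ((n : ℝ) - p + 2) := div_pos hn (by linarith)
  obtain ⟨hi, hI⟩ := integral_pow_mul_rpow (n := n) hp
  refine ⟨mul_nonneg hc.le hS.1, fun ε hε => ?_⟩
  obtain ⟨δ, hδ, hb⟩ := hS.2 (ε / (n / ((n : ℝ) - p + 2))) (by positivity)
  refine ⟨min δ ρ, lt_min hδ hρ, fun s r hs hsr hr => ?_⟩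
  have hrδ := hr.trans_le (min_le_left _ _)
  have hrρ := hr.trans_le (min_le_right _ _)
  have hr0 := hs.trans hsr
  have hsub : V r - V s = n * ∫ t in Ioc (0 : ℝ) 1, t ^ (n - 1) * (S (r * t) - S (s * t)) := by
    rw [h.volume_eq r hr0 hrρ, h.volume_eq s hs (hsr.trans hrρ), ← mul_sub,
      ← integral_sub (h.integrableOn r hr0 hrρ) (h.integrableOn s hs (hsr.trans hrρ))]
    simp only [mul_sub]
  have hint : IntegrableOn (fun t => t ^ (n - 1) * (S (r * t) - S (s * t))) (Ioc 0 1) := by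
    simp only [mul_sub]
    exact (h.integrableOn r hr0 hrρ).sub (h.integrableOn s hs (hsr.trans hrρ))
  have hconst : ∀ c : ℝ, n * ∫ t in Ioc (0 : ℝ) 1, t ^ (n - 1) * t ^ (2 - p) * c =
      n / ((n : ℝ) - p + 2) * c := fun c => by
    rw [integral_mul_const, ← mul_assoc, hI]
  have hpt : ∀ t ∈ Ioc (0 : ℝ) 1, _ := fun t ht => hb (s * t) (r * t) (mul_pos hs ht.1)
    (mul_lt_mul_of_pos_right hsr ht.1) (by nlinarith [ht.1, ht.2])
  have hscale : ∀ t ∈ Ioc (0 : ℝ) 1, rieszKernel p (r * t) - rieszKernel p (s * t) =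
      t ^ (2 - p) * (rieszKernel p r - rieszKernel p s) := fun t ht => by
    rw [mul_comm r, mul_comm s, rieszKernel_mul_sub p ht.1 hr0 hs]
  constructor
  · rw [hsub, mul_assoc, ← hconst]
    refine mul_le_mul_of_nonneg_left ?_ hn.le
    refine setIntegral_mono_on (hi.mul_const _) hint measurableSet_Ioc fun t ht => ?_
    have h1 := (hpt t ht).1
    rw [hscale t ht] at h1
    rw [mul_assoc, mul_left_comm (t ^ (2 - p))]
    exact mul_le_mul_of_nonneg_left h1 (pow_nonneg ht.1.le _)
  · have e1 : n / ((n : ℝ) - p + 2) * Θ + ε =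
        n / ((n : ℝ) - p + 2) * (Θ + ε / (n / ((n : ℝ) - p + 2))) := by
      rw [mul_add, mul_div_cancel₀ _ hc.ne']
    rw [hsub, e1, mul_assoc, ← hconst]
    refine mul_le_mul_of_nonneg_left ?_ hn.le
    refine setIntegral_mono_on hint (hi.mul_const _) measurableSet_Ioc fun t ht => ?_
    have h1 := (hpt t ht).2
    rw [hscale t ht] at h1
    rw [mul_assoc, mul_left_comm (t ^ (2 - p))]
    exact mul_le_mul_of_nonneg_left h1 (pow_nonneg ht.1.le _)

/-- The Harnack inequality and `S ≤ M` in the limit, for `p ≥ 2`. -/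
theorem density_le_of_two_le (h : MeanData n p ρ M S V) (hρ : 0 < ρ) (hp : 2 ≤ p)
    {ΘM ΘS ΘV : ℝ} (hM : HasSlopeAtZero p M ΘM) (hS : HasSlopeAtZero p S ΘS)
    (hV : HasSlopeAtZero p V ΘV) {l : ℝ} (hl : 0 < l) (hl' : l < 1 / 2) :
    ΘM ≤ ΘS ∧ ((1 - 2 * l) / (1 - l)) ^ n * ((1 - 2 * l) ^ (2 - p) * ΘV - ΘM) ≤
      l ^ (2 - p) * ΘM - ΘM := by
  have hK := tendsto_rieszKernel_atBot hp
  have hMd := hM.tendsto_div hp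
  have hSd := hS.tendsto_div hp
  have hmul : ∀ {ψ : ℝ → ℝ} {Θ a : ℝ}, HasSlopeAtZero p ψ Θ → 0 < a →
      Tendsto (fun r => ψ (a * r) / rieszKernel p r) (𝓝[>] 0) (𝓝 (a ^ (2 - p) * Θ)) := by
    intro ψ Θ a hψ ha
    refine ((tendsto_rieszKernel_mul_div p ha).mul
      ((hψ.tendsto_div hp).comp (tendsto_mul_nhdsGT ha))).congr' ?_
    filter_upwards [(hK.comp (tendsto_mul_nhdsGT ha)).eventually_lt_atBot 0] with r hr
    have hr' : rieszKernel p (a * r) ≠ 0 := ne_of_lt hr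
    simp only [Function.comp]
    rw [div_mul_div_comm, mul_comm (rieszKernel p r), mul_div_mul_left _ _ hr']
  have hev : ∀ᶠ r in 𝓝[>] (0 : ℝ), (0 < r ∧ r < ρ) ∧ rieszKernel p r < 0 :=
    Eventually.and (Ioo_mem_nhdsGT hρ) (hK.eventually_lt_atBot 0)
  constructor
  -- Near `0` the kernel is negative, so dividing by it reverses both `S ≤ M` and the Harnack
  -- inequality.
  · refine le_of_tendsto_of_tendsto hMd hSd (hev.mono fun r hr => ?_)
    exact div_le_div_of_nonpos_of_le hr.2.le (h.sphere_le_max r hr.1.1 hr.1.2)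
  · refine le_of_tendsto_of_tendsto (((hmul hV (show 0 < 1 - 2 * l by linarith)).sub hMd).const_mul
      (((1 - 2 * l) / (1 - l)) ^ n)) ((hmul hM hl).sub hMd) (hev.mono fun r hr => ?_)
    simp only [← sub_div, ← mul_div_assoc]
    exact div_le_div_of_nonpos_of_le hr.2.le (h.harnack r l hr.1.1 hr.1.2 hl hl')

/-- For `p < 2` the means must be normalised by their limits at `0`, which have to coincide. The
cycle is `LS ≤ LM` from `S ≤ M`, `LV ≤ LS` from the monotonicity of `S`, and `LM ≤ LV` from the
Harnack inequality in the limit. The kernel is positive, so the inequalities keep their direction.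
-/
theorem density_le_of_lt_two [NeZero n] (h : MeanData n p ρ M S V) (hρ : 0 < ρ) (hp : p < 2)
    {ΘM ΘS ΘV : ℝ} (hM : HasSlopeAtZero p M ΘM) (hS : HasSlopeAtZero p S ΘS)
    (hV : HasSlopeAtZero p V ΘV) {l : ℝ} (hl : 0 < l) (hl' : l < 1 / 2) :
    ΘS ≤ ΘM ∧ l ^ (2 - p) * ΘM - ΘM ≤
      ((1 - 2 * l) / (1 - l)) ^ n * ((1 - 2 * l) ^ (2 - p) * ΘV - ΘM) := by
  have hKpos : ∀ r, 0 < r → 0 < rieszKernel p r := fun r hr => by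
    simp only [rieszKernel, hp, if_true]; exact Real.rpow_pos_of_pos hr _
  obtain ⟨LM, hM0, hMd⟩ := hM.exists_tendsto_sub_div hp
  obtain ⟨LS, hS0, hSd⟩ := hS.exists_tendsto_sub_div hp
  obtain ⟨LV, hV0, hVd⟩ := hV.exists_tendsto_sub_div hp
  have hev : ∀ᶠ r in 𝓝[>] (0 : ℝ), 0 < r ∧ r < ρ := Ioo_mem_nhdsGT hρ
  have hc : 0 < ((1 - 2 * l) / (1 - l)) ^ n :=
    pow_pos (div_pos (by linarith) (by linarith)) n
  have hl1 : 0 < 1 - 2 * l := by linarith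
  have hSM : LS ≤ LM :=
    le_of_tendsto_of_tendsto hS0 hM0 (hev.mono fun r hr => h.sphere_le_max r hr.1 hr.2)
  have hVS : LV ≤ LS := by
    refine le_of_tendsto_of_tendsto hV0 hS0 (hev.mono fun r hr => ?_)
    rw [h.volume_eq r hr.1 hr.2, ← integral_pow_mul_const (n := n) (S r)]
    refine mul_le_mul_of_nonneg_left ?_ (Nat.cast_nonneg n)
    refine setIntegral_mono_on (h.integrableOn r hr.1 hr.2)
      ((continuous_pow _).mul continuous_const).integrableOn_Ioc measurableSet_Ioc fun t ht => ?_
    exact mul_le_mul_of_nonneg_left (h.sphereConvex.monotoneOn (mul_pos hr.1 ht.1)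
      (by nlinarith [ht.1, ht.2, hr.1]) hr.2) (pow_nonneg ht.1.le _)
  have hMV : LM ≤ LV := by
    have h1 : LM - LM ≤ ((1 - 2 * l) / (1 - l)) ^ n * (LV - LM) :=
      le_of_tendsto_of_tendsto ((hM0.comp (tendsto_mul_nhdsGT hl)).sub hM0)
        (((hV0.comp (tendsto_mul_nhdsGT hl1)).sub hM0).const_mul _)
        (hev.mono fun r hr => h.harnack r l hr.1 hr.2 hl hl')
    rw [sub_self] at h1
    linarith [nonneg_of_mul_nonneg_right h1 hc]
  obtain rfl : LS = LM := le_antisymm hSM (hMV.trans hVS)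
  obtain rfl : LV = LS := le_antisymm hVS hMV
  have hmul : ∀ {ψ : ℝ → ℝ} {Θ a : ℝ}, Tendsto (fun r => (ψ r - LV) / rieszKernel p r) (𝓝[>] 0)
      (𝓝 Θ) → 0 < a →
      Tendsto (fun r => (ψ (a * r) - LV) / rieszKernel p r) (𝓝[>] 0) (𝓝 (a ^ (2 - p) * Θ)) := by
    intro ψ Θ a hψ ha
    refine ((tendsto_rieszKernel_mul_div p ha).mul (hψ.comp (tendsto_mul_nhdsGT ha))).congr' ?_
    filter_upwards [self_mem_nhdsWithin] with r hr
    have hr' : rieszKernel p (a * r) ≠ 0 := (hKpos _ (mul_pos ha hr)).ne'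
    simp only [Function.comp]
    rw [div_mul_div_comm, mul_comm (rieszKernel p r), mul_div_mul_left _ _ hr']
  constructor
  · refine le_of_tendsto_of_tendsto hSd hMd (hev.mono fun r hr => ?_)
    exact div_le_div_of_nonneg_right (sub_le_sub_right (h.sphere_le_max r hr.1 hr.2) _)
      (hKpos r hr.1).le
  · refine le_of_tendsto_of_tendsto ((hmul hMd hl).sub hMd)
      (((hmul hVd hl1).sub hMd).const_mul _) (hev.mono fun r hr => ?_)
    simp only [← sub_div, ← mul_div_assoc, sub_sub_sub_cancel_right]
    exact div_le_div_of_nonneg_right (h.harnack r l hr.1 hr.2 hl hl') (hKpos r hr.1).le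

end MeanData

/-- By Bernoulli's inequality the `n`-th power is at least `1 - 2nl`, while `l^(2-p) = l · l^(1-p)`
exceeds `2nl` for small `l` precisely because `p > 1` makes `l^(1-p)` unbounded. -/
theorem exists_radius_ratio (n : ℕ) {p : ℝ} (hp : 1 < p) :
    ∃ l : ℝ, 0 < l ∧ l < 1 / 2 ∧ 0 < l ^ (2 - p) - 1 + ((1 - 2 * l) / (1 - l)) ^ n := by
  have h1 : Tendsto (fun l : ℝ => l ^ (1 - p)) (𝓝[>] 0) atTop := by
    have h2 : Tendsto (fun t : ℝ => t ^ (p - 1)) (𝓝[>] 0) (𝓝[>] 0) := by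
      refine tendsto_nhdsWithin_iff.2 ⟨?_, ?_⟩
      · have := (Real.continuousAt_rpow_const 0 (p - 1) (Or.inr (by linarith))).tendsto
        rw [Real.zero_rpow (by linarith)] at this
        exact this.mono_left nhdsWithin_le_nhds
      · filter_upwards [self_mem_nhdsWithin] with t ht using Real.rpow_pos_of_pos ht _
    refine (tendsto_inv_nhdsGT_zero.comp h2).congr' ?_
    filter_upwards [self_mem_nhdsWithin] with t ht
    rw [show 1 - p = -(p - 1) by ring, Real.rpow_neg (le_of_lt ht)]
    rfl
  obtain ⟨l, hl, hl2⟩ := (Eventually.and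
    (Ioo_mem_nhdsGT (show (0 : ℝ) < 1 / 2 by norm_num)) (h1.eventually_gt_atTop (2 * n))).exists
  refine ⟨l, hl.1, hl.2, ?_⟩
  have h3 : l ^ (2 - p) = l ^ (1 - p) * l := by
    rw [show 2 - p = 1 - p + 1 by ring, Real.rpow_add_one hl.1.ne']
  have h4 := one_add_mul_le_pow (a := -(l / (1 - l)))
    (by
      have : l / (1 - l) ≤ 1 := by rw [div_le_one (by linarith [hl.2])]; linarith [hl.2]
      linarith) n
  have h5 : 1 + -(l / (1 - l)) = (1 - 2 * l) / (1 - l) := by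
    have : 1 - l ≠ 0 := by linarith [hl.2]
    field_simp; ring
  have h6 : l / (1 - l) ≤ 2 * l := by
    rw [div_le_iff₀ (by linarith [hl.2])]; nlinarith [hl.1, hl.2]
  rw [h5] at h4
  have h7 : (n : ℝ) * (l / (1 - l)) ≤ n * (2 * l) := mul_le_mul_of_nonneg_left h6 (Nat.cast_nonneg n)
  have h8 : 2 * n * l < l ^ (1 - p) * l := mul_lt_mul_of_pos_right hl2 hl.1
  rw [h3]
  linarith

/-- The constant comparing the densities of the maximum and of the spherical average. -/
theorem exists_density_constant (n : ℕ) (p : ℝ) :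
    ∃ C : ℝ, 1 < C ∧ ∀ (ρ : ℝ) (M S V : ℝ → ℝ) (ΘM ΘS : ℝ), NeZero n → p ≤ n → 0 < ρ →
      MeanData n p ρ M S V → HasSlopeAtZero p M ΘM → HasSlopeAtZero p S ΘS →
      (2 < p → ΘM ≤ ΘS ∧ ΘS ≤ C * ΘM) ∧ (1 < p → p < 2 → ΘS ≤ ΘM ∧ ΘM ≤ C * ΘS) ∧
        (p = 2 → ΘM = ΘS) := by
  have hquarter : (0 : ℝ) < 1 / 4 ∧ (1 / 4 : ℝ) < 1 / 2 := by norm_num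
  have htwo : ∀ (ρ : ℝ) (M S V : ℝ → ℝ) (ΘM ΘS : ℝ), NeZero n → p ≤ n → 0 < ρ →
      MeanData n p ρ M S V → HasSlopeAtZero p M ΘM → HasSlopeAtZero p S ΘS → p = 2 → ΘM = ΘS := by
    intro ρ M S V ΘM ΘS hn hpn hρ hD hM hS hp
    have hV := hD.hasSlopeAtZero_volume hρ hpn hS
    obtain ⟨h1, h2⟩ := hD.density_le_of_two_le hρ hp.ge hM hS hV hquarter.1 hquarter.2
    -- For `p = 2` all powers are `1` and `ΘV = ΘS`, so the Harnack inequality reads `c(ΘS - ΘM) ≤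
    -- 0` with `c > 0`.
    refine le_antisymm h1 ?_
    have hn0 : (n : ℝ) ≠ 0 := by exact_mod_cast hn.ne
    rw [hp, sub_self, Real.rpow_zero, Real.rpow_zero, sub_add_cancel, div_self hn0] at h2
    have h3 : (0 : ℝ) < ((1 - 2 * (1 / 4)) / (1 - 1 / 4)) ^ n := by positivity
    nlinarith
  rcases lt_trichotomy p 2 with hp | hp | hp
  · by_cases hp1 : 1 < p
    swap
    -- For `p ≤ 1` no comparison is claimed, so any constant will do.
    · exact ⟨2, one_lt_two, fun ρ M S V ΘM ΘS hn hpn hρ hD hM hS =>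
        ⟨fun h => absurd h (by linarith), fun h => absurd h hp1,
          htwo ρ M S V ΘM ΘS hn hpn hρ hD hM hS⟩⟩
    obtain ⟨l, hl, hl', hpos⟩ := exists_radius_ratio n hp1
    set c := ((1 - 2 * l) / (1 - l)) ^ n
    set b := (1 - 2 * l) ^ (2 - p)
    set d := l ^ (2 - p) - 1 + c
    -- In the limit the Harnack inequality reads `d ΘM ≤ c b ΘV`, where `d > 0` by the choice of `l`
    -- and `ΘV = n/(n-p+2) ΘS`. The maximum with `2` only ensures a constant above `1`.
    refine ⟨max 2 (c * b * (n / ((n : ℝ) - p + 2)) / d), lt_max_of_lt_left one_lt_two,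
      fun ρ M S V ΘM ΘS hn hpn hρ hD hM hS => ⟨fun h => absurd h (by linarith), fun _ _ => ?_,
        htwo ρ M S V ΘM ΘS hn hpn hρ hD hM hS⟩⟩
    have hV := hD.hasSlopeAtZero_volume hρ hpn hS
    obtain ⟨h1, h2⟩ := hD.density_le_of_lt_two hρ hp hM hS hV hl hl'
    refine ⟨h1, ?_⟩
    have h3 : ΘM ≤ c * b * (n / ((n : ℝ) - p + 2)) / d * ΘS := by
      rw [div_mul_eq_mul_div, le_div_iff₀ hpos]
      nlinarith
    exact h3.trans (mul_le_mul_of_nonneg_right (le_max_right _ _) hS.1)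
  · exact ⟨2, one_lt_two, fun ρ M S V ΘM ΘS hn hpn hρ hD hM hS =>
      ⟨fun h => absurd h (by linarith), fun _ h => absurd h (by linarith),
        htwo ρ M S V ΘM ΘS hn hpn hρ hD hM hS⟩⟩
  · set c : ℝ := ((1 - 2 * (1 / 4)) / (1 - 1 / 4)) ^ n with hc
    set b : ℝ := (1 - 2 * (1 / 4)) ^ (2 - p) with hb
    have hc0 : 0 < c := by positivity
    have hb0 : 0 < b := Real.rpow_pos_of_pos (by norm_num) _
    -- For `p > 2` the inequality is reversed, `c b ΘV ≤ (l^(2-p) - 1 + c) ΘM`, and bounds `ΘV` for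
    -- every `l` in `(0, 1/2)`; here `l = 1/4`.
    refine ⟨max 2 (((1 / 4) ^ (2 - p) - 1 + c) / (c * b * (n / ((n : ℝ) - p + 2)))),
      lt_max_of_lt_left one_lt_two, fun ρ M S V ΘM ΘS hn hpn hρ hD hM hS => ⟨fun _ => ?_,
        fun _ h => absurd h (by linarith), htwo ρ M S V ΘM ΘS hn hpn hρ hD hM hS⟩⟩
    have hV := hD.hasSlopeAtZero_volume hρ hpn hS
    obtain ⟨h1, h2⟩ := hD.density_le_of_two_le hρ hp.le hM hS hV hquarter.1 hquarter.2
    refine ⟨h1, ?_⟩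
    have hn0 : (0 : ℝ) < n := by exact_mod_cast hn.pos
    have hd : 0 < n / ((n : ℝ) - p + 2) := div_pos hn0 (by linarith)
    have h3 : ΘS ≤ ((1 / 4) ^ (2 - p) - 1 + c) / (c * b * (n / ((n : ℝ) - p + 2))) * ΘM := by
      rw [div_mul_eq_mul_div, le_div_iff₀ (by positivity)]
      rw [← hc, ← hb] at h2
      nlinarith
    exact h3.trans (mul_le_mul_of_nonneg_right (le_max_right _ _) hM.1)

end

/-! ### Mass densities -/

/-- Integration by parts against a monotone function. -/
theorem integral_mul_deriv_nonneg {m g g' : ℝ → ℝ} {a b s r : ℝ} (ha : 0 < a) (has : a < s)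
    (hsr : s ≤ r) (hrb : r < b) (hm : MonotoneOn m (Icc a b))
    (hg : ∀ t, 0 < t → HasDerivAt g (g' t) t) (hg' : ContinuousOn g' (Ioi 0))
    (hg0 : ∀ t, 0 < t → g t ≤ 0) (hsupp : ∀ t, 0 < t → t ∉ Icc s r → g t = 0) :
    0 ≤ ∫ t in Icc a b, m t * g' t := by
  have hgc : ContinuousOn g (Ioi 0) := fun t ht => (hg t ht).continuousAt.continuousWithinAt
  have hmi : IntegrableOn m (Icc a b) := hm.integrableOn_isCompact isCompact_Icc
  have hsub : Icc s r ⊆ Icc a b := Icc_subset_Icc has.le hrb.le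
  have hpos : Icc s r ⊆ Ioi 0 := fun t ht => ha.trans (has.trans_le ht.1)
  have hab : Icc a b ⊆ Ioi 0 := fun t ht => ha.trans_le ht.1
  obtain ⟨C, hC⟩ := (isCompact_Icc (a := a) (b := b + 1)).exists_bound_of_continuousOn
    (hg'.mono fun t ht => ha.trans_le ht.1)
  -- Since `m` need not be continuous, `g'` is replaced by a difference quotient and the shift is
  -- moved onto `m`. The integrand becomes `(m(t-h) - m(t)) g(t)`, a product of two nonpositive
  -- factors, and `h → 0` is taken by dominated convergence.
  have hquot : ∀ h, 0 < h → h < s - a → 0 ≤ ∫ t in Icc a b, m t * (h⁻¹ * (g (t + h) - g t)) := by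
    intro h hh hhs
    have hshift : ContinuousOn (fun t => g (t + h)) (Icc a b) :=
      hgc.comp (by fun_prop) fun t ht => by
        have := ht.1
        rw [mem_Ioi]; linarith
    have hi1 : IntegrableOn (fun t => m t * g (t + h)) (Icc a b) :=
      hmi.mul_continuousOn hshift isCompact_Icc
    have hi2 : IntegrableOn (fun t => m t * g t) (Icc a b) :=
      hmi.mul_continuousOn (hgc.mono hab) isCompact_Icc
    have e1 : ∫ t in Icc a b, m t * g (t + h) = ∫ t in Icc s r, m (t - h) * g t := by
      rw [setIntegral_eq_of_subset_of_forall_sdiff_eq_zero measurableSet_Icc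
        (show Icc (s - h) (r - h) ⊆ Icc a b from Icc_subset_Icc (by linarith) (by linarith))
        fun t ht => ?_]
      · rw [integral_Icc_eq_integral_Ioc, integral_Icc_eq_integral_Ioc,
          ← intervalIntegral.integral_of_le (by linarith), ← intervalIntegral.integral_of_le hsr]
        have := intervalIntegral.integral_comp_add_right (a := s - h) (b := r - h)
          (fun t => m (t - h) * g t) h
        simpa using this
      · rw [hsupp (t + h) (by linarith [ht.1.1]) fun hmem => ht.2 ⟨by linarith [hmem.1],
          by linarith [hmem.2]⟩, mul_zero]
    have e2 : ∫ t in Icc a b, m t * g t = ∫ t in Icc s r, m t * g t :=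
      setIntegral_eq_of_subset_of_forall_sdiff_eq_zero measurableSet_Icc hsub fun t ht => by
        rw [hsupp t (hab ht.1) ht.2, mul_zero]
    have hmh : MonotoneOn (fun t => m (t - h)) (Icc s r) := fun x hx y hy hxy =>
      hm ⟨by linarith [hx.1], by linarith [hx.2]⟩ ⟨by linarith [hy.1], by linarith [hy.2]⟩
        (by linarith)
    have hi3 : IntegrableOn (fun t => m (t - h) * g t) (Icc s r) :=
      (hmh.integrableOn_isCompact isCompact_Icc).mul_continuousOn (hgc.mono hpos) isCompact_Icc
    have e3 : ∫ t in Icc a b, m t * (h⁻¹ * (g (t + h) - g t)) =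
        h⁻¹ * ∫ t in Icc s r, (m (t - h) * g t - m t * g t) := by
      rw [integral_sub hi3 (hi2.mono_set hsub), ← e1, ← e2, ← integral_sub hi1 hi2,
        ← integral_const_mul]
      congr 1
      ext t; ring
    rw [e3]
    refine mul_nonneg (inv_pos.2 hh).le (setIntegral_nonneg measurableSet_Icc fun t ht => ?_)
    rw [← sub_mul]
    refine mul_nonneg_of_nonpos_of_nonpos (sub_nonpos.2 (hm ?_ (hsub ht) (by linarith)))
      (hg0 t (hpos ht))
    exact ⟨by linarith [ht.1], by linarith [ht.2]⟩
  refine ge_of_tendsto (tendsto_integral_filter_of_dominated_convergence (l := 𝓝[>] (0 : ℝ))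
    (F := fun h t => m t * (h⁻¹ * (g (t + h) - g t))) (fun t => |m t| * C) ?_ ?_
    (hmi.abs.mul_const C) ?_) ?_
  · filter_upwards [self_mem_nhdsWithin] with h hh
    have hh' : (0 : ℝ) < h := hh
    have hshift : ContinuousOn (fun t => g (t + h)) (Icc a b) :=
      hgc.comp (by fun_prop) fun t ht => by
        have := ht.1
        rw [mem_Ioi]; linarith
    exact hmi.aestronglyMeasurable.mul ((continuousOn_const.mul
      (hshift.sub (hgc.mono hab))).aestronglyMeasurable measurableSet_Icc)
  · filter_upwards [Ioo_mem_nhdsGT (show (0 : ℝ) < 1 by norm_num)] with h hh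
    filter_upwards [ae_restrict_mem measurableSet_Icc] with t ht
    rw [norm_mul, Real.norm_eq_abs, Real.norm_eq_abs, abs_mul, abs_of_pos (inv_pos.2 hh.1)]
    refine mul_le_mul_of_nonneg_left ?_ (abs_nonneg _)
    rw [inv_mul_le_iff₀ hh.1]
    have h1 := (convex_Icc a (b + 1)).norm_image_sub_le_of_norm_hasDerivWithin_le
      (fun x hx => (hg x (ha.trans_le hx.1)).hasDerivWithinAt) hC
      (show t ∈ Icc a (b + 1) from ⟨ht.1, by linarith [ht.2]⟩)
      (show t + h ∈ Icc a (b + 1) from ⟨by linarith [ht.1, hh.1], by linarith [ht.2, hh.2]⟩)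
    rw [add_sub_cancel_left, Real.norm_eq_abs, Real.norm_eq_abs, abs_of_pos hh.1] at h1
    linarith
  · filter_upwards [ae_restrict_mem measurableSet_Icc] with t ht
    have := (hg t (hab ht)).tendsto_slope_zero_right
    simp only [smul_eq_mul] at this
    exact this.const_mul (m t)
  · filter_upwards [Ioo_mem_nhdsGT (show 0 < s - a by linarith)] with h hh
    exact hquot h hh.1 hh.2

/-! ### Radial cut-offs and their flux -/

/-- A smooth cut-off in the variable `|x|²`, which is `1` for `|x| ≤ s` and `0` for `|x| ≥ r`. -/
def cutoff (s r τ : ℝ) : ℝ := Real.smoothTransition ((r ^ 2 - τ) / (r ^ 2 - s ^ 2))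

section cutoff

variable {s r : ℝ}

theorem contDiff_cutoff (s r : ℝ) : ContDiff ℝ ∞ (cutoff s r) :=
  ContDiff.comp (g := Real.smoothTransition) Real.smoothTransition.contDiff
    ((contDiff_const.sub contDiff_id).div_const _)

theorem cutoff_nonneg (s r τ : ℝ) : 0 ≤ cutoff s r τ := Real.smoothTransition.nonneg _

theorem cutoff_le_one (s r τ : ℝ) : cutoff s r τ ≤ 1 := Real.smoothTransition.le_one _

theorem cutoff_eq_one (hs : 0 < s) (hsr : s < r) {τ : ℝ} (h : τ ≤ s ^ 2) : cutoff s r τ = 1 := by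
  have : 0 < r ^ 2 - s ^ 2 := by nlinarith
  refine Real.smoothTransition.one_of_one_le ?_
  rw [le_div_iff₀ this]; linarith

theorem cutoff_eq_zero (hs : 0 < s) (hsr : s < r) {τ : ℝ} (h : r ^ 2 ≤ τ) : cutoff s r τ = 0 := by
  have : 0 < r ^ 2 - s ^ 2 := by nlinarith
  exact Real.smoothTransition.zero_of_nonpos (div_nonpos_of_nonpos_of_nonneg (by linarith) this.le)

theorem antitone_cutoff (hs : 0 < s) (hsr : s < r) : Antitone (cutoff s r) := fun x y hxy => by
  have : 0 < r ^ 2 - s ^ 2 := by nlinarith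
  refine Real.smoothTransition.monotone ?_
  gcongr

theorem deriv_cutoff_eq_zero (hs : 0 < s) (hsr : s < r) {τ : ℝ} (h : τ < s ^ 2 ∨ r ^ 2 < τ) :
    deriv (cutoff s r) τ = 0 := by
  rcases h with h | h
  · have : cutoff s r =ᶠ[𝓝 τ] fun _ => 1 := by
      filter_upwards [eventually_lt_nhds h] with x hx using cutoff_eq_one hs hsr hx.le
    rw [this.deriv_eq, deriv_const]
  · have : cutoff s r =ᶠ[𝓝 τ] fun _ => 0 := by
      filter_upwards [eventually_gt_nhds h] with x hx using cutoff_eq_zero hs hsr hx.le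
    rw [this.deriv_eq, deriv_const]

theorem hasDerivAt_cutoff (s r τ : ℝ) : HasDerivAt (cutoff s r) (deriv (cutoff s r) τ) τ :=
  ((contDiff_cutoff s r).differentiable (by simp) τ).hasDerivAt

theorem contDiff_deriv_cutoff (s r : ℝ) : ContDiff ℝ ∞ (deriv (cutoff s r)) :=
  (contDiff_infty_iff_deriv.1 (contDiff_cutoff s r)).2

theorem hasDerivAt_deriv_cutoff (s r τ : ℝ) :
    HasDerivAt (deriv (cutoff s r)) (deriv (deriv (cutoff s r)) τ) τ :=
  ((contDiff_deriv_cutoff s r).differentiable (by simp) τ).hasDerivAt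

/-- The flux `t ^ (n - 1) χ'(t)` of the radial cut-off. -/
def flux (n : ℕ) (s r t : ℝ) : ℝ := 2 * t ^ n * deriv (cutoff s r) (t ^ 2)

/-- The derivative of the flux. -/
def fluxDeriv (n : ℕ) (s r t : ℝ) : ℝ := t ^ (n - 1) *
  (2 * n * deriv (cutoff s r) (t ^ 2) + 4 * t ^ 2 * deriv (deriv (cutoff s r)) (t ^ 2))

theorem hasDerivAt_flux [NeZero n] (s r t : ℝ) : HasDerivAt (flux n s r) (fluxDeriv n s r t) t := by
  have h1 := ((hasDerivAt_pow n t).const_mul 2).mul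
    ((hasDerivAt_deriv_cutoff s r (t ^ 2)).comp t (hasDerivAt_pow 2 t))
  refine h1.congr_deriv ?_
  obtain ⟨k, hk⟩ : ∃ k, n = k + 1 := ⟨n - 1, (Nat.succ_pred_eq_of_pos (NeZero.pos n)).symm⟩
  subst hk
  simp only [fluxDeriv, Function.comp, Nat.add_sub_cancel]
  push_cast
  ring

theorem continuous_fluxDeriv (n : ℕ) (s r : ℝ) : Continuous (fluxDeriv n s r) := by
  have h1 := (contDiff_deriv_cutoff s r).continuous
  have h2 : Continuous (deriv (deriv (cutoff s r))) :=
    (contDiff_infty_iff_deriv.1 (contDiff_deriv_cutoff s r)).2.continuous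
  unfold fluxDeriv
  fun_prop

theorem flux_nonpos (hs : 0 < s) (hsr : s < r) {t : ℝ} (ht : 0 < t) : flux n s r t ≤ 0 :=
  mul_nonpos_of_nonneg_of_nonpos (by positivity) ((antitone_cutoff hs hsr).deriv_nonpos)

theorem flux_eq_zero (hs : 0 < s) (hsr : s < r) {t : ℝ} (ht : 0 < t) (h : t ∉ Icc s r) :
    flux n s r t = 0 := by
  rw [flux, deriv_cutoff_eq_zero hs hsr, mul_zero]
  rw [mem_Icc, not_and_or, not_le, not_le] at h
  rcases h with h | h
  · left; gcongr
  · right; have := hs.trans hsr; gcongr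

/-- The pairing of the kernel with the derivative of the flux. -/
theorem integral_kernel_mul_fluxDeriv [NeZero n] {p : ℝ} (hp : p ≤ n) {a b : ℝ} (ha : 0 < a)
    (has : a < s) (hsr : s < r) (hrb : r < b) :
    kernelSlope p * s ^ ((n : ℝ) - p) ≤ ∫ t in Icc a b, rieszKernel p t * fluxDeriv n s r t ∧
      ∫ t in Icc a b, rieszKernel p t * fluxDeriv n s r t ≤ kernelSlope p * r ^ ((n : ℝ) - p) := by
  have hs := ha.trans has
  have hab : a ≤ b := (has.trans (hsr.trans hrb)).le
  have hpos : ∀ t ∈ uIcc a b, 0 < t := fun t ht => by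
    rw [uIcc_of_le hab] at ht; exact ha.trans_le ht.1
  have hKc : ContinuousOn (fun t => kernelSlope p * t ^ (1 - p)) (uIcc a b) := fun t ht =>
    (continuousAt_const.mul
      (Real.continuousAt_rpow_const t _ (Or.inl (hpos t ht).ne'))).continuousWithinAt
  have hparts := intervalIntegral.integral_mul_deriv_eq_deriv_mul (a := a) (b := b)
    (fun t ht => hasDerivAt_rieszKernel p (hpos t ht)) (fun t _ => hasDerivAt_flux (n := n) s r t)
    hKc.intervalIntegrable ((continuous_fluxDeriv n s r).intervalIntegrable _ _)
  rw [flux_eq_zero hs hsr ha fun h => absurd h.1 (not_le.2 has),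
    flux_eq_zero hs hsr (ha.trans_le hab) fun h => absurd h.2 (not_le.2 hrb), mul_zero, mul_zero,
    sub_zero, zero_sub] at hparts
  -- Minus the derivative of `t ↦ χ(t²)` is a probability density on `[s, r]`. After integration by
  -- parts the pairing is the mean of `kernelSlope p * t^(n-p)` for this density, hence lies between
  -- the values at `s` and `r`, as `p ≤ n`.
  let q : ℝ → ℝ := fun t => -(2 * t * deriv (cutoff s r) (t ^ 2))
  have hqc : Continuous q := by
    have h1 := (contDiff_deriv_cutoff s r).continuous
    fun_prop
  have hq0 : ∀ t, 0 < t → 0 ≤ q t := fun t ht => by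
    have h1 : deriv (cutoff s r) (t ^ 2) ≤ 0 := (antitone_cutoff hs hsr).deriv_nonpos
    simp only [q]; nlinarith
  have hq1 : ∀ t, 0 < t → t ∉ Icc s r → q t = 0 := fun t ht h => by
    have h1 := flux_eq_zero (n := 1) hs hsr ht h
    simp only [flux, pow_one] at h1
    simp only [q, h1, neg_zero]
  have hqI : ∫ t in a..b, q t = 1 := by
    have h1 : ∀ t ∈ uIcc a b, HasDerivAt (fun t => -cutoff s r (t ^ 2)) (q t) t := fun t _ => by
      have h2 := ((hasDerivAt_cutoff s r (t ^ 2)).comp t (hasDerivAt_pow 2 t)).neg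
      refine h2.congr_deriv ?_
      simp only [q]; push_cast; ring
    rw [intervalIntegral.integral_eq_sub_of_hasDerivAt h1 (hqc.intervalIntegrable _ _),
      cutoff_eq_one hs hsr (τ := a ^ 2) (by gcongr), cutoff_eq_zero hs hsr (τ := b ^ 2) (by
        have := hs.trans hsr
        gcongr)]
    ring
  have hkey : ∀ t, 0 < t → -(kernelSlope p * t ^ (1 - p) * flux n s r t) =
      kernelSlope p * t ^ ((n : ℝ) - p) * q t := fun t ht => by
    have h1 : t ^ (1 - p) * t ^ n = t ^ ((n : ℝ) - p) * t := by
      rw [← Real.rpow_natCast t n, ← Real.rpow_add ht, ← Real.rpow_add_one ht.ne']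
      congr 1; ring
    simp only [flux, q]
    linear_combination (-2 * kernelSlope p * deriv (cutoff s r) (t ^ 2)) * h1
  have hI : ∫ t in Icc a b, rieszKernel p t * fluxDeriv n s r t =
      ∫ t in Icc a b, kernelSlope p * t ^ ((n : ℝ) - p) * q t := by
    rw [integral_Icc_eq_integral_Ioc, ← intervalIntegral.integral_of_le hab, hparts,
      ← intervalIntegral.integral_neg, intervalIntegral.integral_of_le hab,
      ← integral_Icc_eq_integral_Ioc]
    exact setIntegral_congr_fun measurableSet_Icc fun t ht => hkey t (ha.trans_le ht.1)
  have hqI' : ∀ c : ℝ, ∫ t in Icc a b, c * q t = c := fun c => by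
    rw [integral_const_mul, integral_Icc_eq_integral_Ioc, ← intervalIntegral.integral_of_le hab,
      hqI, mul_one]
  have hint : IntegrableOn (fun t => kernelSlope p * t ^ ((n : ℝ) - p) * q t) (Icc a b) := by
    refine ContinuousOn.integrableOn_compact isCompact_Icc fun t ht => ?_
    exact ((continuousAt_const.mul (Real.continuousAt_rpow_const t _
      (Or.inl (ha.trans_le ht.1).ne'))).mul hqc.continuousAt).continuousWithinAt
  have hintc : ∀ c : ℝ, IntegrableOn (fun t => c * q t) (Icc a b) := fun c =>
    (continuous_const.mul hqc).continuousOn.integrableOn_compact isCompact_Icc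
  have hk := (kernelSlope_pos p).le
  rw [hI]
  constructor
  · rw [← hqI' (kernelSlope p * s ^ ((n : ℝ) - p))]
    refine setIntegral_mono_on (hintc _) hint measurableSet_Icc fun t ht => ?_
    have ht0 := ha.trans_le ht.1
    by_cases hmem : t ∈ Icc s r
    · refine mul_le_mul_of_nonneg_right (mul_le_mul_of_nonneg_left ?_ hk) (hq0 t ht0)
      exact Real.rpow_le_rpow hs.le hmem.1 (by linarith)
    · rw [hq1 t ht0 hmem, mul_zero, mul_zero]
  · rw [← hqI' (kernelSlope p * r ^ ((n : ℝ) - p))]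
    refine setIntegral_mono_on hint (hintc _) measurableSet_Icc fun t ht => ?_
    have ht0 := ha.trans_le ht.1
    by_cases hmem : t ∈ Icc s r
    · refine mul_le_mul_of_nonneg_right (mul_le_mul_of_nonneg_left ?_ hk) (hq0 t ht0)
      exact Real.rpow_le_rpow ht0.le hmem.2 (by linarith)
    · rw [hq1 t ht0 hmem, mul_zero, mul_zero]

/-- The pairing of a function of given slope with the derivative of the flux. -/
theorem integral_mul_fluxDeriv_bounds [NeZero n] {p : ℝ} (hp : p ≤ n) {S : ℝ → ℝ} {Θ Θ' δ : ℝ}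
    (hΘ : 0 ≤ Θ) (hΘ' : 0 ≤ Θ')
    (hb : ∀ s r, 0 < s → s < r → r < δ →
      Θ * (rieszKernel p r - rieszKernel p s) ≤ S r - S s ∧
        S r - S s ≤ Θ' * (rieszKernel p r - rieszKernel p s))
    {a b : ℝ} (ha : 0 < a) (has : a < s) (hsr : s < r) (hrb : r < b) (hbδ : b < δ) :
    kernelSlope p * Θ * s ^ ((n : ℝ) - p) ≤ ∫ t in Icc a b, S t * fluxDeriv n s r t ∧
      ∫ t in Icc a b, S t * fluxDeriv n s r t ≤ kernelSlope p * Θ' * r ^ ((n : ℝ) - p) := by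
  have hs := ha.trans has
  obtain ⟨h1, h2⟩ := integral_kernel_mul_fluxDeriv hp ha has hsr hrb
  have hcont := (continuous_fluxDeriv n s r).continuousOn (s := Icc a b)
  have hKi : IntegrableOn (fun t => rieszKernel p t * fluxDeriv n s r t) (Icc a b) :=
    ContinuousOn.integrableOn_compact isCompact_Icc fun t ht =>
      ((hasDerivAt_rieszKernel p (ha.trans_le ht.1)).continuousAt.mul
        (continuous_fluxDeriv n s r).continuousAt).continuousWithinAt
  -- The slope bounds say that `S - ΘK_p` and `Θ'K_p - S` are increasing; both therefore pair
  -- nonnegatively with the derivative of the flux.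
  have hm1 : MonotoneOn (fun t => S t - Θ * rieszKernel p t) (Icc a b) := fun x hx y hy hxy => by
    rcases hxy.eq_or_lt with rfl | hlt
    · exact le_rfl
    · have := (hb x y (ha.trans_le hx.1) hlt (hy.2.trans_lt hbδ)).1
      simp only; linarith
  have hm2 : MonotoneOn (fun t => Θ' * rieszKernel p t - S t) (Icc a b) := fun x hx y hy hxy => by
    rcases hxy.eq_or_lt with rfl | hlt
    · exact le_rfl
    · have := (hb x y (ha.trans_le hx.1) hlt (hy.2.trans_lt hbδ)).2
      simp only; linarith
  have hSi : IntegrableOn (fun t => S t * fluxDeriv n s r t) (Icc a b) := by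
    have h3 : IntegrableOn (fun t => (S t - Θ * rieszKernel p t) * fluxDeriv n s r t) (Icc a b) :=
      (hm1.integrableOn_isCompact isCompact_Icc).mul_continuousOn hcont isCompact_Icc
    refine (h3.add (hKi.const_mul Θ)).congr (Eventually.of_forall fun t => ?_)
    simp only [Pi.add_apply]; ring
  have hpos : ∀ m : ℝ → ℝ, MonotoneOn m (Icc a b) → 0 ≤ ∫ t in Icc a b, m t * fluxDeriv n s r t :=
    fun m hm => integral_mul_deriv_nonneg ha has hsr.le hrb hm (fun t _ => hasDerivAt_flux s r t)
      (continuous_fluxDeriv n s r).continuousOn (fun t ht => flux_nonpos hs hsr ht)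
      fun t ht h => flux_eq_zero hs hsr ht h
  have h3 := hpos _ hm1
  have h4 := hpos _ hm2
  simp only [sub_mul, mul_assoc] at h3 h4
  rw [integral_sub hSi (hKi.const_mul Θ), integral_const_mul] at h3
  rw [integral_sub (hKi.const_mul Θ') hSi, integral_const_mul] at h4
  constructor <;> nlinarith

end cutoff

/-! ### The mass of balls -/

/-- The radial cut-off about `x₀`. -/
def radialCutoff (x₀ : Eu n) (s r : ℝ) (x : Eu n) : ℝ := cutoff s r (‖x - x₀‖ ^ 2)

section radialCutoff

variable {x₀ : Eu n} {s r : ℝ}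

theorem contDiff_radialCutoff (x₀ : Eu n) (s r : ℝ) : ContDiff ℝ ∞ (radialCutoff x₀ s r) :=
  ContDiff.comp (g := cutoff s r) (contDiff_cutoff s r) ((contDiff_id.sub contDiff_const).norm_sq ℝ)

theorem radialCutoff_eq_one (hs : 0 < s) (hsr : s < r) {x : Eu n}
    (hx : x ∈ Metric.closedBall x₀ s) : radialCutoff x₀ s r x = 1 := by
  rw [Metric.mem_closedBall, dist_eq_norm] at hx
  exact cutoff_eq_one hs hsr (by gcongr)

theorem tsupport_radialCutoff_subset (hs : 0 < s) (hsr : s < r) :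
    tsupport (radialCutoff x₀ s r) ⊆ Metric.closedBall x₀ r := by
  refine closure_minimal (fun x hx => ?_) Metric.isClosed_closedBall
  by_contra h
  rw [Metric.mem_closedBall, dist_eq_norm, not_le] at h
  have := hs.trans hsr
  exact hx (cutoff_eq_zero hs hsr (by gcongr))

theorem trace_hessian_radialCutoff (x₀ y : Eu n) (s r : ℝ) :
    (hessian (radialCutoff x₀ s r) (x₀ + y)).trace = 2 * n * deriv (cutoff s r) (‖y‖ ^ 2) +
      4 * ‖y‖ ^ 2 * deriv (deriv (cutoff s r)) (‖y‖ ^ 2) := by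
  have h1 : hessian (radialCutoff x₀ s r) (x₀ + y) =
      hessian (fun y : Eu n => cutoff s r (‖y‖ ^ 2)) y := by
    ext i j
    simp only [hessian, Matrix.of_apply]
    have := iteratedFDeriv_comp_sub (𝕜 := ℝ) (f := fun y : Eu n => cutoff s r (‖y‖ ^ 2)) 2 x₀
      (x₀ + y)
    rw [add_sub_cancel_left] at this
    rw [← this]; rfl
  rw [h1, hessian_comp_normSq (Eventually.of_forall fun t => hasDerivAt_cutoff s r t)
    (hasDerivAt_deriv_cutoff s r _), Matrix.trace_add, Matrix.trace_smul, Matrix.trace_smul,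
    Matrix.trace_one, Matrix.trace_vecMulVec, EuclideanSpace.real_norm_sq_eq]
  simp only [dotProduct, smul_eq_mul, Fintype.card_fin, ← sq]
  ring

variable {u : Eu n → EReal} {X : Set (Eu n)}

/-- In polar coordinates the Laplacian of a radial cut-off times `t^(n-1)` is the derivative of the
flux, and the prefactor is the area of the sphere. That derivative vanishes outside `[s, r]`, so any
`[a, b]` containing it in its interior will do. -/
theorem integral_mul_trace_hessian_radialCutoff [NeZero n] (hloc : IsLocallyIntegrableOn u X)
    {a b : ℝ} (ha : 0 < a) (has : a < s) (hsr : s < r) (hrb : r < b)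
    (hrX : Metric.closedBall x₀ r ⊆ X) :
    ∫ x, (u x).toReal * (hessian (radialCutoff x₀ s r) x).trace =
      n * (volume : Measure (Eu n)).real (UBall n) *
        ∫ t in Icc a b, sphereMean u x₀ t * fluxDeriv n s r t := by
  have hs := ha.trans has
  have hsub := tsupport_radialCutoff_subset (x₀ := x₀) hs hsr
  have hi := integrable_mul_laplacian hloc (contDiff_radialCutoff x₀ s r)
    (HasCompactSupport.of_support_subset_isCompact (isCompact_closedBall x₀ r)
      ((subset_tsupport _).trans hsub)) (hsub.trans hrX)
  have hi' := hi.comp_add_left x₀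
  rw [← integral_add_left_eq_self _ x₀, integral_polar hi']
  have h1 : ∀ t ∈ Ioi (0 : ℝ), t ^ (n - 1) * ∫ σ : USphere n, (u (x₀ + t • (σ : Eu n))).toReal *
      (hessian (radialCutoff x₀ s r) (x₀ + t • (σ : Eu n))).trace ∂(sphereMeasure n) =
      n * (volume : Measure (Eu n)).real (UBall n) * (sphereMean u x₀ t * fluxDeriv n s r t) := by
    intro t ht
    have h2 : ∀ σ : USphere n, ‖t • (σ : Eu n)‖ = t := fun σ => by
      rw [norm_smul, norm_eq_of_mem_sphere, mul_one, Real.norm_of_nonneg (le_of_lt ht)]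
    have hne : (sphereMeasure n).real univ ≠ 0 := by
      rw [sphereMeasure_real_univ]
      exact mul_ne_zero (by exact_mod_cast NeZero.ne n) volume_ball_pos.ne'
    simp only [trace_hessian_radialCutoff, h2, integral_mul_const]
    rw [sphereMean, average_eq, smul_eq_mul, ← sphereMeasure_real_univ, fluxDeriv]
    field_simp
  rw [setIntegral_congr_fun measurableSet_Ioi h1, integral_const_mul]
  congr 1
  refine setIntegral_eq_of_subset_of_forall_sdiff_eq_zero measurableSet_Ioi
    (fun t ht => ha.trans_le ht.1) fun t ht => ?_
  have h3 : flux n s r =ᶠ[𝓝 t] fun _ => 0 := by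
    have ht0 : 0 < t := ht.1
    have ho : (Icc s r)ᶜ ∈ 𝓝 t := isClosed_Icc.isOpen_compl.mem_nhds fun h =>
      ht.2 ⟨has.le.trans h.1, h.2.trans hrb.le⟩
    filter_upwards [ho, eventually_gt_nhds ht0] with x hx hx0 using flux_eq_zero hs hsr hx0 hx
  have h4 := (hasDerivAt_flux (n := n) s r t).deriv
  rw [h3.deriv_eq, deriv_const] at h4
  rw [← h4, mul_zero]

/-- The cut-off lies between the indicators of the two closed balls. -/
theorem mass_bounds_radialCutoff (hs : 0 < s) (hsr : s < r) {μ : Measure (Eu n)}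
    (hμ : IsLaplacianOn u X μ) (hrX : Metric.closedBall x₀ r ⊆ X) :
    (μ (Metric.closedBall x₀ s)).toReal ≤
        ∫ x, (u x).toReal * (hessian (radialCutoff x₀ s r) x).trace ∧
      ∫ x, (u x).toReal * (hessian (radialCutoff x₀ s r) x).trace ≤
        (μ (Metric.closedBall x₀ r)).toReal := by
  have hsub := tsupport_radialCutoff_subset (x₀ := x₀) hs hsr
  have hr : μ (Metric.closedBall x₀ r) < ⊤ := hμ.finite_on_compacts _ (isCompact_closedBall x₀ r) hrX
  have hsb : μ (Metric.closedBall x₀ s) < ⊤ :=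
    (measure_mono (Metric.closedBall_subset_closedBall hsr.le)).trans_lt hr
  have h1 := hμ.integral_eq _ (contDiff_radialCutoff x₀ s r)
    (HasCompactSupport.of_support_subset_isCompact (isCompact_closedBall x₀ r)
      ((subset_tsupport _).trans hsub)) (hsub.trans hrX)
  simp only [laplacian_eq_trace_hessian] at h1
  have hms : MeasurableSet (Metric.closedBall x₀ s) := Metric.isClosed_closedBall.measurableSet
  have hmr : MeasurableSet (Metric.closedBall x₀ r) := Metric.isClosed_closedBall.measurableSet
  have hIs : Integrable ((Metric.closedBall x₀ s).indicator fun _ => (1 : ℝ)) μ :=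
    (integrableOn_const hsb.ne).integrable_indicator hms
  have hIr : Integrable ((Metric.closedBall x₀ r).indicator fun _ => (1 : ℝ)) μ :=
    (integrableOn_const hr.ne).integrable_indicator hmr
  have hle : ∀ x, radialCutoff x₀ s r x ≤ (Metric.closedBall x₀ r).indicator (fun _ => (1 : ℝ)) x :=
    fun x => by
      by_cases hx : x ∈ Metric.closedBall x₀ r
      · rw [indicator_of_mem hx]; exact cutoff_le_one _ _ _
      · rw [indicator_of_notMem hx, image_eq_zero_of_notMem_tsupport fun h => hx (hsub h)]
  have hge : ∀ x, (Metric.closedBall x₀ s).indicator (fun _ => (1 : ℝ)) x ≤ radialCutoff x₀ s r x :=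
    fun x => by
      by_cases hx : x ∈ Metric.closedBall x₀ s
      · rw [indicator_of_mem hx, radialCutoff_eq_one hs hsr hx]
      · rw [indicator_of_notMem hx]; exact cutoff_nonneg _ _ _
  have hIφ : Integrable (radialCutoff x₀ s r) μ :=
    hIr.mono' (contDiff_radialCutoff x₀ s r).continuous.aestronglyMeasurable
      (Eventually.of_forall fun x => by
        exact (Real.norm_of_nonneg (cutoff_nonneg s r _)).trans_le (hle x))
  have e1 := integral_mono hIs hIφ hge
  have e2 := integral_mono hIφ hIr hle
  rw [integral_indicator hms, setIntegral_const, smul_eq_mul, mul_one] at e1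
  rw [integral_indicator hmr, setIntegral_const, smul_eq_mul, mul_one] at e2
  rw [h1]
  exact ⟨e1, e2⟩

/-- The mass of the balls, in terms of the slope of the spherical average. -/
theorem mass_bounds [NeZero n] {p : ℝ} (hp : p ≤ n) (hloc : IsLocallyIntegrableOn u X)
    {μ : Measure (Eu n)} (hμ : IsLaplacianOn u X μ) {Θ Θ' δ : ℝ} (hΘ : 0 ≤ Θ) (hΘ' : 0 ≤ Θ')
    (hδX : Metric.closedBall x₀ δ ⊆ X)
    (hb : ∀ s r, 0 < s → s < r → r < δ →
      Θ * (rieszKernel p r - rieszKernel p s) ≤ sphereMean u x₀ r - sphereMean u x₀ s ∧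
        sphereMean u x₀ r - sphereMean u x₀ s ≤ Θ' * (rieszKernel p r - rieszKernel p s))
    (hr : 0 < r) (hrδ : r < δ) :
    n * (volume : Measure (Eu n)).real (UBall n) * kernelSlope p * Θ * r ^ ((n : ℝ) - p) ≤
        (μ (Metric.closedBall x₀ r)).toReal ∧
      (μ (Metric.closedBall x₀ r)).toReal ≤
        n * (volume : Measure (Eu n)).real (UBall n) * kernelSlope p * Θ' * r ^ ((n : ℝ) - p) := by
  set c := n * (volume : Measure (Eu n)).real (UBall n) with hc
  have hc0 : 0 ≤ c := by positivity
  have key : ∀ s t, 0 < s → s < t → t < δ →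
      c * kernelSlope p * Θ * s ^ ((n : ℝ) - p) ≤ (μ (Metric.closedBall x₀ t)).toReal ∧
        (μ (Metric.closedBall x₀ s)).toReal ≤ c * kernelSlope p * Θ' * t ^ ((n : ℝ) - p) := by
    intro s t hs hst htδ
    have htX : Metric.closedBall x₀ t ⊆ X :=
      (Metric.closedBall_subset_closedBall htδ.le).trans hδX
    obtain ⟨h1, h2⟩ := integral_mul_fluxDeriv_bounds hp hΘ hΘ' hb (half_pos hs) (half_lt_self hs)
      hst (left_lt_add_div_two.2 htδ) (add_div_two_lt_right.2 htδ)
    obtain ⟨h3, h4⟩ := mass_bounds_radialCutoff hs hst hμ htX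
    rw [integral_mul_trace_hessian_radialCutoff hloc (half_pos hs) (half_lt_self hs)
      hst (left_lt_add_div_two.2 htδ) htX, ← hc] at h3 h4
    constructor
    · refine le_trans ?_ h4
      rw [mul_assoc c, mul_assoc c]
      exact mul_le_mul_of_nonneg_left h1 hc0
    · refine h3.trans ?_
      rw [mul_assoc c, mul_assoc c]
      exact mul_le_mul_of_nonneg_left h2 hc0
  -- The bounds so far involve two different radii; continuity of `t^(n-p)` removes the gap, from
  -- the left for the lower bound and from the right for the upper one.
  have hcont : ∀ k : ℝ, ContinuousAt (fun t : ℝ => k * t ^ ((n : ℝ) - p)) r := fun k =>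
    continuousAt_const.mul (Real.continuousAt_rpow_const r _ (Or.inl hr.ne'))
  constructor
  · refine le_of_tendsto ((hcont (c * kernelSlope p * Θ)).continuousWithinAt (s := Iio r)) ?_
    filter_upwards [Ioo_mem_nhdsLT hr] with s hs using (key s r hs.1 hs.2 hrδ).1
  · refine ge_of_tendsto ((hcont (c * kernelSlope p * Θ')).continuousWithinAt (s := Ioi r)) ?_
    filter_upwards [Ioo_mem_nhdsGT hrδ] with t ht using (key r t hr ht.1 ht.2).2

theorem alpha_pos {k : ℝ} (hk : 0 ≤ k) : 0 < alpha k :=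
  div_pos (Real.rpow_pos_of_pos Real.pi_pos _) (Real.Gamma_pos_of_pos (by positivity))

theorem volume_ball_eq_alpha [NeZero n] : (volume : Measure (Eu n)).real (UBall n) = alpha n := by
  have : Nonempty (Fin n) := ⟨⟨0, NeZero.pos n⟩⟩
  rw [measureReal_def, UBall, EuclideanSpace.volume_closedBall, alpha]
  simp only [ENNReal.ofReal_one, one_pow, one_mul, Fintype.card_fin]
  rw [ENNReal.toReal_ofReal (by positivity), Real.sqrt_eq_rpow, ← Real.rpow_natCast,
    ← Real.rpow_mul Real.pi_pos.le]
  congr 2; ring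

/-- The mass density of the Laplacian. -/
theorem hasMassDensity [NeZero n] {p : ℝ} (hp : p ≤ n) (hloc : IsLocallyIntegrableOn u X)
    (hX : X ∈ 𝓝 x₀) {μ : Measure (Eu n)} (hμ : IsLaplacianOn u X μ) {Θ : ℝ}
    (hS : HasSlopeAtZero p (sphereMean u x₀) Θ) :
    HasMassDensity ((n : ℝ) - p) μ x₀
      (n * alpha n * kernelSlope p * Θ / alpha ((n : ℝ) - p)) := by
  have hα := alpha_pos (sub_nonneg.2 hp)
  have hn : (0 : ℝ) < n := by exact_mod_cast NeZero.pos n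
  set c := n * alpha n * kernelSlope p / alpha ((n : ℝ) - p) with hc
  have hc0 : 0 < c := div_pos (mul_pos (mul_pos hn (alpha_pos hn.le)) (kernelSlope_pos p)) hα
  have e : n * alpha n * kernelSlope p * Θ / alpha ((n : ℝ) - p) = c * Θ := by rw [hc]; ring
  rw [HasMassDensity, e, Metric.tendsto_nhds]
  intro ε hε
  obtain ⟨δ, hδ, hb⟩ := hS.2 (ε / (2 * c)) (by positivity)
  obtain ⟨ρ, hρ, hρX⟩ := Metric.nhds_basis_closedBall.mem_iff.1 hX
  filter_upwards [Ioo_mem_nhdsGT (lt_min hδ hρ)] with r hr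
  have hε' : 0 < ε / (2 * c) := by positivity
  obtain ⟨h1, h2⟩ := mass_bounds hp hloc hμ hS.1 (add_nonneg hS.1 hε'.le)
    ((Metric.closedBall_subset_closedBall (min_le_right δ ρ)).trans hρX)
    (fun s r hs hsr hr => hb s r hs hsr (hr.trans_le (min_le_left _ _))) hr.1 hr.2
  rw [volume_ball_eq_alpha] at h1 h2
  have hrp : 0 < r ^ ((n : ℝ) - p) := Real.rpow_pos_of_pos hr.1 _
  have e2 : c * (ε / (2 * c)) = ε / 2 := by field_simp
  have h3 : c * Θ ≤ (μ (Metric.closedBall x₀ r)).toReal / (alpha ((n : ℝ) - p) * r ^ ((n : ℝ) - p)) := by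
    rw [le_div_iff₀ (mul_pos hα hrp)]
    refine le_trans (le_of_eq ?_) h1
    rw [hc]; field_simp
  have h4 : (μ (Metric.closedBall x₀ r)).toReal / (alpha ((n : ℝ) - p) * r ^ ((n : ℝ) - p)) ≤
      c * (Θ + ε / (2 * c)) := by
    rw [div_le_iff₀ (mul_pos hα hrp)]
    refine h2.trans (le_of_eq ?_)
    rw [hc]; field_simp
  rw [mul_add, e2] at h4
  rw [Real.dist_eq, abs_lt]
  constructor <;> linarith

end radialCutoff

end RieszDensity

end

theorem proposition7p1 (n : ℕ) (p : ℝ) :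
    ∃ C : ℝ, 1 < C ∧
      ∀ F : Set (Matrix (Fin n) (Fin n) ℝ),
        RieszDensity.IsSubequation F → RieszDensity.IsConeSet F → RieszDensity.IsSTInvariant F →
        Convex ℝ F → RieszDensity.IsRieszCharacteristic F p →
      ∀ (X : Set (EuclideanSpace ℝ (Fin n))) (x₀ : EuclideanSpace ℝ (Fin n)),
        IsOpen X → IsConnected X → x₀ ∈ X →
      ∀ u : EuclideanSpace ℝ (Fin n) → EReal,
        RieszDensity.IsSubharmonicOn F u X → (∃ x ∈ X, u x ≠ ⊥) →
        -- the averages and the measure `Δu ≥ 0` are well defined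
        (∀ᶠ r in 𝓝[>] (0 : ℝ), RieszDensity.MeansFinite u x₀ r) ∧
        RieszDensity.IsLocallyIntegrableOn u X ∧
        (∃ μ : Measure (EuclideanSpace ℝ (Fin n)), RieszDensity.IsLaplacianOn u X μ) ∧
        ∀ μ : Measure (EuclideanSpace ℝ (Fin n)), RieszDensity.IsLaplacianOn u X μ →
          -- all the densities exist, and they are related as follows
          ∃ ΘM ΘS ΘV Θμ : ℝ,
            RieszDensity.HasRieszDensity p (RieszDensity.maxMean u x₀) ΘM ∧
            RieszDensity.HasRieszDensity p (RieszDensity.sphereMean u x₀) ΘS ∧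
            RieszDensity.HasRieszDensity p (RieszDensity.volumeMean u x₀) ΘV ∧
            RieszDensity.HasMassDensity ((n : ℝ) - p) μ x₀ Θμ ∧
            (p ≠ 2 →
              ΘS = ((n : ℝ) - p + 2) / n * ΘV ∧
              ΘS = RieszDensity.alpha ((n : ℝ) - p) /
                (n * |p - 2| * RieszDensity.alpha n) * Θμ) ∧
            (p = 2 →
              ΘS = ΘV ∧
              ΘS = RieszDensity.alpha ((n : ℝ) - 2) / (n * RieszDensity.alpha n) * Θμ) ∧
            (2 < p → ΘM ≤ ΘS ∧ ΘS ≤ C * ΘM) ∧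
            (1 < p → p < 2 → ΘS ≤ ΘM ∧ ΘM ≤ C * ΘS) ∧
            (p = 2 → ΘM = ΘS) := by
  obtain ⟨C, hC, hdens⟩ := RieszDensity.exists_density_constant n p
  refine ⟨C, hC, fun F hsub hcone hST hconv hriesz X x₀ hX hXc hx₀ u hu hne => ?_⟩
  have hF : RieszDensity.Admissible F p := ⟨hsub, hcone, hST, hconv, hriesz⟩
  obtain ⟨R⟩ := RieszDensity.exists_rotationFamily hsub.closed hST
  have hn := hF.ne_zero
  have hp := hF.le_dim
  have hloc := RieszDensity.isLocallyIntegrableOn hF R hu hX hXc hne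
  obtain ⟨ρ, hρ, hρX⟩ := Metric.nhds_basis_closedBall.mem_iff.1 (hX.mem_nhds hx₀)
  refine ⟨?_, hloc, RieszDensity.exists_isLaplacianOn hF R hu hX hloc, fun μ hμ => ?_⟩
  · filter_upwards [Ioo_mem_nhdsGT hρ] with r hr
    exact (RieszDensity.exists_approx hF R hu hX hloc hρX).1 r hr.1 hr.2
  have hD := RieszDensity.meanData hF R hu hX hloc hρ hρX
  obtain ⟨ΘM, hM⟩ := hD.maxConvex.exists_hasSlopeAtZero hρ
  obtain ⟨ΘS, hS⟩ := hD.sphereConvex.exists_hasSlopeAtZero hρ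
  obtain ⟨hd1, hd2, hd3⟩ := hdens ρ _ _ _ ΘM ΘS hn hp hρ hD hM hS
  have hn0 : (0 : ℝ) < n := by exact_mod_cast NeZero.pos n
  have hα := RieszDensity.alpha_pos (sub_nonneg.2 hp)
  have hαn := RieszDensity.alpha_pos hn0.le
  have hn2 : 0 < (n : ℝ) - p + 2 := by linarith
  -- The volume and mass densities are produced as explicit multiples of `ΘS`, so the relations
  -- among the three become algebraic identities.
  refine ⟨ΘM, ΘS, _, _, hM.hasRieszDensity, hS.hasRieszDensity,
    (hD.hasSlopeAtZero_volume hρ hp hS).hasRieszDensity,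
    RieszDensity.hasMassDensity hp hloc (hX.mem_nhds hx₀) hμ hS, fun h => ⟨?_, ?_⟩,
    fun h => ⟨?_, ?_⟩, hd1, hd2, hd3⟩
  · field_simp
  · have h0 : 0 < |p - 2| := abs_pos.2 (sub_ne_zero.2 h)
    rw [RieszDensity.kernelSlope, if_neg h]
    field_simp
  · rw [h, sub_add_cancel, div_self hn0.ne', one_mul]
  · subst h
    rw [RieszDensity.kernelSlope, if_pos rfl]
    field_simp
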